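/- Let $f:\mathbb{R}^n\times\mathbb{R}^q\to\mathbb{R}^n$ be $C^2$, $p\in\mathbb{R}^q$, $T>0$, $\rho$ irrational, and $\mathbb{S}=\mathbb{R}/\mathbb{Z}$. Let $F(t,x,p)$ be the (local) flow of $x'=f(x,p)$. Let $v:\mathbb{S}\times\mathbb{R}\to\mathbb{R}^n$ be $C^2$ with $$\partial_\tau v=Tf(v,p),\qquad v(\phi,\tau+1)=v(\phi+\rho,\tau),$$ and let $V$ solve $\partial_\tau V=T\partial_xf(v,p)V$, $V(\cdot,0)=I_n$. *Transversal stability.* Assume there is a continuous family of projections $q_{\mathrm{tg}}(\phi,\tau)$, $(\phi,\tau)\in\mathbb{S}\times\mathbb{R}$, of $\mathbb{R}^n$ onto $\mathrm{span}\{\partial_\tau v(\phi,\tau),\partial_\phi v(\phi,\tau)\}$ with $q_{\mathrm{tg}}(\phi,\tau+1)=q_{\mathrm{tg}}(\phi+\rho,\tau)$ and $q_{\mathrm{tg}}(\phi,\tau)V(\phi,\tau)=V(\phi,\tau)q_{\mathrm{tg}}(\phi,0)$, such that, with $q_{\mathrm{tr}}=I_n-q_{\mathrm{tg}}$, for each $\tau$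 the operator $\delta(\cdot)\mapsto V(\cdot-\rho,\tau+1)V^{-1}(\cdot-\rho,\tau)\delta(\cdot-\rho)-\delta(\cdot)$ is a bijection with bounded inverse on the space of continuous $\delta:\mathbb{S}\to\mathbb{R}^n$ with $q_{\mathrm{tr}}(\cdot,\tau)\delta=\delta$ (normal hyperbolicity), and such that $\|V(\phi,k)q_{\mathrm{tr}}(\phi,0)\|\le C_{\mathrm{tr}}e^{-k/\tau_{\mathrm{tr}}}$ for all $\phi$ and $k=0,1,2,\dots$, with constants $C_{\mathrm{tr}},\tau_{\mathrm{tr}}>0$. *Adjoint solutions.* Let $h=(h_1,h_2)$ be phase conditions with $h(v,p)=0$, whose derivative with respect to $v$ is $\delta_v\mapsto\int_{\mathbb{S}}\int_0^1\partial_vh\,\delta_v\,d\tau\,d\phi$ with a continuous kernel $\partial_vh(\phi,\tau)$, which have a derivative $\partial_ph$ with respect to $p$, and for which the $2\times2$ matrix $\int_{\mathbb{S}}\int_0^1\partial_vh\,[\partial_\tau v\ \ \partial_\phi v]\,d\tau\,d\phi$ is nonsingular. For given $(\eta_\rho,\eta_T)$ the adjoint conditions for $(\lambda_{\mathrm{de}},\lambda_{\mathrm{bc}},\lambda_{\mathrm{ps}},\eta_p)$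 are, for $\tau\in[0,1]$, $$-\partial_\tau\lambda_{\mathrm{de}}^{\mathsf T}-T\lambda_{\mathrm{de}}^{\mathsf T}\partial_xf(v,p)+\lambda_{\mathrm{ps}}^{\mathsf T}\partial_vh=0,\quad \lambda_{\mathrm{de}}(\phi,1)=\lambda_{\mathrm{bc}}(\phi),\quad \lambda_{\mathrm{de}}(\phi,0)=\lambda_{\mathrm{bc}}(\phi-\rho),$$ $$\int_{\mathbb{S}}\int_0^1\lambda_{\mathrm{de}}^{\mathsf T}f(v,p)\,d\tau\,d\phi=\eta_T,\qquad \int_{\mathbb{S}}\lambda_{\mathrm{bc}}^{\mathsf T}(\phi)\partial_\phi v(\phi+\rho,0)\,d\phi=-\eta_\rho,$$ $$-\int_{\mathbb{S}}\int_0^1\lambda_{\mathrm{de}}^{\mathsf T}T\partial_pf(v,p)\,d\tau\,d\phi+\eta_p^{\mathsf T}+\lambda_{\mathrm{ps}}^{\mathsf T}\partial_ph=0.$$ Let $\lambda_{\mathrm{de},T}$ and $\lambda_{\mathrm{de},\rho}$ be the continuous solutions $\lambda_{\mathrm{de}}$ for $(\eta_\rho,\eta_T)=(0,1)$ and $(1,0)$,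 extended to all $\tau$ by $\lambda_{\mathrm{de}}(\phi,\tau+1)=\lambda_{\mathrm{de}}(\phi+\rho,\tau)$; all angles $\phi$ below are lifted to $\mathbb{R}$. Then the following hold. 1. There are $\varepsilon_0,r,C>0$ such that for all $0<\varepsilon\le\varepsilon_0$, all continuous $\delta_{\mathrm{ode}}:[0,\infty)\to\mathbb{R}^n$ with $\|\delta_{\mathrm{ode}}\|\le\varepsilon$, all $(\phi_0,\sigma_0)$ and all $x_0$ with $\|x_0-v(\phi_0,\sigma_0)\|\le\varepsilon$: the problem $x'=Tf(x,p)+\delta_{\mathrm{ode}}(\tau)$, $x(0)=x_0$ has a solution on $[0,\infty)$, and for every such solution there are unique continuous $\varphi,\sigma:[0,\infty)\to\mathbb{R}$ with $|\varphi(0)-\phi_0|\le r$, $|\sigma(0)-\sigma_0|\le r$ such that $x_{\mathrm{tr}}(\tau):=x(\tau)-v(\varphi(\tau),\sigma(\tau))$ satisfies $\lambda_{\mathrm{de},T}^{\mathsf T}(\varphi,\sigma)x_{\mathrm{tr}}=\lambda_{\mathrm{de},\rho}^{\mathsf T}(\varphi,\sigma)x_{\mathrm{tr}}=0$ for all $\tau\ge0$;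 they are differentiable, and for all $\tau\ge0$ $$\|x_{\mathrm{tr}}\|\le C\varepsilon,\quad \bigl|\varphi'+\lambda_{\mathrm{de},\rho}^{\mathsf T}(\varphi,\sigma)\delta_{\mathrm{ode}}\bigr|\le C\varepsilon^2,\quad \bigl|\sigma'-1-\tfrac1T\lambda_{\mathrm{de},T}^{\mathsf T}(\varphi,\sigma)\delta_{\mathrm{ode}}\bigr|\le C\varepsilon^2.$$ 2. There are $d_0,C>0$ such that for all $(\phi_0,\sigma_0)$, all $\|\delta\|\le d_0$ and all $\tau\ge0$ the following flow values exist and $$\Bigl\|F(T\tau,v(\phi_0,\sigma_0)+\delta,p)-F\bigl(T\tau,v(\phi_0-\lambda_{\mathrm{de},\rho}^{\mathsf T}(\phi_0,\sigma_0)\delta,\ \sigma_0+\tfrac1T\lambda_{\mathrm{de},T}^{\mathsf T}(\phi_0,\sigma_0)\delta),p\bigr)\Bigr\|\le C\|\delta\|^2+Ce^{-\tau/\tau_{\mathrm{tr}}}.$$ 3. There are $d_0,r,C>0$ such that for all $(\phi_0,\sigma_0)$ and all $\|\delta\|\le d_0$ there is a unique pair $(\phi_*,\sigma_*)$ with $|\phi_*-\phi_0|\le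 r$, $|\sigma_*-\sigma_0|\le r$ (the asymptotic phases of $v(\phi_0,\sigma_0)+\delta$) for which $F(T\tau,v(\phi_0,\sigma_0)+\delta,p)$ exists for all $\tau\ge0$ and $F(T\tau,v(\phi_0,\sigma_0)+\delta,p)-F(T\tau,v(\phi_*,\sigma_*),p)\to0$ as $\tau\to\infty$; moreover $$\bigl|\phi_*-(\phi_0-\lambda_{\mathrm{de},\rho}^{\mathsf T}(\phi_0,\sigma_0)\delta)\bigr|\le C\|\delta\|^2,\qquad \bigl|\sigma_*-(\sigma_0+\tfrac1T\lambda_{\mathrm{de},T}^{\mathsf T}(\phi_0,\sigma_0)\delta)\bigr|\le C\|\delta\|^2.$$ -/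

import Mathlib

open Set Filter Topology

noncomputable section

/-- The Euclidean space `ℝⁿ`. -/
abbrev Vec (n : ℕ) : Type := EuclideanSpace ℝ (Fin n)

/-- `γ` solves `γ' = g(γ)` on the time interval between `0` and `t`, with `γ(0) = x₀`. -/
def IsTrajectory {n : ℕ} (g : Vec n → Vec n) (x₀ : Vec n) (t : ℝ) (γ : ℝ → Vec n) : Prop :=
  γ 0 = x₀ ∧ ∀ s ∈ uIcc 0 t, HasDerivWithinAt γ (g (γ s)) (uIcc 0 t) s

/-- The solution of `x' = g(x)` starting at `x₀` exists up to time `t`. -/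
def FlowDefined {n : ℕ} (g : Vec n → Vec n) (t : ℝ) (x₀ : Vec n) : Prop :=
  ∃ γ : ℝ → Vec n, IsTrajectory g x₀ t γ

open Classical in
/-- The (local) flow of `x' = g(x)`; its value is meaningful where `FlowDefined g t x₀` holds. -/
def flow {n : ℕ} (g : Vec n → Vec n) (t : ℝ) (x₀ : Vec n) : Vec n :=
  if H : FlowDefined g t x₀ then H.choose t else x₀

/-- The partial derivative in the first argument `φ`. -/
def dphi {n : ℕ} (v : ℝ → ℝ → Vec n) (φ τ : ℝ) : Vec n := deriv (fun s => v s τ) φ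

/-- The partial derivative in the second argument `τ`. -/
def dtau {n : ℕ} (v : ℝ → ℝ → Vec n) (φ τ : ℝ) : Vec n := deriv (fun s => v φ s) τ

/-- `v` solves the torus boundary-value problem `∂_τ v = T g(v)`, `v(φ, 1) = v(φ + ρ, 0)`.
Functions of `φ ∈ 𝕊 = ℝ/ℤ` are written as `1`-periodic functions on `ℝ`, and `v` is extended to all
`τ ∈ ℝ` by `v(φ, τ + 1) = v(φ + ρ, τ)`. -/
structure IsTorusSolution {n : ℕ} (g : Vec n → Vec n) (T ρ : ℝ) (v : ℝ → ℝ → Vec n) : Prop where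
  smooth : ContDiff ℝ 2 (Function.uncurry v)
  periodic : ∀ φ τ, v (φ + 1) τ = v φ τ
  ode : ∀ φ τ, HasDerivAt (fun s => v φ s) (T • g (v φ τ)) τ
  bc : ∀ φ τ, v φ (τ + 1) = v (φ + ρ) τ

/-- `V` solves the variational problem `∂_τ V = T ∂ₓg(v) V`, `V(·, 0) = I`. -/
structure IsVariationalSolution {n : ℕ} (g : Vec n → Vec n) (T : ℝ) (v : ℝ → ℝ → Vec n)
    (V : ℝ → ℝ → Vec n →L[ℝ] Vec n) : Prop where
  init : ∀ φ, V φ 0 = ContinuousLinearMap.id ℝ (Vec n)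
  ode : ∀ φ τ, HasDerivAt (fun s => V φ s) (T • (fderiv ℝ g (v φ τ) ∘L V φ τ)) τ

/-- The operator
`Γ_{ρ,τ} : δ ↦ V(· - ρ, τ + 1) V(· - ρ, τ)⁻¹ δ(· - ρ) - δ(·)`. -/
def gammaOp {n : ℕ} (V : ℝ → ℝ → Vec n →L[ℝ] Vec n) (ρ τ : ℝ) (d : ℝ → Vec n) : ℝ → Vec n :=
  fun φ => V (φ - ρ) (τ + 1) ((V (φ - ρ) τ).inverse (d (φ - ρ))) - d φ

/-- `d` is a continuous periodic perturbation with values in the kernel of the tangential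
projections at level `τ`, i.e. in the range of `q_tr(·, τ) = I - q_tg(·, τ)`. -/
def IsTransversal {n : ℕ} (qtg : ℝ → ℝ → Vec n →L[ℝ] Vec n) (τ : ℝ) (d : ℝ → Vec n) : Prop :=
  Continuous d ∧ (∀ φ, d (φ + 1) = d φ) ∧ ∀ φ, qtg φ τ (d φ) = 0

/-- Normal hyperbolicity of the torus, with variational solution `V` and tangential projections
`q_tg`: an invariant continuous family of projections onto the tangent spaces such that every
`Γ_{ρ,τ}` is a bijection with bounded inverse on the transversal perturbations. -/
structure IsNormallyHyperbolic {n : ℕ} (ρ : ℝ) (v : ℝ → ℝ → Vec n)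
    (V qtg : ℝ → ℝ → Vec n →L[ℝ] Vec n) : Prop where
  continuous : Continuous (Function.uncurry qtg)
  periodic : ∀ φ τ, qtg (φ + 1) τ = qtg φ τ
  idem : ∀ φ τ, qtg φ τ ∘L qtg φ τ = qtg φ τ
  range_eq : ∀ φ τ, LinearMap.range (qtg φ τ : Vec n →ₗ[ℝ] Vec n) =
    Submodule.span ℝ {dtau v φ τ, dphi v φ τ}
  shift : ∀ φ τ, qtg φ (τ + 1) = qtg (φ + ρ) τ
  invariant : ∀ φ τ, qtg φ τ ∘L V φ τ = V φ τ ∘L qtg φ 0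
  mapsTo : ∀ τ d, IsTransversal qtg τ d → IsTransversal qtg τ (gammaOp V ρ τ d)
  bijective : ∀ τ r, IsTransversal qtg τ r → ∃! d, IsTransversal qtg τ d ∧ gammaOp V ρ τ d = r
  bounded_inverse : ∀ τ, ∃ K : ℝ, ∀ d M, IsTransversal qtg τ d →
    (∀ φ, ‖gammaOp V ρ τ d φ‖ ≤ M) → ∀ φ, ‖d φ‖ ≤ K * M

/-- The torus is transversally stable with transversal time constant `τ_tr`:
it is normally hyperbolic and `‖V(·, k) q_tr(·, 0)‖ ≤ C_tr exp(-k / τ_tr)` for `k = 0, 1, 2, …`. -/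
def IsTransversallyStable {n : ℕ} (g : Vec n → Vec n) (T ρ : ℝ) (v : ℝ → ℝ → Vec n)
    (τtr : ℝ) : Prop :=
  0 < τtr ∧ ∃ V qtg : ℝ → ℝ → Vec n →L[ℝ] Vec n,
    IsVariationalSolution g T v V ∧ IsNormallyHyperbolic ρ v V qtg ∧
    ∃ Ctr > 0, ∀ (k : ℕ) (φ : ℝ),
      ‖V φ k ∘L (ContinuousLinearMap.id ℝ (Vec n) - qtg φ 0)‖ ≤ Ctr * Real.exp (-k / τtr)

/-- The pairing `∫_𝕊 ∫₀¹ a(φ, τ)ᵀ b(φ, τ) dτ dφ`. -/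
def pairing {n : ℕ} (a b : ℝ → ℝ → Vec n) : ℝ :=
  ∫ φ in (0 : ℝ)..1, ∫ τ in (0 : ℝ)..1, inner ℝ (a φ τ) (b φ τ)

/-- `h = (h₁, h₂)` is a pair of phase conditions satisfied by `(v, p)`, whose partial derivatives
at `(v, p)` are given by the kernels `∂ᵥh = Dv` and the vectors `∂ₚh = Dp`,
subject to the nondegeneracy condition on the two tangent directions. -/
structure IsPhaseCondition {n q : ℕ} (h : (ℝ → ℝ → Vec n) → Vec q → Fin 2 → ℝ)
    (v : ℝ → ℝ → Vec n) (p : Vec q) (Dv : Fin 2 → ℝ → ℝ → Vec n) (Dp : Fin 2 → Vec q) :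
    Prop where
  zero : ∀ i, h v p i = 0
  continuousOn : ∀ i, ContinuousOn (Function.uncurry (Dv i)) (univ ×ˢ Icc 0 1)
  periodic : ∀ i φ, ∀ τ ∈ Icc (0 : ℝ) 1, Dv i (φ + 1) τ = Dv i φ τ
  deriv_v : ∀ i (w : ℝ → ℝ → Vec n), ContDiff ℝ 1 (Function.uncurry w) →
    (∀ φ τ, w (φ + 1) τ = w φ τ) →
    HasDerivAt (fun s : ℝ => h (fun φ τ => v φ τ + s • w φ τ) p i) (pairing (Dv i) w) 0
  deriv_p : ∀ i, HasGradientAt (fun p' => h v p' i) (Dp i) p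
  nondegenerate : (Matrix.of fun i : Fin 2 =>
    ![pairing (Dv i) (dtau v), pairing (Dv i) (dphi v)]).det ≠ 0

/-- `(λ_de, λ_bc, λ_ps, η_p)` is a continuous solution of the adjoint conditions with the given
`η_ρ` and `η_T`; `λ_de` is extended to all `τ ∈ ℝ` by `λ_de(φ, τ + 1) = λ_de(φ + ρ, τ)`. -/
structure IsAdjointSolution {n q : ℕ} (f : Vec n → Vec q → Vec n) (p : Vec q) (T ρ : ℝ)
    (v : ℝ → ℝ → Vec n) (Dv : Fin 2 → ℝ → ℝ → Vec n) (Dp : Fin 2 → Vec q) (ηρ ηT : ℝ)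
    (lde : ℝ → ℝ → Vec n) (lbc : ℝ → Vec n) (lps : Fin 2 → ℝ) (ηp : Vec q) : Prop where
  continuous : Continuous (Function.uncurry lde)
  periodic : ∀ φ τ, lde (φ + 1) τ = lde φ τ
  shift : ∀ φ τ, lde φ (τ + 1) = lde (φ + ρ) τ
  var_v : ∀ φ, ∀ τ ∈ Icc (0 : ℝ) 1, HasDerivWithinAt (fun s => lde φ s)
    (-(T • ContinuousLinearMap.adjoint (fderiv ℝ (fun x => f x p) (v φ τ)) (lde φ τ))
      + ∑ i, lps i • Dv i φ τ) (Icc 0 1) τ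
  var_v1 : ∀ φ, lde φ 1 - lbc φ = 0
  var_v0 : ∀ φ, -lde φ 0 + lbc (φ - ρ) = 0
  var_T : -pairing lde (fun φ τ => f (v φ τ) p) + ηT = 0
  var_ρ : (∫ φ in (0 : ℝ)..1, inner ℝ (lbc φ) (dphi v (φ + ρ) 0)) + ηρ = 0
  var_p : ∀ w : Vec q, -pairing lde (fun φ τ => T • fderiv ℝ (fun p' => f (v φ τ) p') p w)
    + inner ℝ ηp w + ∑ i, lps i * inner ℝ (Dp i) w = 0

/-- `lde` is the `λ_de`-component of a continuous solution of the adjoint conditions. -/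
def IsAdjointFunction {n q : ℕ} (f : Vec n → Vec q → Vec n) (p : Vec q) (T ρ : ℝ)
    (v : ℝ → ℝ → Vec n) (Dv : Fin 2 → ℝ → ℝ → Vec n) (Dp : Fin 2 → Vec q) (ηρ ηT : ℝ)
    (lde : ℝ → ℝ → Vec n) : Prop :=
  ∃ (lbc : ℝ → Vec n) (lps : Fin 2 → ℝ) (ηp : Vec q),
    IsAdjointSolution f p T ρ v Dv Dp ηρ ηT lde lbc lps ηp

/-- `x` solves `x' = T g(x) + δ_ode(τ)` for all `τ ≥ 0`, with `x(0) = x₀`. -/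
def IsPerturbedTrajectory {n : ℕ} (g : Vec n → Vec n) (T : ℝ) (dode : ℝ → Vec n)
    (x₀ : Vec n) (x : ℝ → Vec n) : Prop :=
  x 0 = x₀ ∧ ∀ τ ∈ Ici (0 : ℝ), HasDerivWithinAt x (T • g (x τ) + dode τ) (Ici 0) τ

/-- `x(τ) = v(φ(τ), σ(τ)) + x_tr(τ)` for `τ ≥ 0`, where `φ`, `σ` are continuous and `x_tr(τ)` is
annihilated by `λ_{de,T}` and `λ_{de,ρ}` at `(φ(τ), σ(τ))`. -/
def IsPhaseDecomposition {n : ℕ} (v lT lρ : ℝ → ℝ → Vec n) (x : ℝ → Vec n) (φ σ : ℝ → ℝ) :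
    Prop :=
  ContinuousOn φ (Ici 0) ∧ ContinuousOn σ (Ici 0) ∧ ∀ τ ∈ Ici (0 : ℝ),
    inner ℝ (lT (φ τ) (σ τ)) (x τ - v (φ τ) (σ τ)) = 0 ∧
    inner ℝ (lρ (φ τ) (σ τ)) (x τ - v (φ τ) (σ τ)) = 0

/-- `(φ, σ)` are asymptotic phases of the point `x`: the trajectory of `x` exists for all forward
times and converges to the trajectory of `v(φ, σ)` on the torus. -/
def IsAsymptoticPhase {n : ℕ} (g : Vec n → Vec n) (T : ℝ) (v : ℝ → ℝ → Vec n) (x : Vec n)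
    (φ σ : ℝ) : Prop :=
  (∀ τ ≥ 0, FlowDefined g (T * τ) x) ∧
    Tendsto (fun τ => flow g (T * τ) x - flow g (T * τ) (v φ σ)) atTop (𝓝 0)

end

/-! Put Λ = (-λ_ρ, λ_T / T), a family of functionals on the universal cover of the torus. Pair the
adjoint equation with a tangent field of v and integrate over the torus: the boundary terms differ
by a rotation of φ and cancel, so the nondegenerate matrix forces λ_ps = 0
(`IsPhaseCondition.multiplier_eq_zero`). Both adjoint solutions therefore solve the homogeneous
adjoint variational equation for all τ. Their pairings with tangent vectors do not depend on τ,
hence by irrationality of ρ not on φ either, and the integral conditions fix the constants: Λ(b)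
Dv(b) = id. Pairings of Λ with all other variational solutions are conserved too, so decaying
solutions lie in ker Λ, and duality identifies ker Λ with the transversal bundle
(`AdjointFrame.norm_nat_le`).

The adjoint solutions are only assumed continuous in φ, whereas phase dynamics needs a derivative.
For y₀ in ker Λ(b), with decaying variational solution y, the value Λ(b + (h, 0)) y₀ is a convergent
integral along y in which the linearizations at the shifted and the unshifted base point are
subtracted (`AdjointFrame.apply_angle_eq_integral`). It is thus O(|h| ‖y₀‖) and differentiable at h
= 0. This yields a Lipschitz frame that is differentiable exactly where it is needed.

The phase of x is the solution b of Λ(b)(x - v(b)) = 0, a fixed point of b ↦ b + Λ(b)(x - v(b)).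
Over a fixed window of length m, the distance vector from the torus solution is a decaying
variational solution up to O(ε + z²), z being the initial distance. Choosing the phase anew after
each window contracts the distance by a factor θ < 1 up to O(ε)
(`PhaseFrame.exists_contracting_step`). Iterated with forcing, this gives a tube of width O(ε);
without forcing, phase corrections O(θ^(2k) z²) whose sum converges to the asymptotic phase, at
distance O(z²) from its linear prediction.

Differentiating Λ(b)(x - v(b)) = 0 in time gives the phase dynamics: the τ-derivative of Λ cancels
the term of first order in x - v(b), so only Λδ and terms of order ε² remain
(`PhaseFrame.exists_phase_dynamics`). Global existence comes from a cutoff of the vector field far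
from the torus, which the trajectories in question never notice. -/

/-! ### Abstract attracting torus with a frame of phase functionals. -/

/-- Quantitative data for an attracting two-dimensional torus `v` of `x' = T g(x)`: a Lipschitz
frame `Λ` of functionals dual to the tangent vectors, invariant under the adjoint variational
equation, with exponential decay on its kernel. -/
structure PhaseFrame {X : Type*} [NormedAddCommGroup X] [NormedSpace ℝ X] (g : X → X) (T τtr : ℝ)
    (v : ℝ × ℝ → X) (A : ℝ × ℝ → X →L[ℝ] X) (Λ : ℝ × ℝ → X →L[ℝ] ℝ × ℝ) (K : ℝ) : Prop where
  T_pos : 0 < T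
  τ_pos : 0 < τtr
  one_le : 1 ≤ K
  ode : ∀ b s, HasDerivAt (fun s : ℝ => v (b + (0, s))) (T • g (v (b + (0, s)))) s
  v_lip : ∀ b b', ‖v b' - v b‖ ≤ K * ‖b' - b‖
  frame_norm : ∀ b, ‖Λ b‖ ≤ K
  frame_tangent : ∀ b b', ‖Λ b (v b' - v b) - (b' - b)‖ ≤ K * ‖b' - b‖ ^ 2
  frame_field : ∀ b, T • Λ b (g (v b)) = (0, 1)
  frame_lip : ∀ b b', ‖Λ b' - Λ b‖ ≤ K * ‖b' - b‖
  g_lip : ∀ x y, ‖g x - g y‖ ≤ K * ‖x - y‖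
  g_taylor : ∀ b x, ‖g x - g (v b) - A b (x - v b)‖ ≤ K * ‖x - v b‖ ^ 2
  A_norm : ∀ b, ‖A b‖ ≤ K
  transversal : ∀ b y₀, Λ b y₀ = 0 → ∃ y : ℝ → X, y 0 = y₀ ∧
    (∀ s, HasDerivAt y (T • A (b + (0, s)) (y s)) s) ∧
    ∀ s ≥ 0, Λ (b + (0, s)) (y s) = 0 ∧ ‖y s‖ ≤ K * Real.exp (-s / τtr) * ‖y₀‖
  differentiable : ∀ b y₀, Λ b y₀ = 0 → ∃ D : ℝ × ℝ →L[ℝ] ℝ × ℝ,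
    HasFDerivAt (fun b' => Λ b' y₀) D b ∧ D (0, 1) = -(T • Λ b (A b y₀))

/-- `x` solves `x' = T g(x) + δ_ode(τ)` for all `τ ≥ 0`. -/
def IsForcedSolution {X : Type*} [NormedAddCommGroup X] [NormedSpace ℝ X] (g : X → X) (T : ℝ)
    (dode : ℝ → X) (x : ℝ → X) : Prop :=
  ∀ τ ∈ Ici (0 : ℝ), HasDerivWithinAt x (T • g (x τ) + dode τ) (Ici 0) τ

/-- Gronwall's inequality with a crude constant, symmetric in the initial error and the
inhomogeneity so that the two can be treated as one. -/
theorem norm_le_exp_mul_of_norm_deriv_le {X : Type*} [NormedAddCommGroup X] [NormedSpace ℝ X]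
    {u u' : ℝ → X} {κ δ ε S : ℝ} (hκ : 0 < κ) (hδ : 0 ≤ δ) (hε : 0 ≤ ε)
    (hu : ∀ s ≥ 0, HasDerivWithinAt u (u' s) (Ici 0) s) (h0 : ‖u 0‖ ≤ δ)
    (bound : ∀ s ∈ Ico 0 S, ‖u' s‖ ≤ κ * ‖u s‖ + ε) :
    ∀ s ∈ Icc 0 S, ‖u s‖ ≤ Real.exp (κ * S) * (1 + 1 / κ) * (δ + ε) := by
  intro s hs
  have h1 := norm_le_gronwallBound_of_norm_deriv_right_le (f := u) (f' := u') (δ := δ) (K := κ)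
    (ε := ε) (a := 0) (b := S)
    (fun t ht => ((hu t ht.1).continuousWithinAt.mono Icc_subset_Ici_self))
    (fun t ht => (hu t ht.1).mono (Ici_subset_Ici.2 ht.1)) h0 bound s hs
  refine h1.trans ?_
  rw [gronwallBound_of_K_ne_0 hκ.ne', sub_zero]
  have h2 : Real.exp (κ * s) ≤ Real.exp (κ * S) :=
    Real.exp_le_exp.2 (mul_le_mul_of_nonneg_left hs.2 hκ.le)
  have h3 : 0 < Real.exp (κ * S) := Real.exp_pos _
  have h4 : ε / κ * (Real.exp (κ * s) - 1) ≤ ε / κ * Real.exp (κ * S) :=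
    mul_le_mul_of_nonneg_left (by linarith) (by positivity)
  have h5 : δ * Real.exp (κ * s) ≤ δ * Real.exp (κ * S) := mul_le_mul_of_nonneg_left h2 hδ
  have h6 : Real.exp (κ * S) * (1 + 1 / κ) * (δ + ε) =
      δ * Real.exp (κ * S) + ε / κ * Real.exp (κ * S) +
      (ε * Real.exp (κ * S) + δ / κ * Real.exp (κ * S)) := by ring
  have h7 : 0 ≤ ε * Real.exp (κ * S) + δ / κ * Real.exp (κ * S) := by positivity
  simp only
  linarith

/-! ### Phases of points near the torus. -/

namespace PhaseFrame

variable {X : Type*} [NormedAddCommGroup X] [NormedSpace ℝ X] {g : X → X} {T τtr : ℝ}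
    {v : ℝ × ℝ → X} {A : ℝ × ℝ → X →L[ℝ] X} {Λ : ℝ × ℝ → X →L[ℝ] ℝ × ℝ} {K : ℝ}

theorem K_pos (F : PhaseFrame g T τtr v A Λ K) : 0 < K := zero_lt_one.trans_le F.one_le

theorem norm_frame_apply_le (F : PhaseFrame g T τtr v A Λ K) (b : ℝ × ℝ) (y : X) :
    ‖Λ b y‖ ≤ K * ‖y‖ :=
  (Λ b).le_of_opNorm_le (F.frame_norm b) y

theorem norm_frame_sub_apply_le (F : PhaseFrame g T τtr v A Λ K) (b b' : ℝ × ℝ) (y : X) :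
    ‖Λ b' y - Λ b y‖ ≤ K * ‖b' - b‖ * ‖y‖ :=
  (Λ b' - Λ b).le_of_opNorm_le (F.frame_lip _ _) y

/-- The map whose fixed points are the phases of `x` is nearly constant close to the torus. -/
theorem norm_phaseMap_sub_le (F : PhaseFrame g T τtr v A Λ K) (x : X) (b b' : ℝ × ℝ) :
    ‖(b' + Λ b' (x - v b')) - (b + Λ b (x - v b))‖ ≤
      K * ‖b' - b‖ * ‖x - v b'‖ + K * ‖b' - b‖ ^ 2 := by
  have e : (b' + Λ b' (x - v b')) - (b + Λ b (x - v b)) =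
      (Λ b' (x - v b') - Λ b (x - v b')) - (Λ b (v b' - v b) - (b' - b)) := by
    have : Λ b (x - v b) = Λ b (x - v b') + Λ b (v b' - v b) := by
      rw [← map_add]; congr 1; abel
    rw [this]; abel
  rw [e]
  exact (norm_sub_le _ _).trans
    (add_le_add (F.norm_frame_sub_apply_le b b' _) (F.frame_tangent _ _))

/-- Points close to the torus have phases. -/
theorem exists_phase (F : PhaseFrame g T τtr v A Λ K) (a : ℝ × ℝ) (x : X)
    (hx : ‖x - v a‖ ≤ 1 / (16 * K ^ 3)) :
    ∃ b, Λ b (x - v b) = 0 ∧ ‖b - a‖ ≤ 2 * ‖Λ a (x - v a)‖ ∧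
      ‖b - a - Λ a (x - v a)‖ ≤ 8 * K ^ 3 * ‖x - v a‖ ^ 2 := by
  have hK := F.K_pos
  have hK1 := F.one_le
  -- On the ball of radius `R` the map `H` below has Lipschitz constant 1/2, and the bound 1/(16K³)
  -- on the distance makes it move the centre by at most R/2; so it maps the ball into itself.
  set R : ℝ := 1 / (8 * K ^ 2) with hR
  have hRpos : 0 < R := by positivity
  have hd : K * (1 / (16 * K ^ 3)) = R / 2 := by rw [hR]; field_simp; norm_num
  have hKR : K * R ≤ 1 / 8 := by
    rw [hR]; rw [show K * (1 / (8 * K ^ 2)) = 1 / 8 * (1 / K) by field_simp]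
    have : 1 / K ≤ 1 := by rw [div_le_one hK]; exact hK1
    linarith
  have hKKR : K * (K * R) = 1 / 8 := by rw [hR]; field_simp
  have hRle : R ≤ 1 / 8 := by nlinarith
  set H : ℝ × ℝ → ℝ × ℝ := fun b => b + Λ b (x - v b) with hH
  have hKx : K * ‖x - v a‖ ≤ R / 2 := by
    rw [← hd]; exact mul_le_mul_of_nonneg_left hx hK.le
  have key : ∀ b ∈ Metric.closedBall a R, ∀ b' ∈ Metric.closedBall a R,
      ‖H b' - H b‖ ≤ 1 / 2 * ‖b' - b‖ := by
    intro b hb b' hb'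
    rw [mem_closedBall_iff_norm] at hb hb'
    refine (F.norm_phaseMap_sub_le x b b').trans ?_
    have h1 : ‖x - v b'‖ ≤ ‖x - v a‖ + K * R := by
      have : x - v b' = (x - v a) - (v b' - v a) := by abel
      rw [this]
      refine (norm_sub_le _ _).trans (add_le_add le_rfl ?_)
      exact (F.v_lip a b').trans (mul_le_mul_of_nonneg_left hb' hK.le)
    have h2 : ‖b' - b‖ ≤ 2 * R := by
      have : b' - b = (b' - a) - (b - a) := by abel
      rw [this]
      exact (norm_sub_le _ _).trans (by linarith)
    have h3 : K * ‖x - v b'‖ ≤ R / 2 + 1 / 8 := by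
      have := mul_le_mul_of_nonneg_left h1 hK.le
      rw [mul_add, hKKR] at this
      linarith
    have h4 : K * ‖b' - b‖ ≤ 1 / 4 := by
      have := mul_le_mul_of_nonneg_left h2 hK.le
      linarith
    have h0 := norm_nonneg (b' - b)
    nlinarith
  have haball : a ∈ Metric.closedBall a R := Metric.mem_closedBall_self hRpos.le
  have hHa : H a - a = Λ a (x - v a) := by simp [hH]
  have hmaps : MapsTo H (Metric.closedBall a R) (Metric.closedBall a R) := by
    intro b hb
    have h1 := key a haball b hb
    rw [mem_closedBall_iff_norm] at hb ⊢
    have : H b - a = (H b - H a) + Λ a (x - v a) := by rw [← hHa]; abel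
    rw [this]
    refine (norm_add_le _ _).trans ?_
    have := F.norm_frame_apply_le a (x - v a)
    linarith
  have hcontr : ContractingWith (1 / 2 : NNReal) (hmaps.restrict H _ _) := by
    refine ⟨by rw [← NNReal.coe_lt_coe]; push_cast; norm_num, ?_⟩
    refine LipschitzWith.of_dist_le_mul fun b b' => ?_
    rw [Subtype.dist_eq, Subtype.dist_eq, dist_eq_norm, dist_eq_norm]
    simpa using key b' b'.2 b b.2
  obtain ⟨b, hb, hfix, -⟩ := hcontr.exists_fixedPoint' Metric.isClosed_closedBall.isComplete hmaps
    haball (edist_ne_top _ _)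
  have hfix' : H b = b := hfix
  have hb0 : Λ b (x - v b) = 0 := by simpa [hH] using hfix'
  have hk := key a haball b hb
  have e1 : b - a - Λ a (x - v a) = H b - H a := by rw [hfix', ← hHa]; abel
  have hba : ‖b - a‖ ≤ 2 * ‖Λ a (x - v a)‖ := by
    have : b - a = (H b - H a) + Λ a (x - v a) := by rw [← e1]; abel
    have h2 := norm_add_le (H b - H a) (Λ a (x - v a))
    rw [← this] at h2
    linarith
  refine ⟨b, hb0, hba, ?_⟩
  -- The contraction estimate would only give a linear bound here. The sharp estimate is applied
  -- with the roles exchanged, so that its distance factor is the known one at `a`.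
  rw [e1, ← norm_neg, neg_sub]
  refine (F.norm_phaseMap_sub_le x b a).trans ?_
  have hba' : ‖a - b‖ ≤ 2 * K * ‖x - v a‖ := by
    rw [← norm_neg, neg_sub]
    have := F.norm_frame_apply_le a (x - v a)
    linarith
  have h0 := norm_nonneg (x - v a)
  calc K * ‖a - b‖ * ‖x - v a‖ + K * ‖a - b‖ ^ 2
      ≤ K * (2 * K * ‖x - v a‖) * ‖x - v a‖ + K * (2 * K * ‖x - v a‖) ^ 2 := by gcongr
    _ = (2 * K ^ 2 + 4 * K ^ 3) * ‖x - v a‖ ^ 2 := by ring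
    _ ≤ 8 * K ^ 3 * ‖x - v a‖ ^ 2 := by
      gcongr
      nlinarith [pow_le_pow_right₀ hK1 (show 2 ≤ 3 by norm_num)]

/-- Phases depend in a Lipschitz way on the point, and are locally unique. -/
theorem norm_phase_sub_le (F : PhaseFrame g T τtr v A Λ K) {x x' : X} {b b' : ℝ × ℝ}
    (hb : Λ b (x - v b) = 0) (hb' : Λ b' (x' - v b') = 0) (hbb : ‖b' - b‖ ≤ 1 / (4 * K))
    (hx : ‖x - v b‖ ≤ 1 / (4 * K)) : ‖b' - b‖ ≤ 2 * K * ‖x' - x‖ := by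
  have hK := F.K_pos
  have e : b' - b = Λ b' (x' - x) + (Λ b' (x - v b) - Λ b (x - v b))
      + (Λ b' (v b - v b') - (b - b')) := by
    have : Λ b' (x' - v b') = Λ b' (x' - x) + Λ b' (x - v b) + Λ b' (v b - v b') := by
      rw [← map_add, ← map_add]; congr 1; abel
    rw [hb, sub_zero]
    rw [this] at hb'
    rw [← add_sub_assoc, hb']; abel
  have h1 : ‖b' - b‖ ≤ K * ‖x' - x‖ + K * ‖b' - b‖ * ‖x - v b‖ + K * ‖b' - b‖ ^ 2 := by
    conv_lhs => rw [e]
    refine (norm_add_le _ _).trans (add_le_add ((norm_add_le _ _).trans (add_le_add ?_ ?_)) ?_)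
    · exact F.norm_frame_apply_le _ _
    · exact F.norm_frame_sub_apply_le _ _ _
    · rw [norm_sub_rev b' b]; exact F.frame_tangent b' b
  have hq : K * (1 / (4 * K)) = 1 / 4 := by field_simp
  have h2 : K * ‖x - v b‖ ≤ 1 / 4 := by rw [← hq]; gcongr
  have h3 : K * ‖b' - b‖ ≤ 1 / 4 := by rw [← hq]; gcongr
  have h0 := norm_nonneg (b' - b)
  nlinarith

/-! ### Windows of fixed length and contraction towards the torus. -/

/-- Comparison of a forced solution with the torus solution of the same initial phase. -/
theorem exists_window_bound (F : PhaseFrame g T τtr v A Λ K) (S : ℝ) :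
    ∃ C ≥ 1, ∀ (dode x : ℝ → X) (ε t : ℝ) (a : ℝ × ℝ), IsForcedSolution g T dode x →
      0 ≤ t → 0 ≤ ε → ε ≤ 1 → (∀ τ ≥ 0, ‖dode τ‖ ≤ ε) → Λ a (x t - v a) = 0 → ∀ s ∈ Icc 0 S,
      ‖x (t + s) - v (a + (0, s))‖ ≤
        K * Real.exp (-s / τtr) * ‖x t - v a‖ + C * (ε + ‖x t - v a‖ ^ 2) ∧
      ‖Λ (a + (0, s)) (x (t + s) - v (a + (0, s)))‖ ≤ C * (ε + ‖x t - v a‖ ^ 2) := by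
  have hK := F.K_pos
  have hT := F.T_pos
  set κ := T * K with hκ
  have hκ0 : 0 < κ := by positivity
  set G := Real.exp (κ * S) * (1 + 1 / κ) with hG
  have hG0 : 0 < G := by positivity
  set C₀ := G * (κ * (2 * G ^ 2) + 1) with hC₀
  have hC₀0 : 0 < C₀ := by positivity
  refine ⟨1 + C₀ + K * C₀, by have := mul_pos hK hC₀0; linarith, ?_⟩
  intro dode x ε t a hx ht hε hε1 hd ha s hs
  obtain ⟨y, hy0, hy, hyb⟩ := F.transversal a _ ha
  set z : ℝ → X := fun s => x (t + s) - v (a + (0, s)) with hz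
  have hz0 : z 0 = x t - v a := by simp [hz, Prod.mk_zero_zero]
  have hzd : ∀ s ≥ 0, HasDerivWithinAt z
      (T • g (x (t + s)) + dode (t + s) - T • g (v (a + (0, s)))) (Ici 0) s := by
    intro s hs
    refine HasDerivWithinAt.sub ?_ (F.ode a s).hasDerivWithinAt
    have h1 := hx (t + s) (add_nonneg ht hs)
    have h2 : HasDerivWithinAt (fun s => t + s) 1 (Ici 0) s :=
      ((hasDerivAt_id s).const_add t).hasDerivWithinAt
    have h3 := HasDerivWithinAt.scomp s h1 h2 (fun r hr => add_nonneg ht hr)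
    rw [one_smul] at h3
    exact h3
  have hzb : ∀ s ∈ Icc 0 S, ‖z s‖ ≤ G * (‖x t - v a‖ + ε) := by
    refine norm_le_exp_mul_of_norm_deriv_le hκ0 (norm_nonneg _) hε hzd (by rw [hz0]) ?_
    intro s hs
    have e : T • g (x (t + s)) + dode (t + s) - T • g (v (a + (0, s))) =
      T • (g (x (t + s)) - g (v (a + (0, s)))) + dode (t + s) := by rw [smul_sub]; abel
    rw [e]
    refine (norm_add_le _ _).trans (add_le_add ?_ (hd _ (add_nonneg ht hs.1)))
    rw [norm_smul, Real.norm_of_nonneg hT.le, hκ, mul_assoc]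
    exact mul_le_mul_of_nonneg_left (F.g_lip _ _) hT.le
  set z₀ := ‖x t - v a‖ with hz₀
  have hz₀0 : 0 ≤ z₀ := norm_nonneg _
  have hsq : ∀ s ∈ Icc 0 S, ‖z s‖ ^ 2 ≤ 2 * G ^ 2 * (ε + z₀ ^ 2) := by
    intro s hs
    calc ‖z s‖ ^ 2 ≤ (G * (z₀ + ε)) ^ 2 := by gcongr; exact hzb s hs
      _ = G ^ 2 * (z₀ + ε) ^ 2 := by ring
      _ ≤ G ^ 2 * (2 * (ε + z₀ ^ 2)) := by
        gcongr
        nlinarith [sq_nonneg (z₀ - ε)]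
      _ = _ := by ring
  -- Subtracting the linear solution leaves an equation with zero initial value, driven only by the
  -- Taylor remainder and the forcing; hence the difference is O(ε + z₀²).
  have hwd : ∀ s ≥ 0, HasDerivWithinAt (fun s => z s - y s)
      (T • g (x (t + s)) + dode (t + s) - T • g (v (a + (0, s))) - T • A (a + (0, s)) (y s))
      (Ici 0) s := fun s hs => (hzd s hs).sub (hy s).hasDerivWithinAt
  have hwb : ∀ s ∈ Icc 0 S, ‖z s - y s‖ ≤ G * (0 + (κ * (2 * G ^ 2 * (ε + z₀ ^ 2)) + ε)) := by
    refine norm_le_exp_mul_of_norm_deriv_le hκ0 le_rfl (by positivity) hwd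
      (by simp only [hz0, hy0, sub_self, norm_zero, le_refl]) ?_
    intro s hs
    have e : T • g (x (t + s)) + dode (t + s) - T • g (v (a + (0, s))) - T • A (a + (0, s)) (y s)
      = T • A (a + (0, s)) (z s - y s)
        + (T • (g (x (t + s)) - g (v (a + (0, s))) - A (a + (0, s)) (z s)) + dode (t + s)) := by
      rw [map_sub]; module
    rw [e]
    refine (norm_add_le _ _).trans (add_le_add ?_ ((norm_add_le _ _).trans (add_le_add ?_
      (hd _ (add_nonneg ht hs.1)))))
    · rw [norm_smul, Real.norm_of_nonneg hT.le, hκ, mul_assoc]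
      exact mul_le_mul_of_nonneg_left ((A _).le_of_opNorm_le (F.A_norm _) _) hT.le
    · rw [norm_smul, Real.norm_of_nonneg hT.le, hκ, mul_assoc]
      refine mul_le_mul_of_nonneg_left ((F.g_taylor _ _).trans ?_) hT.le
      exact mul_le_mul_of_nonneg_left (hsq s ⟨hs.1, hs.2.le⟩) hK.le
  have hw : ‖z s - y s‖ ≤ C₀ * (ε + z₀ ^ 2) := by
    refine (hwb s hs).trans ?_
    rw [hC₀, zero_add, mul_assoc G]
    refine mul_le_mul_of_nonneg_left ?_ hG0.le
    nlinarith [sq_nonneg z₀]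
  have hq0 : 0 ≤ ε + z₀ ^ 2 := by positivity
  obtain ⟨hy1, hy2⟩ := hyb s hs.1
  have hKC := mul_pos hK hC₀0
  constructor
  · have e : x (t + s) - v (a + (0, s)) = y s + (z s - y s) := by simp [hz]
    rw [e]
    refine (norm_add_le _ _).trans (add_le_add hy2 (hw.trans ?_))
    gcongr
    linarith
  · have e : Λ (a + (0, s)) (x (t + s) - v (a + (0, s))) = Λ (a + (0, s)) (z s - y s) := by
      rw [map_sub _ (z s), hy1, sub_zero]
    rw [e]
    refine (F.norm_frame_apply_le _ _).trans ?_
    calc K * ‖z s - y s‖ ≤ K * (C₀ * (ε + z₀ ^ 2)) := by gcongr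
      _ = K * C₀ * (ε + z₀ ^ 2) := by ring
      _ ≤ _ := by gcongr; linarith

end PhaseFrame

namespace PhaseFrame

variable {X : Type*} [NormedAddCommGroup X] [NormedSpace ℝ X] {g : X → X} {T τtr : ℝ}
    {v : ℝ × ℝ → X} {A : ℝ × ℝ → X →L[ℝ] X} {Λ : ℝ × ℝ → X →L[ℝ] ℝ × ℝ} {K : ℝ}

/-- Re-basing the phases after a sufficiently long time contracts the distance to the torus. -/
theorem exists_contracting_step (F : PhaseFrame g T τtr v A Λ K) :
    ∃ m : ℕ, 0 < m ∧ ∃ d > 0, ∃ C ≥ 1, d ≤ 1 ∧ ∀ (dode x : ℝ → X) (ε t : ℝ) (a : ℝ × ℝ),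
      IsForcedSolution g T dode x → 0 ≤ t → 0 ≤ ε → ε ≤ d → (∀ τ ≥ 0, ‖dode τ‖ ≤ ε) →
      Λ a (x t - v a) = 0 → ‖x t - v a‖ ≤ d →
      (∀ s ∈ Icc (0 : ℝ) m, ‖x (t + s) - v (a + (0, s))‖ ≤ C * (‖x t - v a‖ + ε)) ∧
      ∃ a', Λ a' (x (t + m) - v a') = 0 ∧
        ‖x (t + m) - v a'‖ ≤ Real.exp (-m / (2 * τtr)) * ‖x t - v a‖ + C * ε ∧
        ‖a' - (a + (0, (m : ℝ)))‖ ≤ C * (ε + ‖x t - v a‖ ^ 2) := by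
  have hK := F.K_pos
  have hK1 := F.one_le
  have hτ := F.τ_pos
  set K₁ := 1 + 2 * K ^ 2 with hK₁
  have hK₁0 : 1 ≤ K₁ := by rw [hK₁]; nlinarith [sq_nonneg K]
  -- Half of the exponential rate is sacrificed: for large `m` one factor θ of the decay θ² absorbs
  -- `K` and the loss `K₁` from choosing a new phase. The quadratic term fits into the other θ/2 by
  -- the choice of `d`.
  obtain ⟨m, hm0, hm⟩ : ∃ m : ℕ, 0 < m ∧ 2 * K₁ * K * Real.exp (-m / (2 * τtr)) ≤ 1 := by
    have h1 : Tendsto (fun m : ℕ => 2 * K₁ * K * Real.exp (-m / (2 * τtr))) atTop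
        (𝓝 (2 * K₁ * K * 0)) := by
      refine Tendsto.const_mul _ (Real.tendsto_exp_atBot.comp ?_)
      refine (tendsto_neg_atTop_atBot.comp tendsto_natCast_atTop_atTop).atBot_div_const
        (by positivity)
    rw [mul_zero] at h1
    obtain ⟨m, h2, h3⟩ := ((h1.eventually (ge_mem_nhds zero_lt_one)).and
      (eventually_gt_atTop 0)).exists
    exact ⟨m, h3, h2⟩
  set θ := Real.exp (-m / (2 * τtr)) with hθ
  have hθ0 : 0 < θ := Real.exp_pos _
  have hθ1 : θ ≤ 1 := by
    rw [hθ, Real.exp_le_one_iff, neg_div, neg_nonpos]; positivity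
  have hθ2 : Real.exp (-(m : ℝ) / τtr) = θ ^ 2 := by
    rw [hθ, ← Real.exp_nat_mul]; congr 1; push_cast; field_simp
  obtain ⟨W, hW1, hW⟩ := F.exists_window_bound m
  have hW0 : 0 < W := by linarith
  set d := min 1 (min (1 / (16 * K ^ 3) / (K + 2 * W)) (θ / (2 * K₁ * W))) with hd
  have hd0 : 0 < d := by positivity
  have hd1 : d ≤ 1 := min_le_left _ _
  have hd2 : (K + 2 * W) * d ≤ 1 / (16 * K ^ 3) := by
    have : d ≤ 1 / (16 * K ^ 3) / (K + 2 * W) := (min_le_right _ _).trans (min_le_left _ _)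
    rw [le_div_iff₀ (by positivity)] at this
    linarith
  have hd3 : K₁ * W * d ≤ θ / 2 := by
    have : d ≤ θ / (2 * K₁ * W) := (min_le_right _ _).trans (min_le_right _ _)
    rw [le_div_iff₀ (by positivity)] at this
    linarith
  refine ⟨m, hm0, d, hd0, K₁ * W + K + 2 * W, by nlinarith, hd1, ?_⟩
  intro dode x ε t a hx ht hε hεd hdode ha had
  have hwin := hW dode x ε t a hx ht hε (hεd.trans hd1) hdode ha
  set z₀ := ‖x t - v a‖ with hz₀
  have hz0 : 0 ≤ z₀ := norm_nonneg _
  have hzsq : z₀ ^ 2 ≤ z₀ := by nlinarith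
  have hcoarse : ∀ s ∈ Icc (0 : ℝ) m, ‖x (t + s) - v (a + (0, s))‖ ≤ K * z₀ + W * (ε + z₀) := by
    intro s hs
    refine (hwin s hs).1.trans (add_le_add ?_ (by gcongr))
    have : Real.exp (-s / τtr) ≤ 1 := by
      rw [Real.exp_le_one_iff, neg_div, neg_nonpos]; have := hs.1; positivity
    have h2 : K * Real.exp (-s / τtr) ≤ K * 1 := by gcongr
    rw [mul_one] at h2
    exact mul_le_mul_of_nonneg_right h2 hz0
  refine ⟨fun s hs => (hcoarse s hs).trans ?_, ?_⟩
  · have h1 : 0 ≤ K₁ * W * (z₀ + ε) := by positivity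
    have h2 : 0 ≤ K * ε := by positivity
    have h3 : 0 ≤ W * (z₀ + ε) := by positivity
    nlinarith
  have hmm : (m : ℝ) ∈ Icc (0 : ℝ) m := ⟨by positivity, le_rfl⟩
  obtain ⟨hw1, hw2⟩ := hwin m hmm
  rw [hθ2] at hw1
  have hsmall : ‖x (t + m) - v (a + (0, (m : ℝ)))‖ ≤ 1 / (16 * K ^ 3) := by
    refine (hcoarse m hmm).trans (le_trans ?_ hd2)
    have h1 : K * z₀ ≤ K * d := by gcongr
    have h2 : W * (ε + z₀) ≤ W * (d + d) := by gcongr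
    linarith
  obtain ⟨a', ha', ha1, -⟩ := F.exists_phase (a + (0, (m : ℝ))) (x (t + m)) hsmall
  refine ⟨a', ha', ?_, ?_⟩
  · have h1 : ‖x (t + m) - v a'‖ ≤ K₁ * ‖x (t + m) - v (a + (0, (m : ℝ)))‖ := by
      have e : x (t + m) - v a' = (x (t + m) - v (a + (0, (m : ℝ))))
          - (v a' - v (a + (0, (m : ℝ)))) := by abel
      rw [e]
      refine (norm_sub_le _ _).trans ?_
      have h2 := F.v_lip (a + (0, (m : ℝ))) a'
      have h3 := F.norm_frame_apply_le (a + (0, (m : ℝ))) (x (t + m) - v (a + (0, (m : ℝ))))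
      have h4 : K * ‖a' - (a + (0, (m : ℝ)))‖ ≤
          K * (2 * (K * ‖x (t + m) - v (a + (0, (m : ℝ)))‖)) :=
        mul_le_mul_of_nonneg_left (by linarith) hK.le
      rw [hK₁]
      linarith
    have h2 : K₁ * ‖x (t + m) - v (a + (0, (m : ℝ)))‖ ≤
        K₁ * (K * θ ^ 2 * z₀ + W * (ε + z₀ ^ 2)) := by gcongr
    have h3 : K₁ * (K * θ ^ 2 * z₀) ≤ θ / 2 * z₀ := by
      have : K₁ * K * θ * (θ * z₀) ≤ 1 / 2 * (θ * z₀) := by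
        refine mul_le_mul_of_nonneg_right ?_ (by positivity)
        linarith
      linarith
    have h4 : K₁ * W * z₀ * z₀ ≤ θ / 2 * z₀ := by
      refine mul_le_mul_of_nonneg_right (le_trans ?_ hd3) hz0
      gcongr
    have h5 : 0 ≤ (K + 2 * W) * ε := by positivity
    nlinarith
  · refine ha1.trans ?_
    have h1 : 0 ≤ ε + z₀ ^ 2 := by positivity
    have h2 : (0 : ℝ) ≤ (K₁ * W + K) * (ε + z₀ ^ 2) := by positivity
    linarith

set_option maxHeartbeats 800000 in
/-- Along a forced solution starting near the torus, phases can be chosen at all multiples of a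
fixed time. -/
theorem exists_phase_sequence (F : PhaseFrame g T τtr v A Λ K) :
    ∃ m : ℕ, 0 < m ∧ ∃ d > 0, ∃ C ≥ 1, ∀ (dode x : ℝ → X) (ε : ℝ) (a : ℝ × ℝ),
      IsForcedSolution g T dode x → 0 ≤ ε → ε ≤ d → (∀ τ ≥ 0, ‖dode τ‖ ≤ ε) →
      ‖x 0 - v a‖ ≤ d → ∃ p : ℕ → ℝ × ℝ,
      (∀ k : ℕ, Λ (p k) (x (k * m) - v (p k)) = 0) ∧
      (∀ k : ℕ, ∀ s ∈ Icc (0 : ℝ) m, ‖x (k * m + s) - v (p k + (0, s))‖ ≤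
        C * (Real.exp (-m / (2 * τtr)) ^ k * ‖x 0 - v a‖ + ε)) ∧
      (∀ k : ℕ, ‖p (k + 1) - (p k + (0, (m : ℝ)))‖ ≤
        C * (ε + (Real.exp (-m / (2 * τtr)) ^ k * ‖x 0 - v a‖) ^ 2)) ∧
      ‖p 0 - a‖ ≤ C * ‖x 0 - v a‖ ∧
      ‖p 0 - a - Λ a (x 0 - v a)‖ ≤ C * ‖x 0 - v a‖ ^ 2 := by
  have hK := F.K_pos
  have hτ := F.τ_pos
  obtain ⟨m, hm, d', hd', C', hC', hd'1, hstep⟩ := F.exists_contracting_step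
  set θ := Real.exp (-m / (2 * τtr)) with hθ
  have hθ0 : 0 < θ := Real.exp_pos _
  have hmpos : (0 : ℝ) < m := by exact_mod_cast hm
  have hθ1 : θ < 1 := by
    rw [hθ, Real.exp_lt_one_iff, neg_div, neg_lt_zero]; positivity
  -- The fixed point of r ↦ θ r + C': the accumulated effect of an error C' ε made in every window.
  set B := C' / (1 - θ) with hB
  have h1θ : 0 < 1 - θ := by linarith
  have hB0 : 0 < B := by positivity
  have hBθ : θ * B + C' = B := by rw [hB]; field_simp; ring
  set K₁ := 1 + 2 * K ^ 2 with hK₁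
  have hK₁0 : 1 ≤ K₁ := by rw [hK₁]; nlinarith [sq_nonneg K]
  set d := min (1 / (16 * K ^ 3)) (d' / (K₁ + B + 1)) with hd
  have hd0 : 0 < d := by positivity
  have hd1 : d ≤ 1 / (16 * K ^ 3) := min_le_left _ _
  have hd2 : (K₁ + B + 1) * d ≤ d' := by
    have : d ≤ d' / (K₁ + B + 1) := min_le_right _ _
    rw [le_div_iff₀ (by positivity)] at this
    linarith
  have hdd' : d ≤ d' := by nlinarith
  set C := 2 * K + 8 * K ^ 3 + C' * (K₁ + B + 1) + C' * (2 * K₁ ^ 2 + 2 * B ^ 2 + 1) with hC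
  have hC1 : 1 ≤ C := by
    have h1 : 1 ≤ C' * (K₁ + B + 1) := by nlinarith
    have h2 : 0 ≤ 2 * K + 8 * K ^ 3 := by positivity
    have h3 : 0 ≤ C' * (2 * K₁ ^ 2 + 2 * B ^ 2 + 1) := by positivity
    linarith
  refine ⟨m, hm, d, hd0, C, hC1, ?_⟩
  intro dode x ε a hx hε hεd hdode hxa
  set z := ‖x 0 - v a‖ with hz
  have hz0 : 0 ≤ z := norm_nonneg _
  obtain ⟨a₀, ha₀, ha₁, ha₂⟩ := F.exists_phase a (x 0) (hxa.trans hd1)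
  have hfr := F.norm_frame_apply_le a (x 0 - v a)
  have ha₁' : ‖a₀ - a‖ ≤ 2 * K * z := by linarith
  have hza₀ : ‖x 0 - v a₀‖ ≤ K₁ * z := by
    have e : x 0 - v a₀ = (x 0 - v a) - (v a₀ - v a) := by abel
    rw [e]
    refine (norm_sub_le _ _).trans ?_
    have h2 := F.v_lip a a₀
    have h4 : K * ‖a₀ - a‖ ≤ K * (2 * K * z) := mul_le_mul_of_nonneg_left ha₁' hK.le
    rw [hK₁]
    linarith
  have hnext : ∀ (k : ℕ) (b : ℝ × ℝ), (Λ b (x (k * m) - v b) = 0 ∧ ‖x (k * m) - v b‖ ≤ d') →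
      ∃ b', Λ b' (x (k * m + m) - v b') = 0 ∧
        ‖x (k * m + m) - v b'‖ ≤ θ * ‖x (k * m) - v b‖ + C' * ε ∧
        ‖b' - (b + (0, (m : ℝ)))‖ ≤ C' * (ε + ‖x (k * m) - v b‖ ^ 2) := fun k b hb =>
    (hstep dode x ε (k * m) b hx (by positivity) hε (hεd.trans hdd') hdode hb.1 hb.2).2
  choose! nxt hn1 hn2 hn3 using hnext
  set p : ℕ → ℝ × ℝ := fun k => Nat.rec a₀ (fun k b => nxt k b) k with hp
  have hps : ∀ k, p (k + 1) = nxt k (p k) := fun k => rfl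
  have hcast : ∀ k : ℕ, ((k + 1 : ℕ) : ℝ) * m = k * m + m := fun k => by push_cast; ring
  have hbd : ∀ k : ℕ, θ ^ k * (K₁ * z) + B * ε ≤ d' := by
    intro k
    have h1 : θ ^ k ≤ 1 := pow_le_one₀ hθ0.le hθ1.le
    have h2 : θ ^ k * (K₁ * z) ≤ 1 * (K₁ * d) := by gcongr
    have h3 : B * ε ≤ B * d := by gcongr
    nlinarith
  have hind : ∀ k : ℕ, Λ (p k) (x (k * m) - v (p k)) = 0 ∧
      ‖x (k * m) - v (p k)‖ ≤ θ ^ k * (K₁ * z) + B * ε := by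
    intro k
    induction k with
    | zero =>
      have : p 0 = a₀ := rfl
      rw [this]
      have hBε : 0 ≤ B * ε := by positivity
      refine ⟨by simpa using ha₀, ?_⟩
      simp only [Nat.cast_zero, zero_mul, pow_zero, one_mul]
      linarith
    | succ k ih =>
      have hc : Λ (p k) (x (k * m) - v (p k)) = 0 ∧ ‖x (k * m) - v (p k)‖ ≤ d' :=
        ⟨ih.1, ih.2.trans (hbd k)⟩
      rw [hcast, hps]
      refine ⟨hn1 k _ hc, (hn2 k _ hc).trans ?_⟩
      have h1 : θ * ‖x (k * m) - v (p k)‖ ≤ θ * (θ ^ k * (K₁ * z) + B * ε) := by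
        gcongr; exact ih.2
      calc _ ≤ θ * (θ ^ k * (K₁ * z) + B * ε) + C' * ε := by linarith
        _ = θ ^ (k + 1) * (K₁ * z) + (θ * B + C') * ε := by ring
        _ = _ := by rw [hBθ]
  have hCc : C' * (K₁ + B + 1) ≤ C := by
    have h2 : 0 ≤ 2 * K + 8 * K ^ 3 := by positivity
    have h3 : 0 ≤ C' * (2 * K₁ ^ 2 + 2 * B ^ 2 + 1) := by positivity
    linarith
  have hCd : C' * (2 * K₁ ^ 2 + 2 * B ^ 2 + 1) ≤ C := by
    have h2 : 0 ≤ 2 * K + 8 * K ^ 3 := by positivity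
    have h3 : 0 ≤ C' * (K₁ + B + 1) := by positivity
    linarith
  have hε1 : ε ≤ 1 := hεd.trans (hdd'.trans hd'1)
  have hp1 : 0 ≤ C' * (K₁ + B + 1) := by positivity
  have hp2 : 0 ≤ C' * (2 * K₁ ^ 2 + 2 * B ^ 2 + 1) := by positivity
  have hp3 : 0 ≤ K ^ 3 := by positivity
  refine ⟨p, fun k => (hind k).1, ?_, ?_, ?_, ?_⟩
  · intro k s hs
    have h1 := (hstep dode x ε (k * m) (p k) hx (by positivity) hε (hεd.trans hdd') hdode
      (hind k).1 ((hind k).2.trans (hbd k))).1 s hs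
    have hq : 0 ≤ θ ^ k * z := by positivity
    calc _ ≤ C' * (‖x (k * m) - v (p k)‖ + ε) := h1
      _ ≤ C' * (θ ^ k * (K₁ * z) + B * ε + ε) := by gcongr; exact (hind k).2
      _ ≤ C' * ((K₁ + B + 1) * (θ ^ k * z + ε)) := by
        refine mul_le_mul_of_nonneg_left ?_ (by positivity)
        have h2 := mul_nonneg hB0.le hq
        have h3 := mul_nonneg (zero_le_one.trans hK₁0) hε
        linarith
      _ = C' * (K₁ + B + 1) * (θ ^ k * z + ε) := by ring
      _ ≤ _ := by gcongr
  · intro k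
    rw [hps]
    have hc : Λ (p k) (x (k * m) - v (p k)) = 0 ∧ ‖x (k * m) - v (p k)‖ ≤ d' :=
        ⟨(hind k).1, (hind k).2.trans (hbd k)⟩
    have h0 : ε ^ 2 ≤ ε := pow_le_of_le_one hε hε1 two_ne_zero
    calc _ ≤ C' * (ε + ‖x (k * m) - v (p k)‖ ^ 2) := hn3 k _ hc
      _ ≤ C' * (ε + (θ ^ k * (K₁ * z) + B * ε) ^ 2) := by gcongr; exact (hind k).2
      _ ≤ C' * ((2 * K₁ ^ 2 + 2 * B ^ 2 + 1) * (ε + (θ ^ k * z) ^ 2)) := by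
        refine mul_le_mul_of_nonneg_left ?_ (by positivity)
        have h1 : (θ ^ k * (K₁ * z) + B * ε) ^ 2 ≤
            2 * K₁ ^ 2 * (θ ^ k * z) ^ 2 + 2 * B ^ 2 * ε ^ 2 := by
          nlinarith [sq_nonneg (θ ^ k * (K₁ * z) - B * ε)]
        have h2 : 2 * B ^ 2 * ε ^ 2 ≤ 2 * B ^ 2 * ε := by gcongr
        have h3 : 0 ≤ 2 * K₁ ^ 2 * ε := by positivity
        have h4 : 0 ≤ 2 * B ^ 2 * (θ ^ k * z) ^ 2 := by positivity
        have h5 := sq_nonneg (θ ^ k * z)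
        linarith
      _ = C' * (2 * K₁ ^ 2 + 2 * B ^ 2 + 1) * (ε + (θ ^ k * z) ^ 2) := by ring
      _ ≤ _ := by gcongr
  · refine ha₁'.trans ?_
    gcongr
    linarith
  · refine ha₂.trans ?_
    gcongr
    linarith

end PhaseFrame

/-! ### Asymptotic phases of unforced solutions. -/

namespace PhaseFrame

variable {X : Type*} [NormedAddCommGroup X] [NormedSpace ℝ X] {g : X → X} {T τtr : ℝ}
    {v : ℝ × ℝ → X} {A : ℝ × ℝ → X →L[ℝ] X} {Λ : ℝ × ℝ → X →L[ℝ] ℝ × ℝ} {K : ℝ}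

/-- Unforced solutions starting near the torus converge exponentially to a solution on the torus,
whose phase is given to first order by the frame. -/
theorem exists_asymptotic_phase (F : PhaseFrame g T τtr v A Λ K) :
    ∃ d > 0, ∃ C ≥ 1, ∀ (x : ℝ → X) (a : ℝ × ℝ), IsForcedSolution g T (fun _ => 0) x →
      ‖x 0 - v a‖ ≤ d → ∃ b, ‖b - a - Λ a (x 0 - v a)‖ ≤ C * ‖x 0 - v a‖ ^ 2 ∧
        ∀ t ≥ 0, ‖x t - v (b + (0, t))‖ ≤ C * Real.exp (-t / (2 * τtr)) * ‖x 0 - v a‖ := by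
  have hK := F.K_pos
  have hτ := F.τ_pos
  obtain ⟨m, hm, d, hd, C, hC, hseq⟩ := F.exists_phase_sequence
  set θ := Real.exp (-m / (2 * τtr)) with hθ
  have hθ0 : 0 < θ := Real.exp_pos _
  have hmpos : (0 : ℝ) < m := by exact_mod_cast hm
  have hθ1 : θ < 1 := by
    rw [hθ, Real.exp_lt_one_iff, neg_div, neg_lt_zero]; positivity
  have hθ2 : θ ^ 2 < 1 := pow_lt_one₀ hθ0.le hθ1 two_ne_zero
  have h1θ : 0 < 1 - θ ^ 2 := by linarith
  set G := C / (1 - θ ^ 2) with hG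
  have hG0 : 0 < G := by positivity
  refine ⟨min d 1, by positivity, C + G + (C + K * G) / θ, ?_, ?_⟩
  · have : 0 < (C + K * G) / θ := by positivity
    linarith
  intro x a hx hxa
  have hz0 : 0 ≤ ‖x 0 - v a‖ := norm_nonneg _
  obtain ⟨p, -, hp2, hp3, -, hp5⟩ := hseq (fun _ => 0) x 0 a hx le_rfl hd.le (by simp)
    (hxa.trans (min_le_left _ _))
  have hz1 : ‖x 0 - v a‖ ≤ 1 := hxa.trans (min_le_right _ _)
  set z := ‖x 0 - v a‖ with hz
  -- Phases are transported back to time 0. Without forcing their increments are quadratic in the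
  -- current distance, hence geometric with ratio θ², and their limit is the asymptotic phase.
  set u : ℕ → ℝ × ℝ := fun k => p k - (0, (k : ℝ) * m) with hu
  have hdist : ∀ k, dist (u k) (u (k + 1)) ≤ C * z ^ 2 * (θ ^ 2) ^ k := by
    intro k
    rw [dist_comm, dist_eq_norm]
    have e : u (k + 1) - u k = p (k + 1) - (p k + (0, (m : ℝ))) := by
      simp only [hu]; ext <;> simp; ring
    rw [e]
    refine (hp3 k).trans (le_of_eq ?_)
    ring
  obtain ⟨b, hb⟩ := cauchySeq_tendsto_of_complete (cauchySeq_of_le_geometric _ _ hθ2 hdist)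
  have hub : ∀ k, ‖u k - b‖ ≤ G * z ^ 2 * (θ ^ k) ^ 2 := by
    intro k
    have := dist_le_of_le_geometric_of_tendsto _ _ hθ2 hdist hb k
    rw [dist_eq_norm] at this
    refine this.trans (le_of_eq ?_)
    rw [hG]; ring
  refine ⟨b, ?_, ?_⟩
  · have e : b - a - Λ a (x 0 - v a) = (p 0 - a - Λ a (x 0 - v a)) - (u 0 - b) := by
      have : u 0 = p 0 := by simp [hu, Prod.mk_zero_zero]
      rw [this]; abel
    rw [e]
    refine (norm_sub_le _ _).trans ?_
    have h1 := hub 0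
    rw [pow_zero, one_pow, mul_one] at h1
    have h2 : 0 ≤ (C + K * G) / θ * z ^ 2 := by positivity
    calc _ ≤ C * z ^ 2 + G * z ^ 2 := add_le_add hp5 h1
      _ ≤ _ := by linarith
  · intro t ht
    set k := ⌊t / m⌋₊ with hk
    have hk1 : k * m ≤ t := by
      have := Nat.floor_le (show 0 ≤ t / m by positivity)
      rwa [← hk, le_div_iff₀ hmpos] at this
    have hk2 : t < k * m + m := by
      have := Nat.lt_floor_add_one (t / m)
      rw [← hk, div_lt_iff₀ hmpos] at this
      linarith
    have h1 := hp2 k (t - k * m) ⟨by linarith, by linarith⟩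
    rw [add_sub_cancel, add_zero] at h1
    have h2 : ‖v (p k + (0, t - k * m)) - v (b + (0, t))‖ ≤ K * (G * z ^ 2 * (θ ^ k) ^ 2) := by
      refine (F.v_lip _ _).trans (mul_le_mul_of_nonneg_left ?_ hK.le)
      have e : p k + (0, t - k * m) - (b + (0, t)) = u k - b := by
        simp only [hu]; ext <;> simp; ring
      rw [e]
      exact hub k
    have hθk : θ ^ k ≤ 1 := pow_le_one₀ hθ0.le hθ1.le
    have hθk0 : 0 < θ ^ k := by positivity
    have h3 : K * (G * z ^ 2 * (θ ^ k) ^ 2) ≤ K * (G * z * θ ^ k) := by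
      have h4 : z ^ 2 ≤ z := pow_le_of_le_one hz0 hz1 two_ne_zero
      have h5 : (θ ^ k) ^ 2 ≤ θ ^ k := pow_le_of_le_one hθk0.le hθk two_ne_zero
      gcongr
    -- One factor θ is lost because `t` may be almost a full window past `k * m`.
    have h6 : θ ^ k ≤ Real.exp (-t / (2 * τtr)) / θ := by
      rw [le_div_iff₀ hθ0, ← pow_succ, hθ, ← Real.exp_nat_mul]
      refine Real.exp_le_exp.2 ?_
      push_cast
      rw [mul_div_assoc', div_le_div_iff_of_pos_right (by positivity)]
      linarith
    have e : x t - v (b + (0, t)) = (x t - v (p k + (0, t - k * m)))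
        + (v (p k + (0, t - k * m)) - v (b + (0, t))) := by abel
    rw [e]
    refine (norm_add_le _ _).trans ?_
    have h7 : (C + K * G) * θ ^ k * z ≤ (C + K * G) * (Real.exp (-t / (2 * τtr)) / θ) * z := by
      gcongr
    have h8 : 0 ≤ (C + G) * Real.exp (-t / (2 * τtr)) * z := by positivity
    calc _ ≤ C * (θ ^ k * z) + K * (G * z * θ ^ k) := by linarith
      _ = (C + K * G) * θ ^ k * z := by ring
      _ ≤ (C + K * G) * (Real.exp (-t / (2 * τtr)) / θ) * z := h7
      _ = (C + K * G) / θ * Real.exp (-t / (2 * τtr)) * z := by ring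
      _ ≤ _ := by linarith

/-- Distinct nearby solutions on the torus do not converge to each other. -/
theorem eq_of_tendsto_sub (F : PhaseFrame g T τtr v A Λ K) {b b' : ℝ × ℝ}
    (hbb : ‖b' - b‖ ≤ 1 / (2 * K))
    (h : Tendsto (fun t : ℝ => v (b' + (0, t)) - v (b + (0, t))) atTop (𝓝 0)) : b' = b := by
  have hK := F.K_pos
  -- Both phases move by the same translation, so their difference is constant in time, and the
  -- frame recovers it from the difference of the two points.
  have h1 : ∀ t : ℝ, ‖b' - b‖ ≤ 2 * K * ‖v (b' + (0, t)) - v (b + (0, t))‖ := by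
    intro t
    have h2 := F.frame_tangent (b + (0, t)) (b' + (0, t))
    have h3 := F.norm_frame_apply_le (b + (0, t)) (v (b' + (0, t)) - v (b + (0, t)))
    rw [add_sub_add_right_eq_sub] at h2
    have h4 : ‖b' - b‖ ≤ ‖Λ (b + (0, t)) (v (b' + (0, t)) - v (b + (0, t)))‖
        + ‖Λ (b + (0, t)) (v (b' + (0, t)) - v (b + (0, t))) - (b' - b)‖ := by
      have := norm_sub_le (Λ (b + (0, t)) (v (b' + (0, t)) - v (b + (0, t))))
        (Λ (b + (0, t)) (v (b' + (0, t)) - v (b + (0, t))) - (b' - b))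
      rwa [sub_sub_cancel] at this
    have h5 : K * ‖b' - b‖ ≤ 1 / 2 := by
      have : K * (1 / (2 * K)) = 1 / 2 := by field_simp
      rw [← this]
      gcongr
    have h0 := norm_nonneg (b' - b)
    nlinarith
  have h2 : Tendsto (fun t : ℝ => 2 * K * ‖v (b' + (0, t)) - v (b + (0, t))‖) atTop (𝓝 0) := by
    have := h.norm.const_mul (2 * K)
    simpa using this
  have h3 : ‖b' - b‖ ≤ 0 := ge_of_tendsto' h2 h1
  exact sub_eq_zero.1 (norm_le_zero_iff.1 h3)

end PhaseFrame

/-! ### Phase curves of forced solutions and their derivatives. -/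

namespace PhaseFrame

variable {X : Type*} [NormedAddCommGroup X] [NormedSpace ℝ X] {g : X → X} {T τtr : ℝ}
    {v : ℝ × ℝ → X} {A : ℝ × ℝ → X →L[ℝ] X} {Λ : ℝ × ℝ → X →L[ℝ] ℝ × ℝ} {K : ℝ}

/-- A forced solution starting near the torus stays near it, with phases that follow the solution
in a Lipschitz way. -/
theorem exists_phase_curve (F : PhaseFrame g T τtr v A Λ K) :
    ∃ d > 0, ∃ C ≥ 1, ∀ (dode x : ℝ → X) (ε : ℝ) (a : ℝ × ℝ),
      IsForcedSolution g T dode x → 0 ≤ ε → ε ≤ d → (∀ τ ≥ 0, ‖dode τ‖ ≤ ε) →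
      ‖x 0 - v a‖ ≤ ε → ∃ b : ℝ → ℝ × ℝ,
      (∀ t ≥ 0, Λ (b t) (x t - v (b t)) = 0 ∧ ‖x t - v (b t)‖ ≤ C * ε) ∧ ‖b 0 - a‖ ≤ C * ε ∧
      ∀ t ≥ 0, ∀ᶠ t' in 𝓝[Ici 0] t, ‖b t' - b t‖ ≤ 2 * K * ‖x t' - x t‖ := by
  have hK := F.K_pos
  have hK1 := F.one_le
  have hτ := F.τ_pos
  obtain ⟨m, hm, d, hd, C, hC, hseq⟩ := F.exists_phase_sequence
  set θ := Real.exp (-m / (2 * τtr)) with hθ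
  have hθ0 : 0 < θ := Real.exp_pos _
  have hmpos : (0 : ℝ) < m := by exact_mod_cast hm
  have hm1 : (1 : ℝ) ≤ m := by exact_mod_cast hm
  have hθ1 : θ ≤ 1 := by
    rw [hθ, Real.exp_le_one_iff, neg_div, neg_nonpos]; positivity
  set K₁ := 1 + 2 * K ^ 2 with hK₁
  -- `D` guarantees the existence of phases at all times, `D'` keeps the jumps of the chosen phases
  -- below 1/(8K), and `D''` keeps the solution close enough to the torus for local uniqueness of
  -- phases.
  set D := 1 / (16 * K ^ 3) / (2 * C) with hD
  set D' := 1 / (8 * K) / ((8 * K + 2) * C) with hD'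
  set D'' := 1 / (4 * K) / (K₁ * (2 * C)) with hD''
  refine ⟨min (min d 1) (min D (min D' D'')), by positivity,
    K₁ * (2 * C) + (4 * K + 1) * C, ?_, ?_⟩
  · have : 0 ≤ K₁ * (2 * C) := by positivity
    nlinarith
  intro dode x ε a hx hε hεd hdode hxa
  have hεd1 : ε ≤ d := hεd.trans ((min_le_left _ _).trans (min_le_left _ _))
  have hε1 : ε ≤ 1 := hεd.trans ((min_le_left _ _).trans (min_le_right _ _))
  have hεD : 2 * C * ε ≤ 1 / (16 * K ^ 3) := by
    have : ε ≤ D := hεd.trans ((min_le_right _ _).trans (min_le_left _ _))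
    rw [hD, le_div_iff₀ (by positivity)] at this
    linarith
  have hεD' : (8 * K + 2) * C * ε ≤ 1 / (8 * K) := by
    have : ε ≤ D' :=
      hεd.trans ((min_le_right _ _).trans ((min_le_right _ _).trans (min_le_left _ _)))
    rw [hD', le_div_iff₀ (by positivity)] at this
    linarith
  have hεK : K₁ * (2 * C) * ε ≤ 1 / (4 * K) := by
    have : ε ≤ D'' :=
      hεd.trans ((min_le_right _ _).trans ((min_le_right _ _).trans (min_le_right _ _)))
    rw [hD'', le_div_iff₀ (by positivity)] at this
    linarith
  obtain ⟨p, -, hp2, hp3, hp4, -⟩ := hseq dode x ε a hx hε hεd1 hdode (hxa.trans hεd1)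
  have hθk : ∀ k : ℕ, θ ^ k * ‖x 0 - v a‖ ≤ ε := fun k => by
    have h1 : θ ^ k ≤ 1 := pow_le_one₀ hθ0.le hθ1
    calc θ ^ k * ‖x 0 - v a‖ ≤ 1 * ε := by gcongr
      _ = ε := one_mul _
  -- A discontinuous reference phase, moving with unit speed in each window and jumping by O(ε)
  -- between windows.
  set c : ℝ → ℝ × ℝ := fun t => p ⌊t / m⌋₊ + (0, t - ⌊t / m⌋₊ * m) with hc
  have hfl1 : ∀ t ≥ (0 : ℝ), ⌊t / m⌋₊ * (m : ℝ) ≤ t := fun t ht => by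
    have := Nat.floor_le (show 0 ≤ t / m by positivity)
    rwa [le_div_iff₀ hmpos] at this
  have hfl2 : ∀ t : ℝ, t < ⌊t / m⌋₊ * (m : ℝ) + m := fun t => by
    have := Nat.lt_floor_add_one (t / m)
    rw [div_lt_iff₀ hmpos] at this
    linarith
  have hxc : ∀ t ≥ 0, ‖x t - v (c t)‖ ≤ 2 * C * ε := by
    intro t ht
    have h1 := hp2 ⌊t / m⌋₊ (t - ⌊t / m⌋₊ * m) ⟨by linarith [hfl1 t ht], by linarith [hfl2 t]⟩
    rw [add_sub_cancel] at h1
    refine h1.trans ?_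
    calc _ ≤ C * (ε + ε) := by gcongr; exact hθk _
      _ = _ := by ring
  have hcc : ∀ t ≥ 0, ∀ t' ≥ t, t' < t + 1 → ‖c t' - c t‖ ≤ (t' - t) + 2 * C * ε := by
    intro t ht t' htt' hlt
    have ht' : 0 ≤ t' := ht.trans htt'
    have hn : ‖((0 : ℝ), t' - t)‖ = t' - t := by
      rw [Prod.norm_def]; rw [norm_zero, Real.norm_of_nonneg (sub_nonneg.2 htt'),
        max_eq_right (sub_nonneg.2 htt')]
    have hCε : 0 ≤ 2 * C * ε := by positivity
    have hle : ⌊t / m⌋₊ ≤ ⌊t' / m⌋₊ := Nat.floor_mono (by gcongr)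
    have hle' : ⌊t' / m⌋₊ < ⌊t / m⌋₊ + 2 := by
      rw [Nat.floor_lt (by positivity), div_lt_iff₀ hmpos]
      push_cast
      linarith [hfl2 t]
    rcases (show ⌊t' / m⌋₊ = ⌊t / m⌋₊ ∨ ⌊t' / m⌋₊ = ⌊t / m⌋₊ + 1 by omega) with h | h
    · have e : c t' - c t = (0, t' - t) := by
        simp only [hc, h]; ext <;> simp
      rw [e, hn]
      linarith
    · have e : c t' - c t = (p (⌊t / m⌋₊ + 1) - (p ⌊t / m⌋₊ + (0, (m : ℝ)))) + (0, t' - t) := by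
        simp only [hc, h]; ext <;> simp; ring
      rw [e]
      refine (norm_add_le _ _).trans ?_
      rw [hn]
      have h1 : C * (ε + (θ ^ ⌊t / m⌋₊ * ‖x 0 - v a‖) ^ 2) ≤ C * (ε + ε) := by
        gcongr
        calc (θ ^ ⌊t / m⌋₊ * ‖x 0 - v a‖) ^ 2 ≤ ε ^ 2 := by gcongr; exact hθk _
          _ ≤ ε := pow_le_of_le_one hε hε1 two_ne_zero
      linarith [hp3 ⌊t / m⌋₊]
  have hex : ∀ t ≥ 0, ∃ b, Λ b (x t - v b) = 0 ∧ ‖b - c t‖ ≤ 2 * ‖Λ (c t) (x t - v (c t))‖ :=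
    fun t ht => by
      obtain ⟨b, h1, h2, -⟩ := F.exists_phase (c t) (x t) ((hxc t ht).trans hεD)
      exact ⟨b, h1, h2⟩
  -- The phases are chosen separately for each time. Their continuity is automatic: nearby times
  -- have phases close to those of `c`, hence close to each other, where local uniqueness gives a
  -- Lipschitz bound.
  choose! b hb1 hb2 using hex
  have hbc : ∀ t ≥ 0, ‖b t - c t‖ ≤ 2 * (K * (2 * C * ε)) := by
    intro t ht
    refine (hb2 t ht).trans ?_
    gcongr
    exact (F.norm_frame_apply_le _ _).trans (by gcongr; exact hxc t ht)
  have hxb : ∀ t ≥ 0, ‖x t - v (b t)‖ ≤ K₁ * (2 * C) * ε := by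
    intro t ht
    have e : x t - v (b t) = (x t - v (c t)) - (v (b t) - v (c t)) := by abel
    rw [e]
    refine (norm_sub_le _ _).trans ?_
    have h1 := (F.v_lip (c t) (b t)).trans (mul_le_mul_of_nonneg_left (hbc t ht) hK.le)
    have h2 := hxc t ht
    rw [hK₁]
    linarith
  have hbb : ∀ t ≥ 0, ∀ t' ≥ t, t' < t + 1 → ‖b t' - b t‖ ≤ (t' - t) + 1 / (8 * K) := by
    intro t ht t' htt' hlt
    have e : b t' - b t = (b t' - c t') + (c t' - c t) - (b t - c t) := by abel
    rw [e]
    refine (norm_sub_le _ _).trans ?_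
    have h1 := norm_add_le (b t' - c t') (c t' - c t)
    have h2 := hbc t ht
    have h3 := hbc t' (ht.trans htt')
    have h4 := hcc t ht t' htt' hlt
    linarith
  refine ⟨b, fun t ht => ⟨hb1 t ht, (hxb t ht).trans ?_⟩, ?_, ?_⟩
  · have : 0 ≤ (4 * K + 1) * C * ε := by positivity
    linarith
  · have e : b 0 - a = (b 0 - c 0) + (p 0 - a) := by
      simp [hc, Prod.mk_zero_zero]
    rw [e]
    refine (norm_add_le _ _).trans ?_
    have h1 := hbc 0 le_rfl
    have h2 : C * ‖x 0 - v a‖ ≤ C * ε := by gcongr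
    have h3 : 0 ≤ K₁ * (2 * C) * ε := by positivity
    linarith
  · intro t ht
    have h8 : 0 < 1 / (8 * K) := by positivity
    have h81 : 1 / (8 * K) < 1 := by
      rw [div_lt_one (by positivity)]; linarith
    have h48 : 1 / (8 * K) + 1 / (8 * K) = 1 / (4 * K) := by field_simp; norm_num
    have hev : ∀ᶠ t' in 𝓝[Ici 0] t, t' ∈ Ici (0 : ℝ) ∩ Ioo (t - 1 / (8 * K)) (t + 1 / (8 * K)) :=
      inter_mem self_mem_nhdsWithin
        (mem_nhdsWithin_of_mem_nhds (Ioo_mem_nhds (by linarith) (by linarith)))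
    filter_upwards [hev] with t' ht'
    have h1 : ‖b t' - b t‖ ≤ 1 / (4 * K) := by
      rcases le_total t t' with h | h
      · have := hbb t ht t' h (by linarith [ht'.2.2])
        linarith [ht'.2.2]
      · rw [norm_sub_rev]
        have := hbb t' ht'.1 t h (by linarith [ht'.2.1])
        linarith [ht'.2.1]
    exact F.norm_phase_sub_le (hb1 t ht) (hb1 t' ht'.1) h1 ((hxb t ht).trans hεK)

/-- Phases along a differentiable curve are differentiable. -/
theorem exists_hasDerivWithinAt_phase (F : PhaseFrame g T τtr v A Λ K) {s : Set ℝ} {x : ℝ → X}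
    {b : ℝ → ℝ × ℝ} {t : ℝ} {x' : X} (ht : t ∈ s) (hb : ∀ t ∈ s, Λ (b t) (x t - v (b t)) = 0)
    (hxb : ‖x t - v (b t)‖ ≤ 1 / (4 * K))
    (hlip : ∀ᶠ t' in 𝓝[s] t, ‖b t' - b t‖ ≤ 2 * K * ‖x t' - x t‖)
    (hx : HasDerivWithinAt x x' s t) :
    ∃ (b' : ℝ × ℝ) (D : ℝ × ℝ →L[ℝ] ℝ × ℝ), HasDerivWithinAt b b' s t ∧
      b' = Λ (b t) x' + D b' ∧ D (0, 1) = -(T • Λ (b t) (A (b t) (x t - v (b t)))) ∧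
      ‖D‖ ≤ K * ‖x t - v (b t)‖ := by
  have hK := F.K_pos
  set y := x t - v (b t) with hy
  obtain ⟨D, hD, hD1⟩ := F.differentiable (b t) y (hb t ht)
  have hDn : ‖D‖ ≤ K * ‖y‖ := by
    refine hD.le_of_lip' (by positivity) (Eventually.of_forall fun b' => ?_)
    refine (F.norm_frame_sub_apply_le (b t) b' y).trans (le_of_eq (by ring))
  have hDn1 : ‖D‖ < 1 := by
    have h1 : K * ‖y‖ ≤ K * (1 / (4 * K)) := by gcongr
    have h2 : K * (1 / (4 * K)) = 1 / 4 := by field_simp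
    linarith
  have hxO : (fun t' => x t' - x t) =O[𝓝[s] t] fun t' => t' - t := hx.hasFDerivWithinAt.isBigO_sub
  have hbO : (fun t' => b t' - b t) =O[𝓝[s] t] fun t' => t' - t := by
    refine Asymptotics.IsBigO.trans ?_ hxO
    exact Asymptotics.IsBigO.of_bound (2 * K) hlip
  have hx0 : Tendsto (fun t' => x t' - x t) (𝓝[s] t) (𝓝 0) := by
    have := hx.continuousWithinAt.tendsto.sub_const (x t)
    rwa [sub_self] at this
  have hb0 : Tendsto (fun t' => b t' - b t) (𝓝[s] t) (𝓝 0) := by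
    refine squeeze_zero_norm' hlip ?_
    have := hx0.norm.const_mul (2 * K)
    simpa using this
  have hbt : Tendsto b (𝓝[s] t) (𝓝 (b t)) := tendsto_sub_nhds_zero_iff.1 hb0
  have o1 : (fun t' => Λ (b t') y - Λ (b t) y - D (b t' - b t)) =o[𝓝[s] t] fun t' => t' - t :=
    (hD.isLittleO.comp_tendsto hbt).trans_isBigO hbO
  have hsq : ∀ (w : ℝ → ℝ × ℝ) (q : ℝ → ℝ), (∀ t', ‖w t'‖ ≤ K * ‖b t' - b t‖ * q t') →
      Tendsto q (𝓝[s] t) (𝓝 0) → w =o[𝓝[s] t] fun t' => t' - t := by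
    intro w q hw hq
    have h1 : (fun t' => ‖b t' - b t‖ * q t') =o[𝓝[s] t] fun t' => (t' - t) * (1 : ℝ) :=
      hbO.norm_left.mul_isLittleO ((Asymptotics.isLittleO_one_iff ℝ).2 hq)
    simp only [mul_one] at h1
    refine Asymptotics.IsBigO.trans_isLittleO ?_ h1
    refine Asymptotics.IsBigO.of_bound K (Eventually.of_forall fun t' => (hw t').trans ?_)
    rw [mul_assoc]
    exact mul_le_mul_of_nonneg_left (le_abs_self _) hK.le
  have o2 : (fun t' => Λ (b t') (x t' - x t) - Λ (b t) (x t' - x t)) =o[𝓝[s] t]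
      fun t' => t' - t :=
    hsq _ (fun t' => ‖x t' - x t‖) (fun t' => F.norm_frame_sub_apply_le _ _ _)
      (by simpa using hx0.norm)
  have o3 : (fun t' => Λ (b t') (v (b t) - v (b t')) - (b t - b t')) =o[𝓝[s] t]
      fun t' => t' - t :=
    hsq _ (fun t' => ‖b t' - b t‖)
      (fun t' => by
        have := F.frame_tangent (b t') (b t)
        rw [norm_sub_rev (b t) (b t')] at this
        exact this.trans (le_of_eq (by ring)))
      (by simpa using hb0.norm)
  have o4 : (fun t' => Λ (b t) (x t' - x t - (t' - t) • x')) =o[𝓝[s] t] fun t' => t' - t :=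
    ((Λ (b t)).isBigO_comp _ _).trans_isLittleO (hasDerivWithinAt_iff_isLittleO.1 hx)
  -- Expanding the phase condition at `t'` around `t` leaves, up to o(t' - t), a linear relation
  -- between the increments of `b` and `x`. Since ‖D‖ < 1 it can be solved for the increment of `b`.
  have hBb : HasDerivWithinAt (fun t' => (1 - D) (b t')) (Λ (b t) x') s t := by
    rw [hasDerivWithinAt_iff_isLittleO]
    refine (((o1.add o2).add o3).add o4).congr' ?_ EventuallyEq.rfl
    filter_upwards [self_mem_nhdsWithin] with t' ht'
    have e1 := hb t' ht'
    have e2 := hb t ht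
    have e3 : x t' - v (b t') = (x t' - x t) + y + (v (b t) - v (b t')) := by rw [hy]; abel
    rw [e3, map_add, map_add] at e1
    rw [← hy] at e2
    have e4 : Λ (b t') (x t' - x t) =
      -Λ (b t') y - Λ (b t') (v (b t) - v (b t')) := by
      rw [eq_sub_iff_add_eq, eq_neg_iff_add_eq_zero, ← e1]; abel
    rw [e2, e4, map_sub (Λ (b t)) _ ((t' - t) • x'), map_smul]
    simp only [sub_apply, one_apply_eq_self, map_sub]
    abel
  set u := Units.oneSub D hDn1 with hu
  have hu1 : (u : ℝ × ℝ →L[ℝ] ℝ × ℝ) = 1 - D := rfl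
  set B : ℝ × ℝ →L[ℝ] ℝ × ℝ := ↑u⁻¹ with hBdef
  have hB1 : ∀ w, B ((1 - D) w) = w := fun w => by
    have : B * (1 - D) = 1 := by rw [← hu1, hBdef]; exact u.inv_mul
    exact congrArg (fun L : ℝ × ℝ →L[ℝ] ℝ × ℝ => L w) this
  have hB2 : ∀ w, (1 - D) (B w) = w := fun w => by
    have : (1 - D) * B = 1 := by rw [← hu1, hBdef]; exact u.mul_inv
    exact congrArg (fun L : ℝ × ℝ →L[ℝ] ℝ × ℝ => L w) this
  refine ⟨B (Λ (b t) x'), D, ?_, ?_, hD1, hDn⟩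
  · have := B.hasFDerivAt.comp_hasDerivWithinAt t hBb
    refine this.congr_of_mem (fun t' _ => (hB1 _).symm) ht
  · have := hB2 (Λ (b t) x')
    rw [sub_apply, one_apply_eq_self, sub_eq_iff_eq_add] at this
    exact this

/-- Phase dynamics along forced solutions near the torus. -/
theorem exists_phase_dynamics (F : PhaseFrame g T τtr v A Λ K) :
    ∃ d > 0, ∃ r > 0, ∃ C > 0, ∀ (dode x : ℝ → X) (ε : ℝ) (a : ℝ × ℝ),
      IsForcedSolution g T dode x → 0 < ε → ε ≤ d → (∀ τ ≥ 0, ‖dode τ‖ ≤ ε) →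
      ‖x 0 - v a‖ ≤ ε → ∃ b : ℝ → ℝ × ℝ, ContinuousOn b (Ici 0) ∧
      (∀ t ≥ 0, Λ (b t) (x t - v (b t)) = 0 ∧ ‖x t - v (b t)‖ ≤ C * ε) ∧ ‖b 0 - a‖ ≤ r ∧
      (∀ t ≥ 0, ∃ b' : ℝ × ℝ, HasDerivWithinAt b b' (Ici 0) t ∧
        ‖b' - (0, 1) - Λ (b t) (dode t)‖ ≤ C * ε ^ 2) ∧
      ∀ c : ℝ → ℝ × ℝ, ContinuousOn c (Ici 0) → (∀ t ≥ 0, Λ (c t) (x t - v (c t)) = 0) →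
        ‖c 0 - a‖ ≤ r → EqOn c b (Ici 0) := by
  have hK := F.K_pos
  have hT := F.T_pos
  obtain ⟨d, hd, C, hC, hcurve⟩ := F.exists_phase_curve
  have hC0 : 0 < C := by linarith
  set r := 1 / (8 * K) with hr
  have hr0 : 0 < r := by positivity
  have hrr : r + r = 1 / (4 * K) := by rw [hr]; field_simp; norm_num
  set C₁ := K * (T * (K * C ^ 2)) with hC₁
  have hC₁0 : 0 < C₁ := by positivity
  refine ⟨min (min d 1) (r / C), by positivity, r, hr0, C + C₁ + K * C * (2 * (C₁ + K)),
    by positivity, ?_⟩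
  intro dode x ε a hx hε hεd hdode hxa
  have hεd1 : ε ≤ d := hεd.trans ((min_le_left _ _).trans (min_le_left _ _))
  have hε1 : ε ≤ 1 := hεd.trans ((min_le_left _ _).trans (min_le_right _ _))
  have hεr : C * ε ≤ r := by
    have : ε ≤ r / C := hεd.trans (min_le_right _ _)
    rw [le_div_iff₀ hC0] at this
    linarith
  obtain ⟨b, hb, hb0, hlip⟩ := hcurve dode x ε a hx hε.le hεd1 hdode hxa
  have hxb : ∀ t ≥ 0, ‖x t - v (b t)‖ ≤ 1 / (4 * K) := fun t ht =>
    (hb t ht).2.trans (by linarith)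
  have hderiv : ∀ t ≥ 0, ∃ b' : ℝ × ℝ, HasDerivWithinAt b b' (Ici 0) t ∧
        ‖b' - (0, 1) - Λ (b t) (dode t)‖ ≤ (C₁ + K * C * (2 * (C₁ + K))) * ε ^ 2 := by
    intro t ht
    obtain ⟨b', D, h1, h2, h3, h4⟩ := F.exists_hasDerivWithinAt_phase ht
      (fun t ht => (hb t ht).1) (hxb t ht) (hlip t ht) (hx t ht)
    refine ⟨b', h1, ?_⟩
    set y := x t - v (b t) with hy
    set R := g (x t) - g (v (b t)) - A (b t) y with hR
    have hyε : ‖y‖ ≤ C * ε := (hb t ht).2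
    have hRn : ‖R‖ ≤ K * (C * ε) ^ 2 := (F.g_taylor (b t) (x t)).trans (by gcongr)
    set e := b' - (0, 1) with he
    have hD01 : D b' = D e + D (0, 1) := by rw [← map_add, he]; simp
    -- The value of `D` on (0, 1) cancels the linear term T Λ A y of the vector field. What remains
    -- is the Taylor remainder, and `D e`, a product of two factors of size O(ε).
    have heq : e - Λ (b t) (dode t) = Λ (b t) (T • R) + D e := by
      have hx' : T • g (x t) + dode t = T • g (v (b t)) + T • A (b t) y + T • R + dode t := by
        rw [hR]; module
      rw [hD01, h3, hx'] at h2
      simp only [map_add, map_smul] at h2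
      rw [F.frame_field] at h2
      rw [he]
      conv_lhs => rw [h2]
      rw [map_smul]
      abel
    have hΛR : ‖Λ (b t) (T • R)‖ ≤ C₁ * ε ^ 2 := by
      refine (F.norm_frame_apply_le _ _).trans ?_
      rw [norm_smul, Real.norm_of_nonneg hT.le]
      calc K * (T * ‖R‖) ≤ K * (T * (K * (C * ε) ^ 2)) := by gcongr
        _ = _ := by rw [hC₁]; ring
    have hDe : ‖D e‖ ≤ K * (C * ε) * ‖e‖ := by
      refine (D.le_of_opNorm_le h4 e).trans ?_
      gcongr
    have hKCε : K * (C * ε) ≤ 1 / 2 := by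
      have h5 : K * (C * ε) ≤ K * r := by gcongr
      have h6 : K * r = 1 / 8 := by rw [hr]; field_simp
      linarith
    have hen : ‖e‖ ≤ 2 * (C₁ + K) * ε := by
      have h5 : e = Λ (b t) (dode t) + (Λ (b t) (T • R) + D e) := by rw [← heq]; abel
      have h6 : ‖e‖ ≤ K * ε + (C₁ * ε ^ 2 + K * (C * ε) * ‖e‖) := by
        conv_lhs => rw [h5]
        refine (norm_add_le _ _).trans (add_le_add ?_ ((norm_add_le _ _).trans
          (add_le_add hΛR hDe)))
        exact (F.norm_frame_apply_le _ _).trans (by gcongr; exact hdode t ht)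
      have h7 : C₁ * ε ^ 2 ≤ C₁ * ε := by
        gcongr; exact pow_le_of_le_one hε.le hε1 two_ne_zero
      have h8 : K * (C * ε) * ‖e‖ ≤ 1 / 2 * ‖e‖ := by gcongr
      linarith
    rw [heq]
    refine (norm_add_le _ _).trans ((add_le_add hΛR hDe).trans ?_)
    have h9 : K * (C * ε) * ‖e‖ ≤ K * (C * ε) * (2 * (C₁ + K) * ε) := by gcongr
    calc _ ≤ C₁ * ε ^ 2 + K * (C * ε) * (2 * (C₁ + K) * ε) := by linarith
      _ = _ := by ring
  have hbcont : ContinuousOn b (Ici 0) := fun t ht => by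
    obtain ⟨b', h1, -⟩ := hderiv t ht
    exact h1.continuousWithinAt
  have hq : 0 ≤ C₁ + K * C * (2 * (C₁ + K)) := by positivity
  refine ⟨b, hbcont, fun t ht => ⟨(hb t ht).1, (hb t ht).2.trans ?_⟩, hb0.trans hεr, ?_, ?_⟩
  · have := mul_nonneg hq hε.le
    linarith
  · intro t ht
    obtain ⟨b', h1, h2⟩ := hderiv t ht
    refine ⟨b', h1, h2.trans ?_⟩
    have : 0 ≤ C * ε ^ 2 := by positivity
    linarith
  · intro c hc hcphase hc0 t ht
    -- The distance of two phase curves takes no value in (0, 1/(4K)]. It vanishes at time 0, as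
    -- both curves start within `r` = 1/(8K) of `a`, so by continuity it never leaves 0.
    have huniq : ∀ t ≥ 0, ‖c t - b t‖ ≤ 1 / (4 * K) → ‖c t - b t‖ = 0 := by
      intro t ht h
      have := F.norm_phase_sub_le (hb t ht).1 (hcphase t ht) h (hxb t ht)
      rw [sub_self, norm_zero, mul_zero] at this
      exact le_antisymm this (norm_nonneg _)
    have h0 : ‖c 0 - b 0‖ = 0 := by
      refine huniq 0 le_rfl ?_
      have e : c 0 - b 0 = (c 0 - a) - (b 0 - a) := by abel
      rw [e]
      exact (norm_sub_le _ _).trans (by linarith)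
    by_contra hne
    have hpos : 0 < ‖c t - b t‖ := norm_pos_iff.2 (sub_ne_zero.2 hne)
    have hcont : ContinuousOn (fun s => ‖c s - b s‖) (Icc 0 t) :=
      ((hc.sub hbcont).norm).mono Icc_subset_Ici_self
    have hmem : min ‖c t - b t‖ (1 / (4 * K)) ∈ Icc ‖c 0 - b 0‖ ‖c t - b t‖ := by
      rw [h0]; exact ⟨by positivity, min_le_left _ _⟩
    obtain ⟨s, hs, hs'⟩ := intermediate_value_Icc (mem_Ici.1 ht) hcont hmem
    have hs2 := huniq s hs.1 (hs'.le.trans (min_le_right _ _))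
    have : 0 < min ‖c t - b t‖ (1 / (4 * K)) := by positivity
    simp only at hs'
    linarith

end PhaseFrame

/-! ### Uniqueness, global existence and the flow. -/

/-- Both curves stay in one compact ball, on which the C¹ field is Lipschitz; this suffices for
Gronwall uniqueness without any global bound on `g`. -/
theorem eqOn_of_forced_ode {n : ℕ} {g : Vec n → Vec n} (hg : ContDiff ℝ 1 g) {T N : ℝ}
    {dode x y : ℝ → Vec n}
    (hx : ∀ τ ∈ Icc 0 N, HasDerivWithinAt x (T • g (x τ) + dode τ) (Icc 0 N) τ)
    (hy : ∀ τ ∈ Icc 0 N, HasDerivWithinAt y (T • g (y τ) + dode τ) (Icc 0 N) τ)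
    (h0 : x 0 = y 0) : EqOn x y (Icc 0 N) := by
  have hxc : ContinuousOn x (Icc 0 N) := fun τ hτ => (hx τ hτ).continuousWithinAt
  have hyc : ContinuousOn y (Icc 0 N) := fun τ hτ => (hy τ hτ).continuousWithinAt
  obtain ⟨R₁, hR₁⟩ := isCompact_Icc.exists_bound_of_continuousOn hxc
  obtain ⟨R₂, hR₂⟩ := isCompact_Icc.exists_bound_of_continuousOn hyc
  obtain ⟨L, hL⟩ := hg.locallyLipschitz.locallyLipschitzOn.exists_lipschitzOnWith_of_compact
    (isCompact_closedBall (0 : Vec n) (max R₁ R₂))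
  have hder : ∀ z : ℝ → Vec n, (∀ τ ∈ Icc 0 N, HasDerivWithinAt z (T • g (z τ) + dode τ)
      (Icc 0 N) τ) → ∀ τ ∈ Ico 0 N, HasDerivWithinAt z (T • g (z τ) + dode τ) (Ici τ) τ :=
    fun z hz τ hτ => (hz τ ⟨hτ.1, hτ.2.le⟩).mono_of_mem_nhdsWithin
      (mem_of_superset (Icc_mem_nhdsGE hτ.2) (Icc_subset_Icc_left hτ.1))
  refine ODE_solution_unique_of_mem_Icc_right (v := fun τ z => T • g z + dode τ)
    (s := fun _ => Metric.closedBall 0 (max R₁ R₂)) (K := ‖T‖₊ * L) ?_ hxc (hder x hx) ?_ hyc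
    (hder y hy) ?_ h0
  · intro t _
    refine LipschitzOnWith.of_dist_le_mul fun z hz w hw => ?_
    rw [dist_add_right, dist_smul₀, NNReal.coe_mul, mul_assoc, coe_nnnorm]
    gcongr
    exact hL.dist_le_mul z hz w hw
  · intro t ht
    rw [mem_closedBall_zero_iff]
    exact (hR₁ t ⟨ht.1, ht.2.le⟩).trans (le_max_left _ _)
  · intro t ht
    rw [mem_closedBall_zero_iff]
    exact (hR₂ t ⟨ht.1, ht.2.le⟩).trans (le_max_right _ _)

theorem IsForcedSolution.eqOn {n : ℕ} {g : Vec n → Vec n} (hg : ContDiff ℝ 1 g) {T : ℝ}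
    {dode x y : ℝ → Vec n} (hx : IsForcedSolution g T dode x) (hy : IsForcedSolution g T dode y)
    (h0 : x 0 = y 0) : EqOn x y (Ici 0) := fun _ ht =>
  eqOn_of_forced_ode hg (fun τ hτ => (hx τ hτ.1).mono Icc_subset_Ici_self)
    (fun τ hτ => (hy τ hτ.1).mono Icc_subset_Ici_self) h0 (right_mem_Icc.2 ht)

/-- Global existence for bounded Lipschitz vector fields with bounded forcing. -/
theorem exists_isForcedSolution {n : ℕ} {g : Vec n → Vec n} (hg : ContDiff ℝ 1 g) {T K B ε : ℝ}
    (hlip : ∀ x y, ‖g x - g y‖ ≤ K * ‖x - y‖) (hB : ∀ x, ‖g x‖ ≤ B) {dode : ℝ → Vec n}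
    (hd : ContinuousOn dode (Ici 0)) (hdε : ∀ τ ≥ 0, ‖dode τ‖ ≤ ε) (x₀ : Vec n) :
    ∃ x, x 0 = x₀ ∧ IsForcedSolution g T dode x := by
  have hloc : ∀ N : ℕ, ∃ α : ℝ → Vec n, α 0 = x₀ ∧
      ∀ t ∈ Icc (0 : ℝ) N, HasDerivWithinAt α (T • g (α t) + dode t) (Icc 0 N) t := by
    intro N
    have hN : (0 : ℝ) ≤ N := Nat.cast_nonneg N
    set L : NNReal := ‖T‖₊ * B.toNNReal + ε.toNNReal with hL
    -- The ball has radius `L * N`, the farthest a curve of speed at most `L` can travel in time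
    -- `N`, so the local theorem covers the whole interval.
    have hpl : IsPicardLindelof (fun t z => T • g z + dode t)
        (⟨0, le_rfl, hN⟩ : Icc (0 : ℝ) N) x₀ (L * N) 0 L (‖T‖₊ * K.toNNReal) := by
      refine ⟨?_, ?_, ?_, ?_⟩
      · intro t _
        refine LipschitzOnWith.of_dist_le_mul fun z _ w _ => ?_
        rw [dist_add_right, dist_smul₀, NNReal.coe_mul, mul_assoc, coe_nnnorm, dist_eq_norm,
          dist_eq_norm]
        gcongr
        exact (hlip z w).trans (by gcongr; exact Real.le_coe_toNNReal K)
      · intro z _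
        exact continuousOn_const.add (hd.mono Icc_subset_Ici_self)
      · intro t ht z _
        refine (norm_add_le _ _).trans ?_
        rw [norm_smul, hL]
        push_cast
        gcongr
        · exact (hB z).trans (Real.le_coe_toNNReal B)
        · exact (hdε t ht.1).trans (Real.le_coe_toNNReal ε)
      · simp
    exact hpl.exists_eq_forall_mem_Icc_hasDerivWithinAt₀
  choose α hα0 hα using hloc
  have hagree : ∀ M N : ℕ, M ≤ N → EqOn (α M) (α N) (Icc 0 M) := by
    intro M N hMN
    have hMN' : (M : ℝ) ≤ N := by exact_mod_cast hMN
    refine eqOn_of_forced_ode hg (hα M) (fun τ hτ => ?_) (by rw [hα0, hα0])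
    exact (hα N τ ⟨hτ.1, hτ.2.trans hMN'⟩).mono (Icc_subset_Icc_right hMN')
  -- The index `⌊t⌋₊ + 1` puts `t` strictly inside the interval of its local solution on the right,
  -- so derivatives survive the gluing at integers.
  refine ⟨fun t => α (⌊t⌋₊ + 1) t, hα0 _, fun t ht => ?_⟩
  have ht' : (0 : ℝ) ≤ t := ht
  have hlt : t < (⌊t⌋₊ + 1 : ℕ) := by push_cast; exact Nat.lt_floor_add_one t
  have h1 := (hα (⌊t⌋₊ + 1) t ⟨ht', hlt.le⟩).mono_of_mem_nhdsWithin (s := Ici 0)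
    (by
      rw [mem_nhdsWithin]
      exact ⟨Iio _, isOpen_Iio, hlt, fun s hs => ⟨hs.2, le_of_lt hs.1⟩⟩)
  refine h1.congr_of_eventuallyEq ?_ rfl
  have hev : ∀ᶠ s in 𝓝[Ici 0] t, s ∈ Ici (0 : ℝ) ∩ Iio ((⌊t⌋₊ + 1 : ℕ) : ℝ) :=
    inter_mem self_mem_nhdsWithin (mem_nhdsWithin_of_mem_nhds (Iio_mem_nhds hlt))
  filter_upwards [hev] with s hs
  have hs2 : s < (⌊t⌋₊ + 1 : ℕ) := hs.2
  have hle : ⌊s⌋₊ + 1 ≤ ⌊t⌋₊ + 1 := by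
    have := (Nat.floor_lt hs.1).2 hs2
    omega
  refine hagree _ _ hle ⟨hs.1, ?_⟩
  push_cast
  exact (Nat.lt_floor_add_one s).le

theorem flow_eq_of_isTrajectory {n : ℕ} {g : Vec n → Vec n} (hg : ContDiff ℝ 1 g) {t : ℝ}
    (ht : 0 ≤ t) {x₀ : Vec n} {γ : ℝ → Vec n} (hγ : IsTrajectory g x₀ t γ) :
    FlowDefined g t x₀ ∧ flow g t x₀ = γ t := by
  have H : FlowDefined g t x₀ := ⟨γ, hγ⟩
  refine ⟨H, ?_⟩
  rw [flow, dif_pos H]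
  have key : ∀ γ, IsTrajectory g x₀ t γ →
      ∀ s ∈ Icc 0 t, HasDerivWithinAt γ ((1 : ℝ) • g (γ s) + 0) (Icc 0 t) s := by
    intro γ hγ s hs
    have := hγ.2 s (by rwa [uIcc_of_le ht])
    rwa [uIcc_of_le ht, ← one_smul ℝ (g (γ s)), ← add_zero ((1 : ℝ) • g (γ s))] at this
  exact eqOn_of_forced_ode (dode := fun _ => 0) hg (key _ H.choose_spec) (key _ hγ)
    (H.choose_spec.1.trans hγ.1.symm) (right_mem_Icc.2 ht)

/-- Rescaling time by `T` turns solutions of the scaled equation into trajectories of `g`. -/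
theorem IsForcedSolution.flow_eq {n : ℕ} {g : Vec n → Vec n} (hg : ContDiff ℝ 1 g) {T τ : ℝ}
    (hT : 0 < T) (hτ : 0 ≤ τ) {x : ℝ → Vec n} (hx : IsForcedSolution g T (fun _ => 0) x) :
    FlowDefined g (T * τ) (x 0) ∧ flow g (T * τ) (x 0) = x τ := by
  have hTτ : 0 ≤ T * τ := by positivity
  have htraj : IsTrajectory g (x 0) (T * τ) (fun s => x (s / T)) := by
    refine ⟨by simp, fun s hs => ?_⟩
    rw [uIcc_of_le hTτ] at hs ⊢
    have h1 := hx (s / T) (div_nonneg hs.1 hT.le)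
    have h2 : HasDerivWithinAt (fun s : ℝ => s / T) (1 / T) (Icc 0 (T * τ)) s :=
      ((hasDerivAt_id s).div_const T).hasDerivWithinAt
    have h3 := HasDerivWithinAt.scomp s h1 h2 (fun r hr => div_nonneg hr.1 hT.le)
    rw [add_zero, smul_smul, one_div, inv_mul_cancel₀ hT.ne', one_smul] at h3
    exact h3
  have := flow_eq_of_isTrajectory hg hTτ htraj
  rwa [mul_div_cancel_left₀ _ hT.ne'] at this

/-- Unforced flow near the torus, when the frame is given for a field `gt` that agrees with `g` near
the torus. -/
theorem PhaseFrame.exists_flow_asymptotics {n : ℕ} {g gt : Vec n → Vec n} {T τtr K B : ℝ}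
    {v : ℝ × ℝ → Vec n} {A : ℝ × ℝ → Vec n →L[ℝ] Vec n} {Λ : ℝ × ℝ → Vec n →L[ℝ] ℝ × ℝ}
    (F : PhaseFrame gt T τtr v A Λ K) (hg : ContDiff ℝ 1 g) (hgt : ContDiff ℝ 1 gt)
    (hB : ∀ x, ‖gt x‖ ≤ B) (hagree : ∀ b x, ‖x - v b‖ ≤ 1 → gt x = g x) :
    (∀ b, ∀ τ ≥ 0, FlowDefined g (T * τ) (v b) ∧ flow g (T * τ) (v b) = v (b + (0, τ))) ∧
    ∃ d₀ > 0, ∃ C ≥ 1, ∀ (a : ℝ × ℝ) (d : Vec n), ‖d‖ ≤ d₀ → ∃ b,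
      ‖b - (a + Λ a d)‖ ≤ C * ‖d‖ ^ 2 ∧ ∀ τ ≥ 0, FlowDefined g (T * τ) (v a + d) ∧
      ‖flow g (T * τ) (v a + d) - v (b + (0, τ))‖ ≤ C * Real.exp (-τ / (2 * τtr)) * ‖d‖ := by
  have hT := F.T_pos
  have hτtr := F.τ_pos
  constructor
  · intro b τ hτ
    have h1 : IsForcedSolution g T (fun _ => 0) (fun s => v (b + (0, s))) := by
      intro s _
      rw [add_zero, ← hagree (b + (0, s)) _ (by simp)]
      exact (F.ode b s).hasDerivWithinAt
    have := h1.flow_eq hg hT hτ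
    simpa [Prod.mk_zero_zero] using this
  · obtain ⟨d₀, hd₀, C, hC, h⟩ := F.exists_asymptotic_phase
    -- The bound 1/C keeps the solution within distance 1 of the torus, where `gt` and `g` agree.
    refine ⟨min d₀ (1 / C), by positivity, C, hC, fun a d hd => ?_⟩
    obtain ⟨x, hx0, hx⟩ := exists_isForcedSolution (T := T) hgt F.g_lip hB
      (dode := fun _ => 0) (ε := 0) continuousOn_const (by simp) (v a + d)
    have e : x 0 - v a = d := by rw [hx0]; abel
    obtain ⟨b, hb1, hb2⟩ := h x a hx (by rw [e]; exact hd.trans (min_le_left _ _))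
    rw [e] at hb1 hb2
    have hCd : C * ‖d‖ ≤ 1 := by
      have := hd.trans (min_le_right _ _)
      rw [le_div_iff₀ (by linarith)] at this
      linarith
    have hx' : IsForcedSolution g T (fun _ => 0) x := by
      intro s hs
      rw [← hagree (b + (0, s)) (x s) ?_]
      · exact hx s hs
      · refine (hb2 s hs).trans (le_trans ?_ hCd)
        have h1 : Real.exp (-s / (2 * τtr)) ≤ 1 := by
          rw [Real.exp_le_one_iff, neg_div, neg_nonpos]
          have : (0 : ℝ) ≤ s := hs
          positivity
        calc C * Real.exp (-s / (2 * τtr)) * ‖d‖ ≤ C * 1 * ‖d‖ := by gcongr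
          _ = C * ‖d‖ := by rw [mul_one]
    refine ⟨b, by rwa [← sub_sub], fun τ hτ => ?_⟩
    have hfl := hx'.flow_eq hg hT hτ
    rw [hx0] at hfl
    rw [hfl.2]
    exact ⟨hfl.1, hb2 τ hτ⟩

/-! ### The three assertions, derived from a phase frame. -/

section Conclusions

variable {n : ℕ} {g gt : Vec n → Vec n} {T τtr K B : ℝ} {v lT lρ : ℝ → ℝ → Vec n}
    {A : ℝ × ℝ → Vec n →L[ℝ] Vec n} {Λ : ℝ × ℝ → Vec n →L[ℝ] ℝ × ℝ}

theorem PhaseFrame.perturbed_phase_dynamics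
    (F : PhaseFrame gt T τtr (fun b => v b.1 b.2) A Λ K) (hg : ContDiff ℝ 1 g)
    (hgt : ContDiff ℝ 1 gt) (hB : ∀ x, ‖gt x‖ ≤ B)
    (hagree : ∀ (b : ℝ × ℝ) x, ‖x - v b.1 b.2‖ ≤ 1 → gt x = g x)
    (hΛ : ∀ b y, Λ b y = (-inner ℝ (lρ b.1 b.2) y, inner ℝ (lT b.1 b.2) y / T)) :
    ∃ ε₀ > 0, ∃ r > 0, ∃ C > 0, ∀ ε : ℝ, 0 < ε → ε ≤ ε₀ →
      ∀ dode : ℝ → Vec n, ContinuousOn dode (Set.Ici 0) → (∀ τ ≥ 0, ‖dode τ‖ ≤ ε) →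
      ∀ (φ₀ σ₀ : ℝ) (x₀ : Vec n), ‖x₀ - v φ₀ σ₀‖ ≤ ε →
        (∃ x, IsPerturbedTrajectory g T dode x₀ x) ∧
        ∀ x, IsPerturbedTrajectory g T dode x₀ x →
          ∃ φ σ : ℝ → ℝ,
            IsPhaseDecomposition v lT lρ x φ σ ∧ |φ 0 - φ₀| ≤ r ∧ |σ 0 - σ₀| ≤ r ∧
            DifferentiableOn ℝ φ (Set.Ici 0) ∧ DifferentiableOn ℝ σ (Set.Ici 0) ∧
            (∀ τ ≥ 0,
              ‖x τ - v (φ τ) (σ τ)‖ ≤ C * ε ∧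
              |derivWithin φ (Set.Ici 0) τ - -inner ℝ (lρ (φ τ) (σ τ)) (dode τ)| ≤ C * ε ^ 2 ∧
              |derivWithin σ (Set.Ici 0) τ - (1 + inner ℝ (lT (φ τ) (σ τ)) (dode τ) / T)|
                ≤ C * ε ^ 2) ∧
            ∀ φ' σ' : ℝ → ℝ, IsPhaseDecomposition v lT lρ x φ' σ' →
              |φ' 0 - φ₀| ≤ r → |σ' 0 - σ₀| ≤ r →
              Set.EqOn φ' φ (Set.Ici 0) ∧ Set.EqOn σ' σ (Set.Ici 0) := by
  have hT := F.T_pos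
  have hΛ0 : ∀ b y, Λ b y = 0 ↔ inner ℝ (lT b.1 b.2) y = 0 ∧ inner ℝ (lρ b.1 b.2) y = 0 := by
    intro b y
    rw [hΛ, Prod.mk_eq_zero, neg_eq_zero, div_eq_zero_iff, or_iff_left hT.ne']
    exact and_comm
  obtain ⟨d, hd, r, hr, C, hC, h⟩ := F.exists_phase_dynamics
  refine ⟨min d (1 / C), by positivity, r, hr, C, hC, ?_⟩
  intro ε hε hεd dode hdc hdε φ₀ σ₀ x₀ hx₀
  have hεd1 := hεd.trans (min_le_left _ _)
  have hCε : C * ε ≤ 1 := by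
    have := hεd.trans (min_le_right _ _)
    rw [le_div_iff₀ hC] at this
    linarith
  obtain ⟨xt, hxt0, hxt⟩ := exists_isForcedSolution (T := T) hgt F.g_lip hB hdc hdε x₀
  obtain ⟨bt, -, hbt, -⟩ := h dode xt ε (φ₀, σ₀) hxt hε hεd1 hdε (by rw [hxt0]; exact hx₀)
  have hgxt : ∀ t ≥ 0, gt (xt t) = g (xt t) := fun t ht =>
    hagree (bt t) (xt t) ((hbt t ht).2.trans hCε)
  have hxtg : IsForcedSolution g T dode xt := fun t ht => by
    rw [← hgxt t ht]; exact hxt t ht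
  refine ⟨⟨xt, hxt0, hxtg⟩, fun x hx => ?_⟩
  -- An arbitrary solution for `g` is not known to stay near the torus. Uniqueness identifies it
  -- with the one constructed for `gt`, which does.
  have heq : EqOn x xt (Ici 0) := IsForcedSolution.eqOn hg hx.2 hxtg (hx.1.trans hxt0.symm)
  have hx' : IsForcedSolution gt T dode x := fun t ht => by
    have h1 := hx.2 t ht
    rw [heq ht, ← hgxt t ht, ← heq ht] at h1
    exact h1
  obtain ⟨b, hbc, hb, hb0, hb', huniq⟩ := h dode x ε (φ₀, σ₀) hx' hε hεd1 hdε
    (by rw [hx.1]; exact hx₀)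
  have hprod : ∀ (c : ℝ × ℝ), ‖c - (φ₀, σ₀)‖ ≤ r ↔ |c.1 - φ₀| ≤ r ∧ |c.2 - σ₀| ≤ r := by
    intro c
    rw [Prod.norm_def, max_le_iff]; rfl
  have hfst : ∀ t ≥ 0, ∀ b', HasDerivWithinAt b b' (Ici 0) t →
      HasDerivWithinAt (fun t => (b t).1) b'.1 (Ici 0) t := fun t _ b' hd => by
    exact (ContinuousLinearMap.fst ℝ ℝ ℝ).hasFDerivAt.comp_hasDerivWithinAt t hd
  have hsnd : ∀ t ≥ 0, ∀ b', HasDerivWithinAt b b' (Ici 0) t →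
      HasDerivWithinAt (fun t => (b t).2) b'.2 (Ici 0) t := fun t _ b' hd => by
    exact (ContinuousLinearMap.snd ℝ ℝ ℝ).hasFDerivAt.comp_hasDerivWithinAt t hd
  refine ⟨fun t => (b t).1, fun t => (b t).2, ⟨hbc.fst, hbc.snd, fun t ht =>
    (hΛ0 _ _).1 (hb t ht).1⟩, ((hprod _).1 hb0).1, ((hprod _).1 hb0).2, ?_, ?_, ?_, ?_⟩
  · intro t ht
    obtain ⟨b', h1, -⟩ := hb' t ht
    exact (hfst t ht b' h1).differentiableWithinAt
  · intro t ht
    obtain ⟨b', h1, -⟩ := hb' t ht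
    exact (hsnd t ht b' h1).differentiableWithinAt
  · intro t ht
    obtain ⟨b', h1, h2⟩ := hb' t ht
    have hu : UniqueDiffWithinAt ℝ (Ici (0 : ℝ)) t := uniqueDiffOn_Ici 0 t ht
    rw [(hfst t ht b' h1).derivWithin hu, (hsnd t ht b' h1).derivWithin hu]
    refine ⟨(hb t ht).2, ?_⟩
    rw [hΛ, Prod.norm_def, max_le_iff] at h2
    simpa [sub_sub] using h2
  · intro φ' σ' hdec hφ hσ
    have := huniq (fun t => (φ' t, σ' t)) (hdec.1.prodMk hdec.2.1)
      (fun t ht => (hΛ0 _ _).2 (hdec.2.2 t ht)) ((hprod _).2 ⟨hφ, hσ⟩)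
    exact ⟨fun t ht => congrArg Prod.fst (this ht), fun t ht => congrArg Prod.snd (this ht)⟩

theorem PhaseFrame.flow_comparison
    (F : PhaseFrame gt T τtr (fun b => v b.1 b.2) A Λ K) (hg : ContDiff ℝ 1 g)
    (hgt : ContDiff ℝ 1 gt) (hB : ∀ x, ‖gt x‖ ≤ B)
    (hagree : ∀ (b : ℝ × ℝ) x, ‖x - v b.1 b.2‖ ≤ 1 → gt x = g x)
    (hΛ : ∀ b y, Λ b y = (-inner ℝ (lρ b.1 b.2) y, inner ℝ (lT b.1 b.2) y / T)) :
    ∃ d₀ > 0, ∃ C > 0, ∀ (φ₀ σ₀ : ℝ) (d : Vec n), ‖d‖ ≤ d₀ → ∀ τ ≥ 0,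
      FlowDefined g (T * τ) (v φ₀ σ₀ + d) ∧
      FlowDefined g (T * τ)
        (v (φ₀ - inner ℝ (lρ φ₀ σ₀) d) (σ₀ + inner ℝ (lT φ₀ σ₀) d / T)) ∧
      ‖flow g (T * τ) (v φ₀ σ₀ + d) -
        flow g (T * τ)
          (v (φ₀ - inner ℝ (lρ φ₀ σ₀) d) (σ₀ + inner ℝ (lT φ₀ σ₀) d / T))‖
        ≤ C * ‖d‖ ^ 2 + C * Real.exp (-τ / τtr) := by
  have hτtr := F.τ_pos
  have hK := F.K_pos
  obtain ⟨h1, d₀, hd₀, C, hC, h2⟩ := F.exists_flow_asymptotics hg hgt hB hagree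
  refine ⟨d₀, hd₀, C + K * C, by positivity, fun φ₀ σ₀ d hd τ hτ => ?_⟩
  obtain ⟨b, hb, hb'⟩ := h2 (φ₀, σ₀) d hd
  set c : ℝ × ℝ := (φ₀ - inner ℝ (lρ φ₀ σ₀) d, σ₀ + inner ℝ (lT φ₀ σ₀) d / T) with hc
  have hcΛ : (φ₀, σ₀) + Λ (φ₀, σ₀) d = c := by
    rw [hΛ, hc]; simp [sub_eq_add_neg]
  rw [hcΛ] at hb
  have hfc := h1 c τ hτ
  have hfd := hb' τ hτ
  simp only at hfc hfd
  refine ⟨hfd.1, hfc.1, ?_⟩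
  have e1 : flow g (T * τ) (v (φ₀ - inner ℝ (lρ φ₀ σ₀) d) (σ₀ + inner ℝ (lT φ₀ σ₀) d / T)) =
    v (c + (0, τ)).1 (c + (0, τ)).2 := hfc.2
  rw [e1]
  have e2 : flow g (T * τ) (v φ₀ σ₀ + d) - v (c + (0, τ)).1 (c + (0, τ)).2 =
      (flow g (T * τ) (v φ₀ σ₀ + d) - v (b + (0, τ)).1 (b + (0, τ)).2)
      + (v (b + (0, τ)).1 (b + (0, τ)).2 - v (c + (0, τ)).1 (c + (0, τ)).2) := by abel
  rw [e2]
  refine (norm_add_le _ _).trans ?_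
  have h3 : ‖v (b + (0, τ)).1 (b + (0, τ)).2 - v (c + (0, τ)).1 (c + (0, τ)).2‖ ≤
      K * (C * ‖d‖ ^ 2) := by
    refine (F.v_lip (c + (0, τ)) (b + (0, τ))).trans ?_
    rw [add_sub_add_right_eq_sub]
    gcongr
  -- The halved rate comes with a factor ‖d‖, so the inequality between ab and a² + b² restores the
  -- full rate at the price of a quadratic term.
  have h4 : Real.exp (-τ / (2 * τtr)) * ‖d‖ ≤ ‖d‖ ^ 2 + Real.exp (-τ / τtr) := by
    have : Real.exp (-τ / τtr) = Real.exp (-τ / (2 * τtr)) ^ 2 := by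
      rw [← Real.exp_nat_mul]; congr 1; push_cast; field_simp
    rw [this]
    nlinarith [sq_nonneg (Real.exp (-τ / (2 * τtr)) - ‖d‖),
      sq_nonneg (Real.exp (-τ / (2 * τtr)) + ‖d‖)]
  have h5 : C * (Real.exp (-τ / (2 * τtr)) * ‖d‖) ≤ C * (‖d‖ ^ 2 + Real.exp (-τ / τtr)) := by
    gcongr
  have h6 : 0 ≤ K * C * Real.exp (-τ / τtr) := by positivity
  linarith [hfd.2]

theorem PhaseFrame.asymptotic_phase_linearization
    (F : PhaseFrame gt T τtr (fun b => v b.1 b.2) A Λ K) (hg : ContDiff ℝ 1 g)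
    (hgt : ContDiff ℝ 1 gt) (hB : ∀ x, ‖gt x‖ ≤ B)
    (hagree : ∀ (b : ℝ × ℝ) x, ‖x - v b.1 b.2‖ ≤ 1 → gt x = g x)
    (hΛ : ∀ b y, Λ b y = (-inner ℝ (lρ b.1 b.2) y, inner ℝ (lT b.1 b.2) y / T)) :
    ∃ d₀ > 0, ∃ r > 0, ∃ C > 0, ∀ (φ₀ σ₀ : ℝ) (d : Vec n), ‖d‖ ≤ d₀ →
      ∃ φs σs : ℝ, IsAsymptoticPhase g T v (v φ₀ σ₀ + d) φs σs ∧
        |φs - φ₀| ≤ r ∧ |σs - σ₀| ≤ r ∧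
        |φs - (φ₀ - inner ℝ (lρ φ₀ σ₀) d)| ≤ C * ‖d‖ ^ 2 ∧
        |σs - (σ₀ + inner ℝ (lT φ₀ σ₀) d / T)| ≤ C * ‖d‖ ^ 2 ∧
        ∀ φ' σ' : ℝ, IsAsymptoticPhase g T v (v φ₀ σ₀ + d) φ' σ' →
          |φ' - φ₀| ≤ r → |σ' - σ₀| ≤ r → φ' = φs ∧ σ' = σs := by
  have hτtr := F.τ_pos
  have hK := F.K_pos
  obtain ⟨h1, d₀, hd₀, C, hC, h2⟩ := F.exists_flow_asymptotics hg hgt hB hagree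
  set r := 1 / (4 * K) with hr
  have hr0 : 0 < r := by positivity
  have hrr : r + r = 1 / (2 * K) := by rw [hr]; field_simp; norm_num
  refine ⟨min d₀ (min 1 (r / (K + C))), by positivity, r, hr0, C, by positivity,
    fun φ₀ σ₀ d hd => ?_⟩
  have hd1 : ‖d‖ ≤ 1 := hd.trans ((min_le_right _ _).trans (min_le_left _ _))
  have hd2 : (K + C) * ‖d‖ ≤ r := by
    have := hd.trans ((min_le_right _ _).trans (min_le_right _ _))
    rw [le_div_iff₀ (by positivity)] at this
    linarith
  have hprod : ∀ (c c' : ℝ × ℝ) (r : ℝ), ‖c - c'‖ ≤ r ↔ |c.1 - c'.1| ≤ r ∧ |c.2 - c'.2| ≤ r := by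
    intro c c' r
    rw [Prod.norm_def, max_le_iff]; rfl
  obtain ⟨b, hb, hb'⟩ := h2 (φ₀, σ₀) d (hd.trans (min_le_left _ _))
  set c : ℝ × ℝ := (φ₀ - inner ℝ (lρ φ₀ σ₀) d, σ₀ + inner ℝ (lT φ₀ σ₀) d / T) with hc
  have hcΛ : (φ₀, σ₀) + Λ (φ₀, σ₀) d = c := by
    rw [hΛ, hc]; simp [sub_eq_add_neg]
  have hba : ‖b - (φ₀, σ₀)‖ ≤ r := by
    have e : b - (φ₀, σ₀) = (b - ((φ₀, σ₀) + Λ (φ₀, σ₀) d)) + Λ (φ₀, σ₀) d := by abel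
    rw [e]
    refine (norm_add_le _ _).trans ?_
    have h3 := F.norm_frame_apply_le (φ₀, σ₀) d
    have h4 : C * ‖d‖ ^ 2 ≤ C * ‖d‖ := by
      gcongr; exact pow_le_of_le_one (norm_nonneg _) hd1 two_ne_zero
    linarith
  rw [hcΛ] at hb
  have hconv : Tendsto (fun τ => flow g (T * τ) (v φ₀ σ₀ + d) - v (b + (0, τ)).1 (b + (0, τ)).2)
      atTop (𝓝 0) := by
    have hz : Tendsto (fun τ => C * Real.exp (-τ / (2 * τtr)) * ‖d‖) atTop (𝓝 0) := by
      have : Tendsto (fun τ => Real.exp (-τ / (2 * τtr))) atTop (𝓝 0) :=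
        Real.tendsto_exp_atBot.comp
          (tendsto_neg_atTop_atBot.atBot_div_const (by positivity))
      simpa using (this.const_mul C).mul_const ‖d‖
    refine squeeze_zero_norm' ?_ hz
    filter_upwards [eventually_ge_atTop 0] with τ hτ
    exact (hb' τ hτ).2
  have hasym : ∀ c : ℝ × ℝ, Tendsto (fun τ => flow g (T * τ) (v φ₀ σ₀ + d)
        - flow g (T * τ) (v c.1 c.2)) atTop (𝓝 0) ↔
      Tendsto (fun τ => flow g (T * τ) (v φ₀ σ₀ + d) - v (c + (0, τ)).1 (c + (0, τ)).2)
      atTop (𝓝 0) := by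
    intro c
    refine tendsto_congr' ?_
    filter_upwards [eventually_ge_atTop 0] with τ hτ
    rw [show flow g (T * τ) (v c.1 c.2) = v (c + (0, τ)).1 (c + (0, τ)).2 from (h1 c τ hτ).2]
  refine ⟨b.1, b.2, ⟨fun τ hτ => (hb' τ hτ).1, (hasym b).2 hconv⟩, ((hprod _ _ _).1 hba).1,
    ((hprod _ _ _).1 hba).2, ((hprod _ _ _).1 hb).1, ((hprod _ _ _).1 hb).2, ?_⟩
  intro φ' σ' hφσ hφ hσ
  have h3 := (hasym (φ', σ')).1 hφσ.2
  have h4 := hconv.sub h3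
  rw [sub_zero] at h4
  have h5 : (φ', σ') = b := by
    refine F.eq_of_tendsto_sub ?_ (h4.congr fun τ => sub_sub_sub_cancel_left _ _ _)
    have e : (φ', σ') - b = ((φ', σ') - (φ₀, σ₀)) - (b - (φ₀, σ₀)) := by abel
    rw [e]
    refine (norm_sub_le _ _).trans ?_
    have := (hprod (φ', σ') (φ₀, σ₀) r).2 ⟨hφ, hσ⟩
    linarith
  rw [← h5]
  exact ⟨rfl, rfl⟩

end Conclusions

/-! ### Functions on the torus, on its universal cover. -/

/-- Functions on the torus with rotation number `ρ`, written on the universal cover `ℝ × ℝ`. -/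
def TorusPeriodic {F : Type*} (ρ : ℝ) (w : ℝ × ℝ → F) : Prop :=
  (∀ b, w (b + (1, 0)) = w b) ∧ ∀ b, w (b + (0, 1)) = w (b + (ρ, 0))

namespace TorusPeriodic

variable {F : Type*} {ρ : ℝ} {w : ℝ × ℝ → F}

/-- Along the lines s ↦ (x - sρ, s) the function has period 1, so τ can be reduced to its fractional
part first, and φ afterwards. Compactness of the square then makes continuous torus functions
bounded. -/
theorem exists_mem_unitSquare (h : TorusPeriodic ρ w) (b : ℝ × ℝ) :
    ∃ c ∈ Icc (0 : ℝ) 1 ×ˢ Icc (0 : ℝ) 1, w b = w c := by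
  have h1 : ∀ s, Function.Periodic (fun x => w (x, s)) 1 := fun s x => by
    have := h.1 (x, s)
    simpa using this
  have h2 : Function.Periodic (fun s => w (b.1 + b.2 * ρ - s * ρ, s)) 1 := fun s => by
    have := h.2 (b.1 + b.2 * ρ - (s + 1) * ρ, s)
    simp only [Prod.mk_add_mk, add_zero] at this
    refine this.trans ?_
    simp only
    congr 2
    ring
  have e1 : w b = w (b.1 + b.2 * ρ - Int.fract b.2 * ρ, Int.fract b.2) := by
    have := h2.sub_int_mul_eq (x := b.2) ⌊b.2⌋
    simp only [mul_one] at this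
    rw [Int.self_sub_floor] at this
    rw [this, add_sub_cancel_right]
  set y := b.1 + b.2 * ρ - Int.fract b.2 * ρ with hy
  have e2 : w (y, Int.fract b.2) = w (Int.fract y, Int.fract b.2) := by
    have := (h1 (Int.fract b.2)).sub_int_mul_eq (x := y) ⌊y⌋
    simp only [mul_one] at this
    rw [Int.self_sub_floor] at this
    exact this.symm
  exact ⟨_, ⟨⟨Int.fract_nonneg _, (Int.fract_lt_one _).le⟩,
    ⟨Int.fract_nonneg _, (Int.fract_lt_one _).le⟩⟩, e1.trans e2⟩

theorem comp {G : Type*} (h : TorusPeriodic ρ w) (k : F → G) :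
    TorusPeriodic ρ (fun b => k (w b)) :=
  ⟨fun b => congrArg k (h.1 b), fun b => congrArg k (h.2 b)⟩

variable [NormedAddCommGroup F]

theorem exists_norm_le (h : TorusPeriodic ρ w) (hc : Continuous w) : ∃ C, ∀ b, ‖w b‖ ≤ C := by
  obtain ⟨C, hC⟩ := (isCompact_Icc.prod isCompact_Icc).exists_bound_of_continuousOn
    (hc.continuousOn (s := Icc (0 : ℝ) 1 ×ˢ Icc (0 : ℝ) 1))
  refine ⟨C, fun b => ?_⟩
  obtain ⟨c, hc, e⟩ := h.exists_mem_unitSquare b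
  rw [e]
  exact hC c hc

variable [NormedSpace ℝ F]

theorem fderiv (h : TorusPeriodic ρ w) : TorusPeriodic ρ (fderiv ℝ w) := by
  constructor
  · intro b
    rw [← fderiv_comp_add_right]
    congr 1
    exact funext h.1
  · intro b
    rw [← fderiv_comp_add_right, ← fderiv_comp_add_right]
    congr 1
    exact funext h.2

theorem exists_lipschitz (h : TorusPeriodic ρ w) (hw : ContDiff ℝ 1 w) :
    ∃ C, 0 ≤ C ∧ ∀ b b', ‖w b' - w b‖ ≤ C * ‖b' - b‖ := by
  obtain ⟨C, hC⟩ := h.fderiv.exists_norm_le (hw.continuous_fderiv one_ne_zero)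
  refine ⟨C, (norm_nonneg _).trans (hC 0), fun b b' => ?_⟩
  exact convex_univ.norm_image_sub_le_of_norm_fderiv_le
    (fun x _ => (hw.differentiable one_ne_zero) x) (fun x _ => hC x) (mem_univ b) (mem_univ b')

end TorusPeriodic

theorem norm_taylor_le_of_lipschitz_fderiv {E G : Type*} [NormedAddCommGroup E] [NormedSpace ℝ E]
    [NormedAddCommGroup G] [NormedSpace ℝ G] {w : E → G} (hw : Differentiable ℝ w) {C : ℝ}
    (hC : 0 ≤ C) (hlip : ∀ b b', ‖fderiv ℝ w b' - fderiv ℝ w b‖ ≤ C * ‖b' - b‖) (b b' : E) :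
    ‖w b' - w b - fderiv ℝ w b (b' - b)‖ ≤ C * ‖b' - b‖ ^ 2 := by
  have := (convex_segment b b').norm_image_sub_le_of_norm_hasFDerivWithin_le' (𝕜 := ℝ)
    (f := w) (f' := fderiv ℝ w) (φ := fderiv ℝ w b) (C := C * ‖b' - b‖)
    (fun x _ => (hw x).hasFDerivAt.hasFDerivWithinAt)
    (fun x hx => (hlip b x).trans (by
      gcongr
      have := norm_sub_le_of_mem_segment hx
      simpa using this))
    (left_mem_segment ℝ b b') (right_mem_segment ℝ b b')
  refine this.trans (le_of_eq (by ring))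

/-- The periods form a group containing ℤ + ρℤ, which is dense. -/
theorem eq_const_of_irrational_periods {m : ℝ → ℝ} (hm : Continuous m) {ρ : ℝ}
    (hρ : Irrational ρ) (h1 : ∀ φ, m (φ + 1) = m φ) (hρm : ∀ φ, m (φ + ρ) = m φ) (φ : ℝ) :
    m φ = m 0 := by
  have hd : Dense (AddSubgroup.closure {ρ, 1} : Set ℝ) := by
    rw [dense_addSubgroupClosure_pair_iff, div_one]
    exact hρ
  have hper : ∀ x ∈ AddSubgroup.closure {ρ, (1 : ℝ)}, ∀ φ, m (φ + x) = m φ := by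
    intro x hx
    induction hx using AddSubgroup.closure_induction with
    | mem x hx =>
      rcases hx with rfl | rfl
      · exact hρm
      · exact h1
    | zero => simp
    | add x y _ _ hx hy => intro φ; rw [← add_assoc, hy, hx]
    | neg x _ hx => intro φ; rw [← hx (φ + -x), neg_add_cancel_right]
  have heq : m = fun _ => m 0 := by
    refine Continuous.ext_on hd hm continuous_const fun x hx => ?_
    have := hper x hx 0
    simpa using this
  exact congrFun heq φ

/-! ### Tangent vectors of the torus. -/

section Tangent

variable {n : ℕ} {g : Vec n → Vec n} {T ρ : ℝ} {v : ℝ → ℝ → Vec n}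

theorem IsTorusSolution.torusPeriodic (hv : IsTorusSolution g T ρ v) :
    TorusPeriodic ρ (Function.uncurry v) := by
  constructor
  · rintro ⟨φ, τ⟩
    simpa [Function.uncurry] using hv.periodic φ τ
  · rintro ⟨φ, τ⟩
    simpa [Function.uncurry] using hv.bc φ τ

theorem HasFDerivAt.hasDerivAt_line {F : Type*} [NormedAddCommGroup F] [NormedSpace ℝ F]
    {w : ℝ × ℝ → F} {w' : ℝ × ℝ →L[ℝ] F} {b c : ℝ × ℝ} {s : ℝ}
    (h : HasFDerivAt w w' (b + s • c)) : HasDerivAt (fun s : ℝ => w (b + s • c)) (w' c) s := by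
  have h1 : HasDerivAt (fun s : ℝ => b + s • c) c s := by
    simpa using ((hasDerivAt_id s).smul_const c).const_add b
  exact h.comp_hasDerivAt s h1

theorem add_zero_mk_eq (b : ℝ × ℝ) (s : ℝ) : b + (0, s) = b + s • ((0, 1) : ℝ × ℝ) := by
  ext <;> simp

theorem add_mk_zero_eq (b : ℝ × ℝ) (s : ℝ) : b + (s, 0) = b + s • ((1, 0) : ℝ × ℝ) := by
  ext <;> simp

theorem IsTorusSolution.fderiv_time (hv : IsTorusSolution g T ρ v) (b : ℝ × ℝ) :
    fderiv ℝ (Function.uncurry v) b (0, 1) = T • g (v b.1 b.2) := by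
  have h1 :=
    ((hv.smooth.differentiable two_ne_zero) (b + (0 : ℝ) • (0, 1))).hasFDerivAt.hasDerivAt_line
  have h2 : HasDerivAt (fun s => v b.1 (b.2 + s)) (T • g (v b.1 b.2)) 0 := by
    have := HasDerivAt.comp_const_add (f := fun s => v b.1 s) b.2 0
      (by rw [add_zero]; exact hv.ode b.1 b.2)
    exact this
  rw [zero_smul, add_zero] at h1
  refine h1.unique (h2.congr_of_eventuallyEq (Eventually.of_forall fun s => ?_))
  simp [Function.uncurry]

theorem IsTorusSolution.hasDerivAt_time (hv : IsTorusSolution g T ρ v) (b : ℝ × ℝ) (s : ℝ) :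
    HasDerivAt (fun s : ℝ => Function.uncurry v (b + (0, s)))
      (T • g (Function.uncurry v (b + (0, s)))) s := by
  have h1 := ((hv.smooth.differentiable two_ne_zero) (b + s • (0, 1))).hasFDerivAt.hasDerivAt_line
  rw [hv.fderiv_time] at h1
  simp only [← add_zero_mk_eq] at h1
  exact h1

theorem IsTorusSolution.dtau_eq (hv : IsTorusSolution g T ρ v) (φ τ : ℝ) :
    dtau v φ τ = fderiv ℝ (Function.uncurry v) (φ, τ) (0, 1) := by
  rw [hv.fderiv_time, dtau, (hv.ode φ τ).deriv]

theorem IsTorusSolution.dphi_eq (hv : IsTorusSolution g T ρ v) (φ τ : ℝ) :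
    dphi v φ τ = fderiv ℝ (Function.uncurry v) (φ, τ) (1, 0) := by
  have h1 := ((hv.smooth.differentiable two_ne_zero) (((0, τ) : ℝ × ℝ)
    + φ • ((1, 0) : ℝ × ℝ))).hasFDerivAt.hasDerivAt_line
  rw [dphi]
  have e : ((0, τ) : ℝ × ℝ) + φ • ((1, 0) : ℝ × ℝ) = (φ, τ) := by ext <;> simp
  rw [e] at h1
  refine HasDerivAt.deriv (h1.congr_of_eventuallyEq (Eventually.of_forall fun s => ?_))
  simp [Function.uncurry]

/-- Tangent vectors of the torus solve the variational equation. -/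
theorem IsTorusSolution.hasDerivAt_tangent (hv : IsTorusSolution g T ρ v) (hg : ContDiff ℝ 2 g)
    (c b : ℝ × ℝ) (s : ℝ) :
    HasDerivAt (fun s : ℝ => fderiv ℝ (Function.uncurry v) (b + (0, s)) c)
      (T • fderiv ℝ g (Function.uncurry v (b + (0, s)))
        (fderiv ℝ (Function.uncurry v) (b + (0, s)) c)) s := by
  set u := Function.uncurry v with hu
  have hD : Differentiable ℝ (fderiv ℝ u) :=
    (hv.smooth.fderiv_right (m := 1) (by norm_num)).differentiable one_ne_zero
  have h1 := ((hD (b + s • (0, 1))).hasFDerivAt.hasDerivAt_line).clm_apply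
    (hasDerivAt_const s c)
  simp only [← add_zero_mk_eq, map_zero, add_zero] at h1
  -- Symmetry of the second derivative exchanges the τ-derivative of Dv c with the derivative in
  -- direction `c` of ∂_τ v = T g(v), which the chain rule evaluates.
  have hsymm : IsSymmSndFDerivAt ℝ u (b + (0, s)) :=
    (hv.smooth.contDiffAt).isSymmSndFDerivAt (by simp)
  rw [hsymm.eq] at h1
  have h2 := ((hD (b + (0, s) + (0 : ℝ) • c)).hasFDerivAt.hasDerivAt_line).clm_apply
    (hasDerivAt_const 0 ((0, 1) : ℝ × ℝ))
  simp only [map_zero, add_zero, zero_smul] at h2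
  have h3 : HasDerivAt (fun r : ℝ => T • g (u (b + (0, s) + r • c)))
      (T • fderiv ℝ g (u (b + (0, s))) (fderiv ℝ u (b + (0, s)) c)) 0 := by
    refine HasDerivAt.const_smul T ?_
    have h4 := ((hv.smooth.differentiable two_ne_zero)
      (b + (0, s) + (0 : ℝ) • c)).hasFDerivAt.hasDerivAt_line
    have h5 := ((hg.differentiable two_ne_zero)
      (u (b + (0, s) + (0 : ℝ) • c))).hasFDerivAt.comp_hasDerivAt (0 : ℝ) h4
    simp only [zero_smul, add_zero] at h5
    exact h5
  rw [h2.unique (h3.congr_of_eventuallyEq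
    (Eventually.of_forall fun r => hv.fderiv_time (b + (0, s) + r • c)))] at h1
  exact h1

end Tangent

theorem TorusPeriodic.add_intCast {F : Type*} {ρ : ℝ} {w : ℝ × ℝ → F} (h : TorusPeriodic ρ w)
    (b : ℝ × ℝ) (k : ℤ) : w (b + (0, (k : ℝ))) = w (b + (k * ρ, 0)) := by
  have h2 : Function.Periodic (fun s => w (b.1 + (b.2 + k) * ρ - s * ρ, s)) 1 := fun s => by
    have := h.2 (b.1 + (b.2 + k) * ρ - (s + 1) * ρ, s)
    simp only [Prod.mk_add_mk, add_zero] at this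
    refine this.trans ?_
    simp only
    congr 2
    ring
  have := h2.sub_int_mul_eq (x := b.2 + k) k
  simp only [mul_one, add_sub_cancel_right] at this
  have e1 : b + (0, (k : ℝ)) = (b.1, b.2 + k) := by ext <;> simp
  have e2 : b + (k * ρ, 0) = (b.1 + (b.2 + k) * ρ - b.2 * ρ, b.2) := by
    ext
    · simp; ring
    · simp
  rw [e1, e2, this]

/-- A function that is differentiable, with the same derivative, on all closed intervals between
consecutive integers is differentiable. -/
theorem hasDerivAt_of_forall_Icc_int {F : Type*} [NormedAddCommGroup F] [NormedSpace ℝ F]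
    {u u' : ℝ → F}
    (h : ∀ (k : ℤ), ∀ s ∈ Icc (k : ℝ) (k + 1), HasDerivWithinAt u (u' s) (Icc (k : ℝ) (k + 1)) s)
    (s : ℝ) : HasDerivAt u (u' s) s := by
  have h1 := h ⌊s⌋ s ⟨Int.floor_le s, (Int.lt_floor_add_one s).le⟩
  have hc1 : ((⌈s⌉ - 1 : ℤ) : ℝ) < s := by push_cast; linarith [Int.ceil_lt_add_one s]
  have h2 := h (⌈s⌉ - 1) s ⟨hc1.le, by push_cast; linarith [Int.le_ceil s]⟩
  refine (h2.union h1).hasDerivAt ?_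
  refine mem_of_superset (Ioo_mem_nhds hc1 (Int.lt_floor_add_one s)) fun r hr => ?_
  rcases le_total r s with hrs | hrs
  · left
    refine ⟨hr.1.le, ?_⟩
    push_cast
    linarith [Int.le_ceil s]
  · right
    exact ⟨(Int.floor_le s).trans hrs, hr.2.le⟩

/-! ### Adjoint solutions: vanishing multipliers and duality. -/

section Adjoint

variable {n q : ℕ} {f : Vec n → Vec q → Vec n} {p : Vec q} {T ρ : ℝ} {v : ℝ → ℝ → Vec n}
  {h : (ℝ → ℝ → Vec n) → Vec q → Fin 2 → ℝ} {Dv : Fin 2 → ℝ → ℝ → Vec n} {Dp : Fin 2 → Vec q}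
  {ηρ ηT : ℝ} {lde : ℝ → ℝ → Vec n} {lbc : ℝ → Vec n} {lps : Fin 2 → ℝ} {ηp : Vec q}

theorem IsAdjointSolution.torusPeriodic
    (hl : IsAdjointSolution f p T ρ v Dv Dp ηρ ηT lde lbc lps ηp) :
    TorusPeriodic ρ (Function.uncurry lde) := by
  constructor
  · rintro ⟨φ, τ⟩
    simpa [Function.uncurry] using hl.periodic φ τ
  · rintro ⟨φ, τ⟩
    simpa [Function.uncurry] using hl.shift φ τ

/-- Along a tangent field ω the τ-derivative of ⟨λ, ω⟩ is the multiplier term alone. Its integral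
over [0, 1] is m(φ + ρ) - m(φ) with `m` periodic, which has mean zero. -/
theorem IsPhaseCondition.sum_multiplier_pairing_eq_zero (hh : IsPhaseCondition h v p Dv Dp)
    (hg : ContDiff ℝ 2 (fun x => f x p)) (hv : IsTorusSolution (fun x => f x p) T ρ v)
    (hl : IsAdjointSolution f p T ρ v Dv Dp ηρ ηT lde lbc lps ηp) (c : ℝ × ℝ) :
    ∑ i, lps i * pairing (Dv i) (fun φ τ => fderiv ℝ (Function.uncurry v) (φ, τ) c) = 0 := by
  set ω : ℝ → ℝ → Vec n := fun φ τ => fderiv ℝ (Function.uncurry v) (φ, τ) c with hω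
  have hωc : Continuous (Function.uncurry ω) := by
    have : Continuous (fderiv ℝ (Function.uncurry v)) := hv.smooth.continuous_fderiv two_ne_zero
    exact this.clm_apply continuous_const
  have hωd : ∀ φ τ, HasDerivAt (ω φ)
      (T • fderiv ℝ (fun x => f x p) (v φ τ) (ω φ τ)) τ := by
    intro φ τ
    have := hv.hasDerivAt_tangent hg c (φ, 0) τ
    simpa [hω, Function.uncurry] using this
  -- The kernels are controlled only for τ in [0, 1]; clamping τ makes them globally continuous
  -- without changing the integrals.
  have hDvc : ∀ i, Continuous (Function.uncurry fun φ τ =>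
      inner ℝ (Dv i φ (projIcc (0 : ℝ) 1 zero_le_one τ)) (ω φ τ)) := by
    intro i
    refine Continuous.inner ?_ hωc
    have h1 : Continuous fun b : ℝ × ℝ => (b.1, (projIcc (0 : ℝ) 1 zero_le_one b.2 : ℝ)) := by
      fun_prop
    exact (hh.continuousOn i).comp_continuous h1 fun b => ⟨mem_univ _, Subtype.coe_prop _⟩
  have hproj : ∀ i φ, ∀ τ ∈ uIcc (0 : ℝ) 1, inner ℝ (Dv i φ τ) (ω φ τ) =
      inner ℝ (Dv i φ (projIcc (0 : ℝ) 1 zero_le_one τ)) (ω φ τ) := by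
    intro i φ τ hτ
    rw [uIcc_of_le zero_le_one] at hτ
    rw [projIcc_of_mem zero_le_one hτ]
  have hint : ∀ i φ, IntervalIntegrable (fun τ => inner ℝ (Dv i φ τ) (ω φ τ))
      MeasureTheory.volume 0 1 := by
    intro i φ
    refine ContinuousOn.intervalIntegrable ?_
    refine ContinuousOn.congr ?_ (hproj i φ)
    exact ((hDvc i).comp (Continuous.prodMk_right φ)).continuousOn
  have hI : ∀ i, Continuous fun φ => ∫ τ in (0 : ℝ)..1, inner ℝ (Dv i φ τ) (ω φ τ) := by
    intro i
    have := intervalIntegral.continuous_parametric_intervalIntegral_of_continuous'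
      (μ := MeasureTheory.volume) (hDvc i) 0 1
    refine this.congr fun φ => ?_
    exact (intervalIntegral.integral_congr (hproj i φ)).symm
  set m : ℝ → ℝ := fun φ => inner ℝ (lde φ 0) (ω φ 0) with hm
  have hmc : Continuous m := by
    refine Continuous.inner ?_ ?_
    · exact hl.continuous.comp (Continuous.prodMk_left 0)
    · exact hωc.comp (Continuous.prodMk_left 0)
  have hper : TorusPeriodic ρ (fun b => fderiv ℝ (Function.uncurry v) b c) :=
    hv.torusPeriodic.fderiv.comp fun L => L c
  have hmper : Function.Periodic m 1 := by
    intro φ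
    have h1 : ω (φ + 1) 0 = ω φ 0 := by simpa [hω] using hper.1 (φ, 0)
    simp only [hm, h1, hl.periodic]
  have hm1 : ∀ φ, inner ℝ (lde φ 1) (ω φ 1) = m (φ + ρ) := by
    intro φ
    have h1 : ω φ 1 = ω (φ + ρ) 0 := by simpa [hω] using hper.2 (φ, 0)
    have h2 : lde φ 1 = lde (φ + ρ) 0 := by simpa using hl.shift φ 0
    simp only [hm, h1, h2]
  have hftc : ∀ φ, ∑ i, lps i * ∫ τ in (0 : ℝ)..1, inner ℝ (Dv i φ τ) (ω φ τ) =
      m (φ + ρ) - m φ := by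
    intro φ
    have hd : ∀ τ ∈ Icc (0 : ℝ) 1, HasDerivWithinAt (fun s => inner ℝ (lde φ s) (ω φ s))
        (∑ i, lps i * inner ℝ (Dv i φ τ) (ω φ τ)) (Icc 0 1) τ := by
      intro τ hτ
      have h1 := (hl.var_v φ τ hτ).inner ℝ (hωd φ τ).hasDerivWithinAt
      refine h1.congr_deriv ?_
      rw [inner_add_left, inner_neg_left, inner_smul_left, inner_smul_right,
        ContinuousLinearMap.adjoint_inner_left, sum_inner]
      simp [inner_smul_left]
    have h2 := intervalIntegral.integral_eq_sub_of_hasDeriv_right_of_le (zero_le_one' ℝ)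
      (fun τ hτ => (hd τ hτ).continuousWithinAt)
      (fun τ hτ => ((hd τ ⟨hτ.1.le, hτ.2.le⟩).hasDerivAt
        (Icc_mem_nhds hτ.1 hτ.2)).hasDerivWithinAt)
      (by
        have := IntervalIntegrable.sum Finset.univ fun i _ => (hint i φ).const_mul (lps i)
        refine this.congr fun τ _ => ?_
        simp)
    rw [intervalIntegral.integral_finsetSum fun i _ => (hint i φ).const_mul _] at h2
    simp only [intervalIntegral.integral_const_mul] at h2
    rw [h2, hm1]
  have hsum : ∑ i, lps i * pairing (Dv i) ω = ∫ φ in (0 : ℝ)..1, (m (φ + ρ) - m φ) := by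
    simp only [← hftc]
    rw [intervalIntegral.integral_finsetSum
      fun i _ => ((hI i).intervalIntegrable 0 1).const_mul (lps i)]
    simp only [intervalIntegral.integral_const_mul]
    rfl
  have hmρ : Continuous fun φ => m (φ + ρ) := hmc.comp (continuous_add_const ρ)
  rw [hsum, intervalIntegral.integral_sub (hmρ.intervalIntegrable 0 1)
    (hmc.intervalIntegrable 0 1),
    intervalIntegral.integral_comp_add_right (fun φ => m φ) ρ]
  have := hmper.intervalIntegral_add_eq ρ 0
  rw [zero_add, add_comm (1 : ℝ) ρ, this, zero_add, sub_self]

theorem IsPhaseCondition.multiplier_eq_zero (hh : IsPhaseCondition h v p Dv Dp)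
    (hg : ContDiff ℝ 2 (fun x => f x p)) (hv : IsTorusSolution (fun x => f x p) T ρ v)
    (hl : IsAdjointSolution f p T ρ v Dv Dp ηρ ηT lde lbc lps ηp) : lps = 0 := by
  refine Matrix.eq_zero_of_vecMul_eq_zero hh.nondegenerate ?_
  have hτ : dtau v = fun φ τ => fderiv ℝ (Function.uncurry v) (φ, τ) (0, 1) := by
    funext φ τ; exact hv.dtau_eq φ τ
  have hφ : dphi v = fun φ τ => fderiv ℝ (Function.uncurry v) (φ, τ) (1, 0) := by
    funext φ τ; exact hv.dphi_eq φ τ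
  ext j
  rw [Matrix.vecMul, dotProduct]
  fin_cases j
  · simpa [hτ] using hh.sum_multiplier_pairing_eq_zero hg hv hl (0, 1)
  · simpa [hφ] using hh.sum_multiplier_pairing_eq_zero hg hv hl (1, 0)

/-- The adjoint solutions solve the adjoint variational equation for all times. -/
theorem IsPhaseCondition.hasDerivAt_adjoint (hh : IsPhaseCondition h v p Dv Dp)
    (hg : ContDiff ℝ 2 (fun x => f x p)) (hv : IsTorusSolution (fun x => f x p) T ρ v)
    (hl : IsAdjointSolution f p T ρ v Dv Dp ηρ ηT lde lbc lps ηp) (b : ℝ × ℝ) (s : ℝ) :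
    HasDerivAt (fun s : ℝ => Function.uncurry lde (b + (0, s)))
      (-(T • ContinuousLinearMap.adjoint
        (fderiv ℝ (fun x => f x p) (Function.uncurry v (b + (0, s))))
        (Function.uncurry lde (b + (0, s))))) s := by
  have hlps := hh.multiplier_eq_zero hg hv hl
  set e : ℝ × ℝ → Vec n := fun b => -(T • ContinuousLinearMap.adjoint
        (fderiv ℝ (fun x => f x p) (Function.uncurry v b)) (Function.uncurry lde b)) with he
  -- Periodicity of the right-hand side makes the one-sided derivatives at integer times agree, so
  -- the equation on [0, 1] extends to all of ℝ without corners.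
  have heP : TorusPeriodic ρ e :=
    ⟨fun b => by simp only [he, hv.torusPeriodic.1, hl.torusPeriodic.1],
      fun b => by simp only [he, hv.torusPeriodic.2, hl.torusPeriodic.2]⟩
  have hunit : ∀ φ, ∀ τ ∈ Icc (0 : ℝ) 1,
      HasDerivWithinAt (fun s => lde φ s) (e (φ, τ)) (Icc 0 1) τ := by
    intro φ τ hτ
    have := hl.var_v φ τ hτ
    simpa [hlps, he, Function.uncurry] using this
  have hall : ∀ φ τ, HasDerivAt (fun s => lde φ s) (e (φ, τ)) τ := by
    intro φ
    refine hasDerivAt_of_forall_Icc_int (u' := fun τ => e (φ, τ)) fun k s hs => ?_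
    have hs' : s - k ∈ Icc (0 : ℝ) 1 := ⟨by linarith [hs.1], by linarith [hs.2]⟩
    have h1 : HasDerivWithinAt (fun s : ℝ => s - k) 1 (Icc (k : ℝ) (k + 1)) s :=
      ((hasDerivAt_id s).sub_const (k : ℝ)).hasDerivWithinAt
    have h2 := HasDerivWithinAt.scomp s (t' := Icc (0 : ℝ) 1) (hunit (φ + k * ρ) (s - k) hs') h1
      (fun r hr => ⟨by linarith [hr.1], by linarith [hr.2]⟩)
    rw [one_smul] at h2
    have e1 : e (φ + k * ρ, s - k) = e (φ, s) := by
      have := heP.add_intCast (φ, s - k) k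
      simp only [Prod.mk_add_mk, add_zero, sub_add_cancel] at this
      exact this.symm
    rw [e1] at h2
    refine h2.congr_of_mem (fun r _ => ?_) hs
    have := hl.torusPeriodic.add_intCast (φ, r - k) k
    simp only [Prod.mk_add_mk, add_zero, sub_add_cancel, Function.uncurry] at this
    exact this
  have h3 := HasDerivAt.comp_const_add b.2 s (hall b.1 (b.2 + s))
  have e2 : b + (0, s) = (b.1, b.2 + s) := by ext <;> simp
  have e3 : (fun s : ℝ => Function.uncurry lde (b + (0, s))) = fun s => lde b.1 (b.2 + s) := by
    funext r; simp [Function.uncurry]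
  rw [e3]
  change HasDerivAt _ (e (b + (0, s))) s
  rw [e2]
  exact h3

/-- The pairing of adjoint solutions with tangent vectors is constant. -/
theorem IsPhaseCondition.inner_adjoint_tangent_eq (hh : IsPhaseCondition h v p Dv Dp)
    (hρ : Irrational ρ) (hg : ContDiff ℝ 2 (fun x => f x p))
    (hv : IsTorusSolution (fun x => f x p) T ρ v)
    (hl : IsAdjointSolution f p T ρ v Dv Dp ηρ ηT lde lbc lps ηp) (c b : ℝ × ℝ) :
    inner ℝ (Function.uncurry lde b) (fderiv ℝ (Function.uncurry v) b c) =
      inner ℝ (Function.uncurry lde 0) (fderiv ℝ (Function.uncurry v) 0 c) := by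
  set M : ℝ × ℝ → ℝ := fun b =>
    inner ℝ (Function.uncurry lde b) (fderiv ℝ (Function.uncurry v) b c) with hM
  have hMP : TorusPeriodic ρ M :=
    ⟨fun b => by simp only [hM, hv.torusPeriodic.fderiv.1, hl.torusPeriodic.1],
      fun b => by simp only [hM, hv.torusPeriodic.fderiv.2, hl.torusPeriodic.2]⟩
  have hMc : Continuous M := by
    refine Continuous.inner hl.continuous ?_
    exact (hv.smooth.continuous_fderiv two_ne_zero).clm_apply continuous_const
  have hconst : ∀ b (s : ℝ), M (b + (0, s)) = M b := by
    intro b s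
    have hd : ∀ s : ℝ, HasDerivAt (fun s : ℝ => M (b + (0, s))) 0 s := by
      intro s
      have h1 := (hh.hasDerivAt_adjoint hg hv hl b s).inner ℝ (hv.hasDerivAt_tangent hg c b s)
      refine h1.congr_deriv ?_
      rw [inner_neg_left, inner_smul_left, inner_smul_right,
        ContinuousLinearMap.adjoint_inner_left]
      simp
    have := is_const_of_deriv_eq_zero (fun s => (hd s).differentiableAt)
      (fun s => (hd s).deriv) s 0
    simpa [Prod.mk_zero_zero] using this
  -- Invariance in τ turns the shift relation into period ρ in φ, in addition to period 1.
  have h0 : ∀ φ, M (φ, 0) = M (0, 0) := by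
    refine eq_const_of_irrational_periods (m := fun φ => M (φ, 0))
      (hMc.comp (Continuous.prodMk_left 0)) hρ (fun φ => ?_) fun φ => ?_
    · simpa using hMP.1 (φ, 0)
    · have h1 := hMP.2 (φ, 0)
      rw [hconst] at h1
      simpa using h1.symm
  have h1 := hconst (b.1, 0) b.2
  simp only [Prod.mk_add_mk, add_zero, zero_add] at h1
  change M b = M 0
  rw [show b = (b.1, b.2) from rfl, h1, h0]
  rfl

/-- As the pairing is constant, the integral condition with η_T averages a constant and gives its
value directly. -/
theorem IsPhaseCondition.inner_adjoint_time (hh : IsPhaseCondition h v p Dv Dp) (hT : 0 < T)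
    (hρ : Irrational ρ) (hg : ContDiff ℝ 2 (fun x => f x p))
    (hv : IsTorusSolution (fun x => f x p) T ρ v)
    (hl : IsAdjointSolution f p T ρ v Dv Dp ηρ ηT lde lbc lps ηp) (b : ℝ × ℝ) :
    inner ℝ (Function.uncurry lde b) (fderiv ℝ (Function.uncurry v) b (0, 1)) = T * ηT := by
  have hc := hh.inner_adjoint_tangent_eq hρ hg hv hl (0, 1)
  rw [hc]
  set k := inner ℝ (Function.uncurry lde 0) (fderiv ℝ (Function.uncurry v) 0 (0, 1)) with hk
  have h1 : pairing lde (fun φ τ => f (v φ τ) p) = k / T := by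
    have e : ∀ φ τ, inner ℝ (lde φ τ) (f (v φ τ) p) = k / T := by
      intro φ τ
      have h2 := hc (φ, τ)
      rw [hv.fderiv_time, inner_smul_right] at h2
      rw [eq_div_iff hT.ne', mul_comm]
      exact h2
    simp only [pairing, e, intervalIntegral.integral_const, sub_zero, one_smul]
  have h2 := hl.var_T
  rw [h1] at h2
  have h3 : k / T = ηT := by linarith
  rw [div_eq_iff hT.ne'] at h3
  linarith

theorem IsPhaseCondition.inner_adjoint_angle (hh : IsPhaseCondition h v p Dv Dp)
    (hρ : Irrational ρ) (hg : ContDiff ℝ 2 (fun x => f x p))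
    (hv : IsTorusSolution (fun x => f x p) T ρ v)
    (hl : IsAdjointSolution f p T ρ v Dv Dp ηρ ηT lde lbc lps ηp) (b : ℝ × ℝ) :
    inner ℝ (Function.uncurry lde b) (fderiv ℝ (Function.uncurry v) b (1, 0)) = -ηρ := by
  have hc := hh.inner_adjoint_tangent_eq hρ hg hv hl (1, 0)
  rw [hc]
  set k := inner ℝ (Function.uncurry lde 0) (fderiv ℝ (Function.uncurry v) 0 (1, 0)) with hk
  have e : ∀ φ, inner ℝ (lbc φ) (dphi v (φ + ρ) 0) = k := by
    intro φ
    have h2 := hc (φ + ρ, 0)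
    have h3 : lbc φ = lde (φ + ρ) 0 := by
      rw [← sub_eq_zero.1 (hl.var_v1 φ), ← hl.shift, zero_add]
    rw [h3, hv.dphi_eq]
    exact h2
  have h2 := hl.var_ρ
  simp only [e, intervalIntegral.integral_const, sub_zero, one_smul] at h2
  linarith

end Adjoint

/-! ### Decay on the kernel of the frame and regularity of the frame. -/

/-- A family of functionals `Λ` on a torus with tangent maps `D`, dual to the tangent vectors and
solving the adjoint of the variational equation `y' = T A y`. -/
structure AdjointFrame {X : Type*} [NormedAddCommGroup X] [NormedSpace ℝ X] (T ρ : ℝ)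
    (D : ℝ × ℝ → ℝ × ℝ →L[ℝ] X) (A : ℝ × ℝ → X →L[ℝ] X) (Λ : ℝ × ℝ → X →L[ℝ] ℝ × ℝ)
    (K : ℝ) : Prop where
  T_pos : 0 < T
  one_le : 1 ≤ K
  continuous : Continuous fun q : (ℝ × ℝ) × X => Λ q.1 q.2
  periodic : TorusPeriodic ρ Λ
  norm_le : ∀ b, ‖Λ b‖ ≤ K
  hasDerivAt : ∀ (b : ℝ × ℝ) (y : ℝ → X) (y' : X) (s : ℝ), HasDerivAt y y' s →
    HasDerivAt (fun s : ℝ => Λ (b + (0, s)) (y s))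
      (Λ (b + (0, s)) (y' - T • A (b + (0, s)) (y s))) s
  tangent : ∀ b c, Λ b (D b c) = c
  A_norm : ∀ b, ‖A b‖ ≤ K
  A_lip : ∀ b b', ‖A b' - A b‖ ≤ K * ‖b' - b‖
  A_periodic : TorusPeriodic ρ A
  A_differentiable : Differentiable ℝ A
  D_norm : ∀ b, ‖D b‖ ≤ K
  D_lip : ∀ b b', ‖D b' - D b‖ ≤ K * ‖b' - b‖

/-- `y` solves the variational equation along the torus solution through `b`. -/
def IsVariational {X : Type*} [NormedAddCommGroup X] [NormedSpace ℝ X] (T : ℝ)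
    (A : ℝ × ℝ → X →L[ℝ] X) (b : ℝ × ℝ) (y : ℝ → X) : Prop :=
  ∀ s, HasDerivAt y (T • A (b + (0, s)) (y s)) s

namespace AdjointFrame

variable {X : Type*} [NormedAddCommGroup X] [NormedSpace ℝ X] {T ρ : ℝ}
  {D : ℝ × ℝ → ℝ × ℝ →L[ℝ] X} {A : ℝ × ℝ → X →L[ℝ] X} {Λ : ℝ × ℝ → X →L[ℝ] ℝ × ℝ} {K : ℝ}

theorem K_pos (F : AdjointFrame T ρ D A Λ K) : 0 < K := zero_lt_one.trans_le F.one_le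

theorem norm_apply_le (F : AdjointFrame T ρ D A Λ K) (b : ℝ × ℝ) (y : X) : ‖Λ b y‖ ≤ K * ‖y‖ :=
  (Λ b).le_of_opNorm_le (F.norm_le b) y

theorem norm_A_apply_le (F : AdjointFrame T ρ D A Λ K) (b : ℝ × ℝ) (y : X) : ‖A b y‖ ≤ K * ‖y‖ :=
  (A b).le_of_opNorm_le (F.A_norm b) y

theorem apply_variational (F : AdjointFrame T ρ D A Λ K) {b : ℝ × ℝ} {y : ℝ → X}
    (hy : IsVariational T A b y) (s : ℝ) : Λ (b + (0, s)) (y s) = Λ b (y 0) := by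
  have hd : ∀ s, HasDerivAt (fun s : ℝ => Λ (b + (0, s)) (y s)) 0 s := fun s => by
    have := F.hasDerivAt b y _ s (hy s)
    rwa [sub_self, map_zero] at this
  have := is_const_of_deriv_eq_zero (fun s => (hd s).differentiableAt) (fun s => (hd s).deriv) s 0
  simpa [Prod.mk_zero_zero] using this

theorem variational_unique (F : AdjointFrame T ρ D A Λ K) {b : ℝ × ℝ} {y z : ℝ → X}
    (hy : IsVariational T A b y) (hz : IsVariational T A b z) {s : ℝ} (h : y s = z s) : y = z := by
  have hT := F.T_pos
  have hK := F.K_pos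
  refine ODE_solution_unique_univ (v := fun s z => T • A (b + (0, s)) z) (s := fun _ => univ)
    (K := (T * K).toNNReal) (fun t => ?_) (fun t => ⟨hy t, mem_univ _⟩)
    (fun t => ⟨hz t, mem_univ _⟩) h
  refine LipschitzOnWith.of_dist_le_mul fun x _ w _ => ?_
  rw [dist_eq_norm, dist_eq_norm, ← smul_sub, ← map_sub, norm_smul, Real.norm_of_nonneg hT.le,
    Real.coe_toNNReal _ (by positivity), mul_assoc]
  gcongr
  exact F.norm_A_apply_le _ _

theorem exists_forward_bound (F : AdjointFrame T ρ D A Λ K) :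
    ∃ G ≥ 1, ∀ (b : ℝ × ℝ) (y : ℝ → X), IsVariational T A b y → ∀ s, ∀ r ∈ Icc (0 : ℝ) 1,
      ‖y (s + r)‖ ≤ G * ‖y s‖ := by
  have hT := F.T_pos
  have hK := F.K_pos
  have hκ : 0 < T * K := by positivity
  refine ⟨Real.exp (T * K * 1) * (1 + 1 / (T * K)), ?_, ?_⟩
  · have h1 : 1 ≤ Real.exp (T * K * 1) := Real.one_le_exp (by positivity)
    have h2 : 0 < 1 / (T * K) := by positivity
    nlinarith
  · intro b y hy s r hr
    have := norm_le_exp_mul_of_norm_deriv_le (u := fun r => y (s + r))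
      (u' := fun r => T • A (b + (0, s + r)) (y (s + r))) (δ := ‖y s‖) (ε := 0) (S := 1) hκ
      (norm_nonneg _) le_rfl
      (fun r _ => (HasDerivAt.comp_const_add s r (hy (s + r))).hasDerivWithinAt)
      (by simp) (fun r _ => by
        rw [norm_smul, Real.norm_of_nonneg hT.le, add_zero, mul_assoc]
        gcongr
        exact F.norm_A_apply_le _ _) r hr
    simpa using this

/-- Decay at integer times on the section `τ = 0` implies uniform exponential decay. -/
theorem exists_decay (F : AdjointFrame T ρ D A Λ K) {τtr Ctr : ℝ} (hτ : 0 < τtr) (hC : 0 < Ctr)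
    (hdec : ∀ (φ : ℝ) (y : ℝ → X), IsVariational T A (φ, 0) y → Λ (φ, 0) (y 0) = 0 → ∀ k : ℕ,
      ‖y k‖ ≤ Ctr * Real.exp (-k / τtr) * ‖y 0‖) :
    ∃ C ≥ 1, ∀ (b : ℝ × ℝ) (y : ℝ → X), IsVariational T A b y → Λ b (y 0) = 0 → ∀ s ≥ 0,
      ‖y s‖ ≤ C * Real.exp (-s / τtr) * ‖y 0‖ := by
  obtain ⟨G, hG, hfwd⟩ := F.exists_forward_bound
  have hG0 : 0 < G := by linarith
  have hE : 0 < Real.exp (2 / τtr) := Real.exp_pos _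
  have hE1 : 1 ≤ Real.exp (2 / τtr) := Real.one_le_exp (by positivity)
  refine ⟨G * Real.exp (2 / τtr) + G * Ctr * Real.exp (2 / τtr) * G, ?_, ?_⟩
  · have h1 : 0 < G * Ctr * Real.exp (2 / τtr) * G := by positivity
    nlinarith
  intro b y hy hy0 s hs
  -- The solution first runs for a time `u` ≤ 1 to an integer level, which periodicity identifies
  -- with the section τ = 0; then integer decay applies, then a remainder shorter than 1. At most
  -- time 2 is lost, whence the factor exp(2/τtr).
  set k := ⌈b.2⌉ with hk
  set u : ℝ := k - b.2 with hu
  have hu0 : 0 ≤ u := by rw [hu]; linarith [Int.le_ceil b.2]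
  have hu1 : u ≤ 1 := by rw [hu]; linarith [Int.ceil_lt_add_one b.2]
  have hyu : ‖y u‖ ≤ G * ‖y 0‖ := by
    have := hfwd b y hy 0 u ⟨hu0, hu1⟩
    rwa [zero_add] at this
  have hexp : ∀ t, s ≤ t + 2 → Real.exp (-t / τtr) ≤ Real.exp (2 / τtr) * Real.exp (-s / τtr) := by
    intro t ht
    rw [← Real.exp_add, Real.exp_le_exp, ← add_div, div_le_div_iff_of_pos_right hτ]
    linarith
  rcases le_total s u with hsu | hsu
  · have h1 := hfwd b y hy 0 s ⟨hs, hsu.trans hu1⟩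
    rw [zero_add] at h1
    have h2 : 1 ≤ Real.exp (2 / τtr) * Real.exp (-s / τtr) := by
      have := hexp 0 (by linarith)
      simpa using this
    calc ‖y s‖ ≤ G * 1 * ‖y 0‖ := by rwa [mul_one]
      _ ≤ G * (Real.exp (2 / τtr) * Real.exp (-s / τtr)) * ‖y 0‖ := by gcongr
      _ ≤ _ := by
        have : 0 ≤ G * Ctr * Real.exp (2 / τtr) * G * Real.exp (-s / τtr) * ‖y 0‖ := by positivity
        linarith
  · set η : ℝ → X := fun r => y (r + u) with hη
    have hbase : ∀ r : ℝ, b + (0, r + u) = (b.1, r) + (0, (k : ℝ)) := by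
      intro r
      ext
      · simp
      · simp only [Prod.snd_add, hu]; ring
    have hshift : ∀ r : ℝ, ((b.1, r) : ℝ × ℝ) + (k * ρ, 0) = (b.1 + k * ρ, 0) + (0, r) := by
      intro r; ext <;> simp
    have hηv : IsVariational T A (b.1 + k * ρ, 0) η := by
      intro r
      have h1 := HasDerivAt.comp_add_const r u (hy (r + u))
      rw [hbase, F.A_periodic.add_intCast, hshift] at h1
      exact h1
    have hη0 : Λ (b.1 + k * ρ, 0) (η 0) = 0 := by
      have h1 := F.apply_variational hy u
      have h2 := hbase 0
      have h3 := hshift 0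
      rw [zero_add] at h2
      rw [h2, F.periodic.add_intCast, h3, hy0, Prod.mk_zero_zero, add_zero] at h1
      simpa [hη] using h1
    set j := ⌊s - u⌋₊ with hj
    have hsu0 : 0 ≤ s - u := sub_nonneg.2 hsu
    have hj1 : (j : ℝ) ≤ s - u := Nat.floor_le hsu0
    have hj2 : s - u < j + 1 := Nat.lt_floor_add_one _
    have h1 := hdec _ η hηv hη0 j
    have h2 := hfwd _ η hηv j (s - u - j) ⟨by linarith, by linarith⟩
    have e1 : η (j + (s - u - j)) = y s := by simp [hη]
    have e2 : η 0 = y u := by simp [hη]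
    rw [e1] at h2
    rw [e2] at h1
    have h3 := hexp j (by linarith)
    calc ‖y s‖ ≤ G * (Ctr * Real.exp (-j / τtr) * ‖y u‖) := h2.trans (by gcongr)
      _ ≤ G * (Ctr * (Real.exp (2 / τtr) * Real.exp (-s / τtr)) * (G * ‖y 0‖)) := by gcongr
      _ ≤ _ := by
        have : 0 ≤ G * Real.exp (2 / τtr) * Real.exp (-s / τtr) * ‖y 0‖ := by positivity
        linarith

theorem norm_time_sub_le (F : AdjointFrame T ρ D A Λ K) (b : ℝ × ℝ) (s : ℝ) (y : X) :
    ‖Λ (b + (0, s)) y - Λ b y‖ ≤ K * (T * K) * |s| * ‖y‖ := by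
  have hT := F.T_pos
  have hK := F.K_pos
  have h1 := convex_univ.norm_image_sub_le_of_norm_hasDerivWithin_le (𝕜 := ℝ)
    (f := fun s : ℝ => Λ (b + (0, s)) y)
    (f' := fun s => Λ (b + (0, s)) (0 - T • A (b + (0, s)) y)) (C := K * (T * (K * ‖y‖)))
    (fun s _ => (F.hasDerivAt b (fun _ => y) 0 s (hasDerivAt_const s y)).hasDerivWithinAt)
    (fun s _ => by
      refine (F.norm_apply_le _ _).trans ?_
      rw [zero_sub, norm_neg, norm_smul, Real.norm_of_nonneg hT.le]
      gcongr
      exact F.norm_A_apply_le _ _) (mem_univ 0) (mem_univ s)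
  rw [Prod.mk_zero_zero, add_zero, sub_zero, Real.norm_eq_abs] at h1
  refine h1.trans (le_of_eq (by ring))

section Increment

variable {τtr C : ℝ} {b : ℝ × ℝ} {y : ℝ → X}

/-- The integrand representing the change of the frame in the angular direction. -/
def angleIntegrand (T : ℝ) (A : ℝ × ℝ → X →L[ℝ] X) (Λ : ℝ × ℝ → X →L[ℝ] ℝ × ℝ) (b : ℝ × ℝ)
    (y : ℝ → X) (h s : ℝ) : ℝ × ℝ :=
  Λ (b + (h, 0) + (0, s)) (T • (A (b + (h, 0) + (0, s)) - A (b + (0, s))) (y s))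

theorem norm_angleIntegrand_le (F : AdjointFrame T ρ D A Λ K)
    (hdec : ∀ s ≥ 0, ‖y s‖ ≤ C * Real.exp (-s / τtr) * ‖y 0‖) (h : ℝ) {s : ℝ} (hs : 0 ≤ s) :
    ‖angleIntegrand T A Λ b y h s‖ ≤
      |h| * (K * (T * (K * (C * ‖y 0‖))) * Real.exp (-τtr⁻¹ * s)) := by
  have hT := F.T_pos
  have hK := F.K_pos
  refine (F.norm_apply_le _ _).trans ?_
  rw [norm_smul, Real.norm_of_nonneg hT.le]
  have h1 : ‖A (b + (h, 0) + (0, s)) - A (b + (0, s))‖ ≤ K * |h| := by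
    refine (F.A_lip _ _).trans (le_of_eq ?_)
    congr 1
    have : b + (h, 0) + (0, s) - (b + (0, s)) = (h, 0) := by abel
    rw [this, Prod.norm_def]
    simp
  have h2 : ‖(A (b + (h, 0) + (0, s)) - A (b + (0, s))) (y s)‖ ≤
      K * |h| * (C * Real.exp (-s / τtr) * ‖y 0‖) :=
    ((A _ - A _).le_of_opNorm_le h1 _).trans (by gcongr; exact hdec s hs)
  have h3 : Real.exp (-τtr⁻¹ * s) = Real.exp (-s / τtr) := by
    congr 1; rw [div_eq_mul_inv]; ring
  rw [h3]
  calc _ ≤ K * (T * (K * |h| * (C * Real.exp (-s / τtr) * ‖y 0‖))) := by gcongr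
    _ = _ := by ring

theorem continuous_angleIntegrand (F : AdjointFrame T ρ D A Λ K) (hy : IsVariational T A b y)
    (h : ℝ) : Continuous (angleIntegrand T A Λ b y h) := by
  have hyc : Continuous y := continuous_iff_continuousAt.2 fun s => (hy s).continuousAt
  have hA : Continuous A := F.A_differentiable.continuous
  have h1 : Continuous fun s : ℝ => b + (h, 0) + (0, s) := by fun_prop
  have h2 : Continuous fun s : ℝ => b + (0, s) := by fun_prop
  have h3 : Continuous fun s : ℝ =>
      T • (A (b + (h, 0) + (0, s)) - A (b + (0, s))) (y s) :=
    (((hA.comp h1).sub (hA.comp h2)).clm_apply hyc).const_smul T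
  exact F.continuous.comp (h1.prodMk h3)

theorem integrableOn_exp_decay (hτ : 0 < τtr) (c : ℝ) :
    MeasureTheory.IntegrableOn (fun s => c * Real.exp (-τtr⁻¹ * s)) (Ioi (0 : ℝ)) :=
  (exp_neg_integrableOn_Ioi 0 (inv_pos.2 hτ)).const_mul c

/-- Paired with the frame at the shifted base points, `y` fails to be conserved only through the
difference of the two linearizations. Since `y` decays, the pairing tends to 0 and integrating its
derivative gives the formula. -/
theorem apply_angle_eq_integral (F : AdjointFrame T ρ D A Λ K) (hτ : 0 < τtr)
    (hy : IsVariational T A b y)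
    (hdec : ∀ s ≥ 0, ‖y s‖ ≤ C * Real.exp (-s / τtr) * ‖y 0‖) (h : ℝ) :
    Λ (b + (h, 0)) (y 0) = ∫ s in Ioi (0 : ℝ), angleIntegrand T A Λ b y h s := by
  have hK := F.K_pos
  have hint : MeasureTheory.IntegrableOn (angleIntegrand T A Λ b y h) (Ioi 0) := by
    refine MeasureTheory.Integrable.mono' ((integrableOn_exp_decay hτ
      (K * (T * (K * (C * ‖y 0‖))))).const_mul |h|)
      (F.continuous_angleIntegrand hy h).aestronglyMeasurable ?_
    rw [MeasureTheory.ae_restrict_iff' measurableSet_Ioi]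
    exact Eventually.of_forall fun s hs => F.norm_angleIntegrand_le hdec h (le_of_lt hs)
  have hderiv : ∀ s ∈ Ici (0 : ℝ), HasDerivAt (fun s : ℝ => -Λ (b + (h, 0) + (0, s)) (y s))
      (angleIntegrand T A Λ b y h s) s := by
    intro s _
    refine (F.hasDerivAt (b + (h, 0)) y _ s (hy s)).neg.congr_deriv ?_
    rw [angleIntegrand, ← map_neg]
    congr 1
    rw [sub_apply, smul_sub, neg_sub]
  have hlim : Tendsto (fun s : ℝ => -Λ (b + (h, 0) + (0, s)) (y s)) atTop (𝓝 0) := by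
    have hz : Tendsto (fun s => K * (C * Real.exp (-s / τtr) * ‖y 0‖)) atTop (𝓝 0) := by
      have : Tendsto (fun s => Real.exp (-s / τtr)) atTop (𝓝 0) :=
        Real.tendsto_exp_atBot.comp (tendsto_neg_atTop_atBot.atBot_div_const hτ)
      simpa using ((this.const_mul C).mul_const ‖y 0‖).const_mul K
    refine squeeze_zero_norm' ?_ hz
    filter_upwards [eventually_ge_atTop 0] with s hs
    rw [norm_neg]
    exact (F.norm_apply_le _ _).trans (by gcongr; exact hdec s hs)
  have := MeasureTheory.integral_Ioi_of_hasDerivAt_of_tendsto' hderiv hint hlim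
  rw [this, Prod.mk_zero_zero, add_zero]
  abel

theorem norm_apply_angle_le (F : AdjointFrame T ρ D A Λ K) (hτ : 0 < τtr)
    (hy : IsVariational T A b y)
    (hdec : ∀ s ≥ 0, ‖y s‖ ≤ C * Real.exp (-s / τtr) * ‖y 0‖) (h : ℝ) :
    ‖Λ (b + (h, 0)) (y 0)‖ ≤ K * (T * (K * C)) * τtr * |h| * ‖y 0‖ := by
  rw [F.apply_angle_eq_integral hτ hy hdec h]
  have h1 := MeasureTheory.norm_integral_le_of_norm_le (μ := MeasureTheory.volume.restrict (Ioi 0))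
    (f := angleIntegrand T A Λ b y h)
    ((integrableOn_exp_decay hτ (K * (T * (K * (C * ‖y 0‖))))).const_mul |h|)
    (by
      rw [MeasureTheory.ae_restrict_iff' measurableSet_Ioi]
      exact Eventually.of_forall fun s hs => F.norm_angleIntegrand_le hdec h (le_of_lt hs))
  refine h1.trans (le_of_eq ?_)
  rw [MeasureTheory.integral_const_mul, MeasureTheory.integral_const_mul,
    integral_exp_mul_Ioi (by simpa using hτ)]
  simp
  ring

/-- Dominated convergence for the integral formula divided by `h`: the integrand involves the frame
only through its values, so continuity of `Λ` suffices and the derivative falls on `A`. -/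
theorem exists_hasDerivAt_angle (F : AdjointFrame T ρ D A Λ K) (hτ : 0 < τtr)
    (hy : IsVariational T A b y) (hy0 : Λ b (y 0) = 0)
    (hdec : ∀ s ≥ 0, ‖y s‖ ≤ C * Real.exp (-s / τtr) * ‖y 0‖) :
    ∃ e, HasDerivAt (fun h : ℝ => Λ (b + (h, 0)) (y 0)) e 0 := by
  refine ⟨∫ s in Ioi (0 : ℝ), Λ (b + (0, s)) (T • fderiv ℝ A (b + (0, s)) (1, 0) (y s)), ?_⟩
  rw [hasDerivAt_iff_tendsto_slope]
  have hslope : ∀ h : ℝ, slope (fun h : ℝ => Λ (b + (h, 0)) (y 0)) 0 h =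
      ∫ s in Ioi (0 : ℝ), h⁻¹ • angleIntegrand T A Λ b y h s := by
    intro h
    rw [slope_def_module, sub_zero, Prod.mk_zero_zero, add_zero, hy0, sub_zero,
      F.apply_angle_eq_integral hτ hy hdec h, MeasureTheory.integral_smul]
  rw [tendsto_congr hslope]
  refine MeasureTheory.tendsto_integral_filter_of_dominated_convergence
    (fun s => K * (T * (K * (C * ‖y 0‖))) * Real.exp (-τtr⁻¹ * s)) ?_ ?_
    (integrableOn_exp_decay hτ _) ?_
  · exact Eventually.of_forall fun h =>
      ((F.continuous_angleIntegrand hy h).const_smul h⁻¹).aestronglyMeasurable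
  · filter_upwards [self_mem_nhdsWithin] with h hh
    rw [MeasureTheory.ae_restrict_iff' measurableSet_Ioi]
    refine Eventually.of_forall fun s hs => ?_
    have hh' : 0 < |h| := abs_pos.2 hh
    rw [norm_smul, norm_inv, Real.norm_eq_abs, inv_mul_le_iff₀ hh']
    exact F.norm_angleIntegrand_le hdec h (le_of_lt hs)
  · refine Eventually.of_forall fun s => ?_
    have hA : HasDerivAt (fun h : ℝ => A (b + (0, s) + h • ((1, 0) : ℝ × ℝ)))
        (fderiv ℝ A (b + (0, s)) (1, 0)) 0 := by
      have := (F.A_differentiable (b + (0, s) + (0 : ℝ) • (1, 0))).hasFDerivAt.hasDerivAt_line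
      simpa only [zero_smul, add_zero] using this
    have hA' := (hasDerivAt_iff_tendsto_slope.1 hA)
    have h1 : Tendsto (fun h : ℝ => b + (h, 0) + (0, s)) (𝓝[≠] 0) (𝓝 (b + (0, s))) := by
      have : Continuous fun h : ℝ => b + (h, 0) + (0, s) := by fun_prop
      have h2 := (this.tendsto 0).mono_left (nhdsWithin_le_nhds (s := {0}ᶜ))
      rwa [Prod.mk_zero_zero, add_zero] at h2
    have h2 : Tendsto (fun h : ℝ => T • (slope (fun h : ℝ =>
        A (b + (0, s) + h • ((1, 0) : ℝ × ℝ))) 0 h) (y s)) (𝓝[≠] 0)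
        (𝓝 (T • fderiv ℝ A (b + (0, s)) (1, 0) (y s))) :=
      Tendsto.const_smul
        (((ContinuousLinearMap.apply ℝ X (y s)).continuous.tendsto _).comp hA') T
    have h3 := (F.continuous.tendsto (b + (0, s), T • fderiv ℝ A (b + (0, s)) (1, 0) (y s))).comp
      (h1.prodMk_nhds h2)
    refine h3.congr fun h => ?_
    simp only [Function.comp, angleIntegrand, slope_def_module, sub_zero, zero_smul, add_zero]
    rw [← add_mk_zero_eq, add_right_comm b (0, s) (h, 0), smul_apply, smul_comm T, map_smul]

end Increment

end AdjointFrame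

namespace AdjointFrame

variable {X : Type*} [NormedAddCommGroup X] [NormedSpace ℝ X] {T ρ : ℝ}
  {D : ℝ × ℝ → ℝ × ℝ →L[ℝ] X} {A : ℝ × ℝ → X →L[ℝ] X} {Λ : ℝ × ℝ → X →L[ℝ] ℝ × ℝ} {K : ℝ}

theorem exists_lipschitz (F : AdjointFrame T ρ D A Λ K) {τtr C : ℝ} (hτ : 0 < τtr) (hC : 0 ≤ C)
    (hex : ∀ b y₀, Λ b y₀ = 0 → ∃ y : ℝ → X, y 0 = y₀ ∧ IsVariational T A b y ∧
      ∀ s ≥ 0, ‖y s‖ ≤ C * Real.exp (-s / τtr) * ‖y 0‖) :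
    ∃ L, 0 ≤ L ∧ ∀ b b', ‖Λ b' - Λ b‖ ≤ L * ‖b' - b‖ := by
  have hT := F.T_pos
  have hK := F.K_pos
  set M := K * (T * (K * C)) * τtr with hM
  have hM0 : 0 ≤ M := by positivity
  have hangle : ∀ (b : ℝ × ℝ) (h : ℝ) (y : X),
      ‖Λ (b + (h, 0)) y - Λ b y‖ ≤ (M * (1 + K * K) + K * K * K) * |h| * ‖y‖ := by
    intro b h y
    have hc := F.norm_apply_le b y
    set c := Λ b y with hcdef
    have hDc : ‖D b c‖ ≤ K * (K * ‖y‖) :=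
      ((D b).le_of_opNorm_le (F.D_norm b) c).trans (by gcongr)
    -- Splitting off the tangential part D b c leaves a kernel vector, to which the integral bound
    -- applies; on the tangential part the frame varies only as much as `D` does, by duality.
    obtain ⟨z, hz0, hz, hzdec⟩ := hex b (y - D b c)
      (by rw [map_sub, F.tangent, hcdef, sub_self])
    have h1 := F.norm_apply_angle_le hτ hz hzdec h
    rw [hz0, ← hM] at h1
    have h2 : ‖y - D b c‖ ≤ (1 + K * K) * ‖y‖ := (norm_sub_le _ _).trans (by linarith)
    have h3 : ‖Λ (b + (h, 0)) ((D b - D (b + (h, 0))) c)‖ ≤ K * (K * |h| * (K * ‖y‖)) := by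
      refine (F.norm_apply_le _ _).trans ?_
      gcongr
      refine ((D b - D (b + (h, 0))).le_of_opNorm_le (F.D_lip _ _) c).trans ?_
      have e : b - (b + (h, 0)) = -(h, 0) := by abel
      rw [e, norm_neg, Prod.norm_def]
      simp only [norm_zero, Real.norm_eq_abs, abs_nonneg, sup_of_le_left]
      gcongr
    have e : Λ (b + (h, 0)) y - c = Λ (b + (h, 0)) (y - D b c)
        + Λ (b + (h, 0)) ((D b - D (b + (h, 0))) c) := by
      rw [sub_apply, map_sub, map_sub, F.tangent]; abel
    rw [e]
    refine (norm_add_le _ _).trans ((add_le_add h1 h3).trans ?_)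
    have h4 : M * |h| * ‖y - D b c‖ ≤ M * |h| * ((1 + K * K) * ‖y‖) := by gcongr
    linarith
  refine ⟨M * (1 + K * K) + K * K * K + K * (T * K), by positivity, fun b b' => ?_⟩
  refine ContinuousLinearMap.opNorm_le_bound _ (by positivity) fun y => ?_
  set h := (b' - b).1 with hh
  set s := (b' - b).2 with hs
  have hb' : b' = b + (h, 0) + (0, s) := by ext <;> simp [hh, hs]
  have hhn : |h| ≤ ‖b' - b‖ := norm_fst_le (b' - b)
  have hsn : |s| ≤ ‖b' - b‖ := norm_snd_le (b' - b)
  have h1 := hangle b h y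
  have h2 := F.norm_time_sub_le (b + (h, 0)) s y
  rw [← hb'] at h2
  have e : (Λ b' - Λ b) y = (Λ b' y - Λ (b + (h, 0)) y) + (Λ (b + (h, 0)) y - Λ b y) := by
    rw [sub_apply]; abel
  rw [e]
  refine (norm_add_le _ _).trans ((add_le_add h2 h1).trans ?_)
  have h3 : K * (T * K) * |s| * ‖y‖ ≤ K * (T * K) * ‖b' - b‖ * ‖y‖ := by gcongr
  have h4 : (M * (1 + K * K) + K * K * K) * |h| * ‖y‖ ≤
    (M * (1 + K * K) + K * K * K) * ‖b' - b‖ * ‖y‖ := by gcongr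
  linarith

/-- The τ-derivative exists everywhere and is continuous, so a φ-derivative at the single point `b`
is enough for total differentiability. -/
theorem exists_hasFDerivAt (F : AdjointFrame T ρ D A Λ K) {b : ℝ × ℝ} {y : X} {e : ℝ × ℝ}
    (he : HasDerivAt (fun h : ℝ => Λ (b + (h, 0)) y) e 0) :
    ∃ L : ℝ × ℝ →L[ℝ] ℝ × ℝ, HasFDerivAt (fun b' => Λ b' y) L b ∧
      L (0, 1) = -(T • Λ b (A b y)) := by
  set w : ℝ × ℝ → ℝ × ℝ := fun b' => -(T • Λ b' (A b' y)) with hw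
  have hwc : Continuous w := by
    have hA : Continuous fun b' => A b' y :=
      F.A_differentiable.continuous.clm_apply continuous_const
    exact ((F.continuous.comp (continuous_id.prodMk hA)).const_smul T).neg
  have hwd : ∀ (b' : ℝ × ℝ) (s : ℝ), HasDerivAt (fun s : ℝ => Λ (b' + (0, s)) y)
      (w (b' + (0, s))) s := by
    intro b' s
    refine (F.hasDerivAt b' (fun _ => y) 0 s (hasDerivAt_const s y)).congr_deriv ?_
    simp [hw]
  refine ⟨(ContinuousLinearMap.fst ℝ ℝ ℝ).smulRight e
    + (ContinuousLinearMap.snd ℝ ℝ ℝ).smulRight (w b), ?_, by simp [hw]⟩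
  rw [hasFDerivAt_iff_isLittleO_nhds_zero]
  have o1 : (fun c : ℝ × ℝ => Λ (b + (c.1, 0)) y - Λ b y - c.1 • e) =o[𝓝 0] fun c => c := by
    have h1 := hasDerivAt_iff_isLittleO_nhds_zero.1 he
    simp only [zero_add, Prod.mk_zero_zero, add_zero] at h1
    have h2 : Tendsto (fun c : ℝ × ℝ => c.1) (𝓝 0) (𝓝 0) := continuous_fst.tendsto 0
    refine (h1.comp_tendsto h2).trans_isBigO ?_
    exact Asymptotics.IsBigO.of_bound 1 (Eventually.of_forall fun c => by
      rw [one_mul]; exact norm_fst_le c)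
  have o2 : (fun c : ℝ × ℝ => Λ (b + c) y - Λ (b + (c.1, 0)) y - c.2 • w b) =o[𝓝 0]
      fun c => c := by
    rw [Asymptotics.isLittleO_iff]
    intro ε hε
    obtain ⟨δ, hδ, hball⟩ := Metric.continuousAt_iff.1 hwc.continuousAt ε hε
    filter_upwards [Metric.ball_mem_nhds 0 hδ] with c hc
    rw [mem_ball_zero_iff] at hc
    have hc1 : |c.1| < δ := (norm_fst_le c).trans_lt hc
    have hc2 : |c.2| < δ := (norm_snd_le c).trans_lt hc
    have h1 := (convex_ball (0 : ℝ) δ).norm_image_sub_le_of_norm_hasDerivWithin_le (𝕜 := ℝ)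
      (f := fun s : ℝ => Λ (b + (c.1, 0) + (0, s)) y - s • w b)
      (f' := fun s => w (b + (c.1, 0) + (0, s)) - (1 : ℝ) • w b) (C := ε)
      (fun s _ => ((hwd (b + (c.1, 0)) s).sub
        ((hasDerivAt_id s).smul_const (w b))).hasDerivWithinAt)
      (fun s hs => by
        rw [one_smul, ← dist_eq_norm]
        refine (hball ?_).le
        rw [dist_eq_norm]
        have e : b + (c.1, 0) + (0, s) - b = (c.1, s) := by ext <;> simp
        rw [mem_ball_zero_iff] at hs
        rw [e, Prod.norm_def]
        exact max_lt hc1 hs)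
      (Metric.mem_ball_self hδ) (mem_ball_zero_iff.2 hc2)
    have e1 : b + (c.1, 0) + (0, c.2) = b + c := by ext <;> simp
    have e2 : b + (c.1, 0) + (0, (0 : ℝ)) = b + (c.1, 0) := by simp [Prod.mk_zero_zero]
    simp only [e1, e2, zero_smul, sub_zero] at h1
    rw [sub_right_comm] at h1
    refine h1.trans ?_
    gcongr
    exact norm_snd_le c
  refine (o1.add o2).congr_left fun c => ?_
  simp only [add_apply, ContinuousLinearMap.smulRight_apply, ContinuousLinearMap.coe_fst',
    ContinuousLinearMap.coe_snd']
  abel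

end AdjointFrame

/-! ### From transversal stability to decay on the kernel of the frame. -/

section Stability

variable {n : ℕ} {g : Vec n → Vec n} {T ρ τtr Ctr K : ℝ} {v : ℝ → ℝ → Vec n}
  {V qtg : ℝ → ℝ → Vec n →L[ℝ] Vec n} {D : ℝ × ℝ → ℝ × ℝ →L[ℝ] Vec n}
  {A : ℝ × ℝ → Vec n →L[ℝ] Vec n} {Λ : ℝ × ℝ → Vec n →L[ℝ] ℝ × ℝ}

theorem IsVariationalSolution.isVariational (hV : IsVariationalSolution g T v V)
    (hA : ∀ b, A b = fderiv ℝ g (Function.uncurry v b)) (b : ℝ × ℝ) (ξ : Vec n) :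
    IsVariational T A b (fun s => V b.1 (b.2 + s) ξ) := by
  intro s
  have h1 := HasDerivAt.comp_const_add b.2 s (hV.ode b.1 (b.2 + s))
  have h2 := h1.clm_apply (hasDerivAt_const s ξ)
  rw [map_zero, add_zero] at h2
  refine h2.congr_deriv ?_
  have e : b + (0, s) = (b.1, b.2 + s) := by ext <;> simp
  rw [hA, e]
  rfl

/-- By uniqueness, a solution V ξ that vanishes at one time vanishes at time 0, so V is injective
and hence surjective at every time; solutions with any initial value are then columns of V. -/
theorem AdjointFrame.exists_variational (F : AdjointFrame T ρ D A Λ K)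
    (hV : IsVariationalSolution g T v V) (hA : ∀ b, A b = fderiv ℝ g (Function.uncurry v b))
    (b : ℝ × ℝ) (y₀ : Vec n) : ∃ y, y 0 = y₀ ∧ IsVariational T A b y := by
  have hinj : Function.Injective (V b.1 b.2 : Vec n →ₗ[ℝ] Vec n) := by
    rw [injective_iff_map_eq_zero]
    intro ξ hξ
    have hzero : IsVariational T A b (fun _ => (0 : Vec n)) := by
      intro s
      rw [map_zero, smul_zero]
      exact hasDerivAt_const s 0
    have h1 := F.variational_unique (hV.isVariational hA b ξ) hzero (s := 0) (by
      rw [add_zero]; exact hξ)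
    have h2 := congrFun h1 (-b.2)
    simp only [add_neg_cancel, hV.init] at h2
    exact h2
  obtain ⟨ξ, hξ⟩ := LinearMap.injective_iff_surjective.1 hinj y₀
  exact ⟨fun s => V b.1 (b.2 + s) ξ, by simp only [add_zero]; exact hξ, hV.isVariational hA b ξ⟩

theorem AdjointFrame.norm_nat_le (F : AdjointFrame T ρ D A Λ K) (hτ : 0 < τtr)
    (hV : IsVariationalSolution g T v V) (hA : ∀ b, A b = fderiv ℝ g (Function.uncurry v b))
    (hN : IsNormallyHyperbolic ρ v V qtg)
    (hDτ : ∀ φ τ, dtau v φ τ = D (φ, τ) (0, 1)) (hDφ : ∀ φ τ, dphi v φ τ = D (φ, τ) (1, 0))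
    (hdec : ∀ (k : ℕ) (φ : ℝ),
      ‖V φ k ∘L (ContinuousLinearMap.id ℝ (Vec n) - qtg φ 0)‖ ≤ Ctr * Real.exp (-k / τtr))
    (φ : ℝ) (y : ℝ → Vec n) (hy : IsVariational T A (φ, 0) y) (hy0 : Λ (φ, 0) (y 0) = 0) (k : ℕ) :
    ‖y k‖ ≤ Ctr * Real.exp (-k / τtr) * ‖y 0‖ := by
  have hK := F.K_pos
  -- The pairing is conserved while the transversal solution decays at integer times, so it must be
  -- zero.
  have htr : ∀ ξ, Λ (φ, 0) (ξ - qtg φ 0 ξ) = 0 := by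
    intro ξ
    have h1 : ∀ k : ℕ, ‖Λ (φ, 0) (ξ - qtg φ 0 ξ)‖ ≤
        K * (Ctr * Real.exp (-k / τtr) * ‖ξ‖) := by
      intro k
      have h2 := F.apply_variational (hV.isVariational hA (φ, 0) (ξ - qtg φ 0 ξ)) k
      simp only [zero_add, hV.init] at h2
      rw [ContinuousLinearMap.id_apply] at h2
      rw [← h2]
      refine (F.norm_apply_le _ _).trans ?_
      gcongr
      exact ContinuousLinearMap.le_of_opNorm_le _ (hdec k φ) ξ
    have h3 : Tendsto (fun k : ℕ => K * (Ctr * Real.exp (-k / τtr) * ‖ξ‖)) atTop (𝓝 0) := by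
      have : Tendsto (fun k : ℕ => Real.exp (-k / τtr)) atTop (𝓝 0) :=
        Real.tendsto_exp_atBot.comp
          ((tendsto_neg_atTop_atBot.comp tendsto_natCast_atTop_atTop).atBot_div_const hτ)
      simpa using ((this.const_mul Ctr).mul_const ‖ξ‖).const_mul K
    exact norm_le_zero_iff.1 (ge_of_tendsto' h3 h1)
  -- The frame kills both `y 0` and its transversal part, hence the tangential part, on which it
  -- reads off the coefficients.
  have hq : qtg φ 0 (y 0) = 0 := by
    have hmem : qtg φ 0 (y 0) ∈ Submodule.span ℝ {dtau v φ 0, dphi v φ 0} := by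
      rw [← hN.range_eq]
      exact ⟨y 0, rfl⟩
    rw [hDτ, hDφ] at hmem
    obtain ⟨α, β, hαβ⟩ := Submodule.mem_span_pair.1 hmem
    rw [← map_smul, ← map_smul, ← map_add] at hαβ
    have h1 := htr (y 0)
    rw [map_sub, hy0, zero_sub, neg_eq_zero, ← hαβ, F.tangent] at h1
    rw [← hαβ, h1, map_zero]
  have hyV : y = fun s => V φ (0 + s) (y 0) :=
    F.variational_unique hy (hV.isVariational hA (φ, 0) (y 0)) (s := 0)
      (by simp only [add_zero, hV.init]; rfl)
  have h1 : y k = (V φ k ∘L (ContinuousLinearMap.id ℝ (Vec n) - qtg φ 0)) (y 0) := by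
    have h2 := congrFun hyV k
    rw [zero_add] at h2
    rw [h2]
    simp [hq]
  rw [h1]
  exact ContinuousLinearMap.le_of_opNorm_le _ (hdec k φ) (y 0)

end Stability

/-! ### Cutoff, construction of the frame, and conclusion. -/

/-- A `C²` vector field can be modified away from a bounded set such that it becomes bounded and
Lipschitz, with Lipschitz derivative. -/
theorem exists_cutoff {n : ℕ} {g : Vec n → Vec n} (hg : ContDiff ℝ 2 g) {R : ℝ} (hR : 0 < R) :
    ∃ gt : Vec n → Vec n, ContDiff ℝ 2 gt ∧ (∀ x, ‖x‖ ≤ R → gt x = g x) ∧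
      (∀ x, ‖x‖ < R → fderiv ℝ gt x = fderiv ℝ g x) ∧ ∃ C, 0 ≤ C ∧ (∀ x, ‖gt x‖ ≤ C) ∧
      (∀ x y, ‖gt x - gt y‖ ≤ C * ‖x - y‖) ∧
      ∀ x y, ‖fderiv ℝ gt x - fderiv ℝ gt y‖ ≤ C * ‖x - y‖ := by
  let χ : ContDiffBump (0 : Vec n) := ⟨R, R + 1, hR, by linarith⟩
  set gt : Vec n → Vec n := fun x => χ x • g x with hgt
  have hgt2 : ContDiff ℝ 2 gt := χ.contDiff.smul hg
  have hcs : HasCompactSupport gt := χ.hasCompactSupport.smul_right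
  have heq : ∀ x, ‖x‖ ≤ R → gt x = g x := fun x hx => by
    have : χ x = 1 := χ.one_of_mem_closedBall (mem_closedBall_zero_iff.2 hx)
    rw [hgt]
    simp [this]
  obtain ⟨C₁, hC₁⟩ := hgt2.continuous.bounded_above_of_compact_support hcs
  obtain ⟨C₂, hC₂⟩ := ContDiff.lipschitzWith_of_hasCompactSupport hcs hgt2 two_ne_zero
  obtain ⟨C₃, hC₃⟩ := ContDiff.lipschitzWith_of_hasCompactSupport (hcs.fderiv (𝕜 := ℝ))
    (hgt2.fderiv_right (m := 1) (by norm_num)) one_ne_zero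
  have h1 : 0 ≤ C₁ := (norm_nonneg _).trans (hC₁ 0)
  refine ⟨gt, hgt2, heq, fun x hx => ?_, C₁ + C₂ + C₃, by positivity, fun x => ?_, fun x y => ?_,
    fun x y => ?_⟩
  · refine Filter.EventuallyEq.fderiv_eq ?_
    filter_upwards [Metric.isOpen_ball.mem_nhds (mem_ball_zero_iff.2 hx)] with z hz
    exact heq z (mem_ball_zero_iff.1 hz).le
  · refine (hC₁ x).trans ?_
    have := C₂.coe_nonneg
    have := C₃.coe_nonneg
    linarith
  · rw [← dist_eq_norm, ← dist_eq_norm]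
    refine (hC₂.dist_le_mul x y).trans ?_
    have := C₃.coe_nonneg
    gcongr
    linarith
  · rw [← dist_eq_norm, ← dist_eq_norm]
    refine (hC₃.dist_le_mul x y).trans ?_
    have := C₂.coe_nonneg
    gcongr
    linarith

/-- The frame of functionals given by the two adjoint solutions. -/
noncomputable def adjointFrame {n : ℕ} (T : ℝ) (lT lρ : ℝ → ℝ → Vec n) (b : ℝ × ℝ) :
    Vec n →L[ℝ] ℝ × ℝ :=
  (-(innerSL ℝ (lρ b.1 b.2))).prod (T⁻¹ • innerSL ℝ (lT b.1 b.2))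

theorem adjointFrame_apply {n : ℕ} (T : ℝ) (lT lρ : ℝ → ℝ → Vec n) (b : ℝ × ℝ) (y : Vec n) :
    adjointFrame T lT lρ b y = (-inner ℝ (lρ b.1 b.2) y, inner ℝ (lT b.1 b.2) y / T) := by
  simp [adjointFrame, div_eq_inv_mul]

section Main

variable {n q : ℕ} {f : Vec n → Vec q → Vec n} {p : Vec q} {T ρ τtr : ℝ} {v : ℝ → ℝ → Vec n}
  {h : (ℝ → ℝ → Vec n) → Vec q → Fin 2 → ℝ} {Dv : Fin 2 → ℝ → ℝ → Vec n} {Dp : Fin 2 → Vec q}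
  {lT lρ : ℝ → ℝ → Vec n}

theorem hasDerivAt_inner_adjoint {l : ℝ × ℝ → Vec n} {A : ℝ × ℝ → Vec n →L[ℝ] Vec n}
    (hl : ∀ (b : ℝ × ℝ) (s : ℝ), HasDerivAt (fun s : ℝ => l (b + (0, s)))
      (-(T • ContinuousLinearMap.adjoint (A (b + (0, s))) (l (b + (0, s))))) s)
    (b : ℝ × ℝ) {y : ℝ → Vec n} {y' : Vec n} {s : ℝ} (hy : HasDerivAt y y' s) :
    HasDerivAt (fun s : ℝ => inner ℝ (l (b + (0, s))) (y s))
      (inner ℝ (l (b + (0, s))) (y' - T • A (b + (0, s)) (y s))) s := by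
  refine ((hl b s).inner ℝ hy).congr_deriv ?_
  rw [inner_neg_left, inner_smul_left, ContinuousLinearMap.adjoint_inner_left, inner_sub_right,
    inner_smul_right]
  simp [sub_eq_add_neg]

/-- The choices (η_ρ, η_T) = (0, 1) and (1, 0) make λ_T pair to (0, T) and λ_ρ to (-1, 0) with (∂_φ
v, ∂_τ v); this explains the sign and the division by `T` in the frame. All bounds come from
compactness of the torus. -/
theorem exists_adjointFrame (hf : ContDiff ℝ 2 (fun x => f x p)) (hT : 0 < T)
    (hρ : Irrational ρ) (hv : IsTorusSolution (fun x => f x p) T ρ v)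
    (hh : IsPhaseCondition h v p Dv Dp) (hlT : IsAdjointFunction f p T ρ v Dv Dp 0 1 lT)
    (hlρ : IsAdjointFunction f p T ρ v Dv Dp 1 0 lρ) :
    ∃ K, AdjointFrame T ρ (fderiv ℝ (Function.uncurry v))
      (fun b => fderiv ℝ (fun x => f x p) (Function.uncurry v b)) (adjointFrame T lT lρ) K := by
  obtain ⟨lbcT, lpsT, ηpT, hT'⟩ := hlT
  obtain ⟨lbcρ, lpsρ, ηpρ, hρ'⟩ := hlρ
  set A : ℝ × ℝ → Vec n →L[ℝ] Vec n :=
    fun b => fderiv ℝ (fun x => f x p) (Function.uncurry v b) with hA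
  have hAP : TorusPeriodic ρ A := hv.torusPeriodic.comp _
  have hA1 : ContDiff ℝ 1 A :=
    (hf.fderiv_right (m := 1) (by norm_num)).comp (hv.smooth.of_le (by norm_num))
  have hDP := hv.torusPeriodic.fderiv
  have hD1 : ContDiff ℝ 1 (fderiv ℝ (Function.uncurry v)) :=
    hv.smooth.fderiv_right (by norm_num)
  obtain ⟨CA, hCA⟩ := hAP.exists_norm_le hA1.continuous
  obtain ⟨LA, hLA0, hLA⟩ := hAP.exists_lipschitz hA1
  obtain ⟨CD, hCD⟩ := hDP.exists_norm_le hD1.continuous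
  obtain ⟨LD, hLD0, hLD⟩ := hDP.exists_lipschitz hD1
  obtain ⟨C₁, hC₁⟩ := hT'.torusPeriodic.exists_norm_le hT'.continuous
  obtain ⟨C₂, hC₂⟩ := hρ'.torusPeriodic.exists_norm_le hρ'.continuous
  have hCA0 : 0 ≤ CA := (norm_nonneg _).trans (hCA 0)
  have hCD0 : 0 ≤ CD := (norm_nonneg _).trans (hCD 0)
  have hC₁0 : 0 ≤ C₁ := (norm_nonneg _).trans (hC₁ 0)
  have hC₂0 : 0 ≤ C₂ := (norm_nonneg _).trans (hC₂ 0)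
  have hC₁T : 0 ≤ C₁ / T := by positivity
  refine ⟨1 + CA + LA + CD + LD + C₁ / T + C₂, ⟨hT, by linarith, ?_, ?_, ?_, ?_, ?_,
    fun b => (hCA b).trans (by linarith), fun b b' => (hLA b b').trans (by gcongr; linarith),
    hAP, hA1.differentiable one_ne_zero, fun b => (hCD b).trans (by linarith),
    fun b b' => (hLD b b').trans (by gcongr; linarith)⟩⟩
  · simp only [adjointFrame_apply]
    have h1 : Continuous fun q : (ℝ × ℝ) × Vec n => lT q.1.1 q.1.2 :=
      hT'.continuous.comp continuous_fst
    have h2 : Continuous fun q : (ℝ × ℝ) × Vec n => lρ q.1.1 q.1.2 :=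
      hρ'.continuous.comp continuous_fst
    exact (h2.inner continuous_snd).neg.prodMk ((h1.inner continuous_snd).div_const T)
  · have e : ∀ b, adjointFrame T lT lρ b =
        (-(innerSL ℝ (Function.uncurry lρ b))).prod (T⁻¹ • innerSL ℝ (Function.uncurry lT b)) :=
      fun b => rfl
    exact ⟨fun b => by rw [e, e, hT'.torusPeriodic.1, hρ'.torusPeriodic.1],
      fun b => by rw [e, e, hT'.torusPeriodic.2, hρ'.torusPeriodic.2]⟩
  · intro b
    refine ContinuousLinearMap.opNorm_le_bound _ (by linarith) fun y => ?_
    rw [adjointFrame_apply, Prod.norm_def]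
    have hy := norm_nonneg y
    refine max_le ?_ ?_
    · have h1 : ‖inner ℝ (lρ b.1 b.2) y‖ ≤ C₂ * ‖y‖ :=
        (norm_inner_le_norm _ _).trans (by gcongr; exact hC₂ b)
      rw [norm_neg]
      refine h1.trans ?_
      gcongr
      linarith
    · have h1 : ‖inner ℝ (lT b.1 b.2) y‖ ≤ C₁ * ‖y‖ :=
        (norm_inner_le_norm _ _).trans (by gcongr; exact hC₁ b)
      rw [norm_div, Real.norm_of_nonneg hT.le, div_le_iff₀ hT]
      calc _ ≤ C₁ * ‖y‖ := h1
        _ = C₁ / T * ‖y‖ * T := by field_simp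
        _ ≤ _ := by gcongr; linarith
  · intro b y y' s hy
    have h1 := hasDerivAt_inner_adjoint (A := A) (hh.hasDerivAt_adjoint hf hv hT') b hy
    have h2 := hasDerivAt_inner_adjoint (A := A) (hh.hasDerivAt_adjoint hf hv hρ') b hy
    have h3 := h2.neg.prodMk (h1.div_const T)
    simp only [adjointFrame_apply]
    exact h3
  · intro b c
    have e : fderiv ℝ (Function.uncurry v) b c =
        c.1 • fderiv ℝ (Function.uncurry v) b (1, 0)
        + c.2 • fderiv ℝ (Function.uncurry v) b (0, 1) := by
      rw [← map_smul, ← map_smul, ← map_add]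
      congr 1
      ext <;> simp
    have h1 := hh.inner_adjoint_time hT hρ hf hv hT' b
    have h2 := hh.inner_adjoint_angle hρ hf hv hT' b
    have h3 := hh.inner_adjoint_time hT hρ hf hv hρ' b
    have h4 := hh.inner_adjoint_angle hρ hf hv hρ' b
    simp only [Function.uncurry_def] at h1 h2 h3 h4 e ⊢
    rw [adjointFrame_apply, e, inner_add_right, inner_add_right, inner_smul_right,
      inner_smul_right, inner_smul_right, inner_smul_right, h1, h2, h3, h4]
    ext
    · simp
    · simp [hT.ne']

theorem exists_phaseFrame (hf : ContDiff ℝ 2 (fun x => f x p)) (hT : 0 < T)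
    (hρ : Irrational ρ) (hv : IsTorusSolution (fun x => f x p) T ρ v)
    (hst : IsTransversallyStable (fun x => f x p) T ρ v τtr)
    (hh : IsPhaseCondition h v p Dv Dp) (hlT : IsAdjointFunction f p T ρ v Dv Dp 0 1 lT)
    (hlρ : IsAdjointFunction f p T ρ v Dv Dp 1 0 lρ) :
    ∃ (gt : Vec n → Vec n) (B K : ℝ), ContDiff ℝ 1 gt ∧ (∀ x, ‖gt x‖ ≤ B) ∧
      (∀ (b : ℝ × ℝ) x, ‖x - v b.1 b.2‖ ≤ 1 → gt x = f x p) ∧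
      PhaseFrame gt T τtr (fun b => v b.1 b.2)
        (fun b => fderiv ℝ (fun x => f x p) (v b.1 b.2)) (adjointFrame T lT lρ) K := by
  obtain ⟨κ, F⟩ := exists_adjointFrame hf hT hρ hv hh hlT hlρ
  obtain ⟨hτ, V, qtg, hV, hN, Ctr, hCtr, hdec⟩ := hst
  have hκ := F.K_pos
  obtain ⟨R, hR⟩ := hv.torusPeriodic.exists_norm_le hv.smooth.continuous
  have hR0 : 0 ≤ R := (norm_nonneg _).trans (hR 0)
  obtain ⟨gt, hgt2, hgteq, hgtd, G, hG0, hG1, hG2, hG3⟩ :=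
    -- The radius `R + 1` leaves the field unchanged on the whole neighbourhood of width 1 of the
    -- torus.
    exists_cutoff hf (show 0 < R + 1 by linarith)
  have hagree : ∀ (b : ℝ × ℝ) x, ‖x - v b.1 b.2‖ ≤ 1 → gt x = f x p := by
    intro b x hx
    refine hgteq x ?_
    have h1 : x = (x - v b.1 b.2) + v b.1 b.2 := by abel
    rw [h1]
    refine (norm_add_le _ _).trans ?_
    have h2 : ‖v b.1 b.2‖ ≤ R := hR b
    linarith
  have hgv : ∀ b : ℝ × ℝ, gt (v b.1 b.2) = f (v b.1 b.2) p := fun b =>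
    hagree b _ (by rw [sub_self, norm_zero]; exact zero_le_one)
  have hAgt : ∀ b : ℝ × ℝ, fderiv ℝ gt (v b.1 b.2) = fderiv ℝ (fun x => f x p) (v b.1 b.2) := by
    intro b
    refine hgtd _ ?_
    have h2 : ‖v b.1 b.2‖ ≤ R := hR b
    linarith
  obtain ⟨C, hC1, hC⟩ := F.exists_decay hτ hCtr
    (F.norm_nat_le hτ hV (fun _ => rfl) hN hv.dtau_eq hv.dphi_eq hdec)
  have hex : ∀ b y₀, adjointFrame T lT lρ b y₀ = 0 → ∃ y : ℝ → Vec n, y 0 = y₀ ∧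
      IsVariational T (fun b => fderiv ℝ (fun x => f x p) (Function.uncurry v b)) b y ∧
      ∀ s ≥ 0, ‖y s‖ ≤ C * Real.exp (-s / τtr) * ‖y 0‖ := by
    intro b y₀ hy₀
    obtain ⟨y, hy0, hy⟩ := F.exists_variational hV (fun _ => rfl) b y₀
    exact ⟨y, hy0, hy, hC b y hy (by rw [hy0]; exact hy₀)⟩
  obtain ⟨L, hL0, hL⟩ := F.exists_lipschitz hτ (by linarith) hex
  obtain ⟨Lv, hLv0, hLv⟩ := hv.torusPeriodic.exists_lipschitz (hv.smooth.of_le (by norm_num))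
  refine ⟨gt, G, 1 + κ + κ * κ + G + C + L + Lv, hgt2.of_le (by norm_num), hG1, hagree, ?_⟩
  have hκκ : 0 < κ * κ := by positivity
  refine ⟨hT, hτ, by linarith, ?_, ?_, ?_, ?_, ?_, ?_, ?_, ?_, ?_, ?_, ?_⟩
  · intro b s
    have h1 := hv.hasDerivAt_time b s
    simp only [Function.uncurry_def] at h1
    rw [← hgv (b + (0, s))] at h1
    exact h1
  · exact fun b b' => (hLv b b').trans (by gcongr; linarith)
  · exact fun b => (F.norm_le b).trans (by linarith)
  · intro b b'
    have h1 := norm_taylor_le_of_lipschitz_fderiv (hv.smooth.differentiable two_ne_zero) hκ.le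
      F.D_lip b b'
    have h2 : adjointFrame T lT lρ b (v b'.1 b'.2 - v b.1 b.2) - (b' - b) =
        adjointFrame T lT lρ b (Function.uncurry v b' - Function.uncurry v b
          - fderiv ℝ (Function.uncurry v) b (b' - b)) := by
      rw [map_sub _ (Function.uncurry v b' - Function.uncurry v b), F.tangent]
      rfl
    rw [h2]
    refine (F.norm_apply_le _ _).trans ?_
    calc _ ≤ κ * (κ * ‖b' - b‖ ^ 2) := by gcongr
      _ = κ * κ * ‖b' - b‖ ^ 2 := by ring
      _ ≤ _ := by gcongr; linarith
  · intro b
    rw [hgv b, ← map_smul, ← F.tangent b (0, 1), hv.fderiv_time]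
  · exact fun b b' => (hL b b').trans (by gcongr; linarith)
  · exact fun x y => (hG2 x y).trans (by gcongr; linarith)
  · intro b x
    have h1 := norm_taylor_le_of_lipschitz_fderiv (hgt2.differentiable two_ne_zero) hG0
      (fun x y => hG3 y x) (v b.1 b.2) x
    rw [hAgt] at h1
    exact h1.trans (by gcongr; linarith)
  · exact fun b => (F.A_norm b).trans (by linarith)
  · intro b y₀ hy₀
    obtain ⟨y, hy0, hy, hydec⟩ := hex b y₀ hy₀
    refine ⟨y, hy0, hy, fun s hs => ⟨?_, ?_⟩⟩
    · rw [F.apply_variational hy, hy0, hy₀]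
    · have h1 := hydec s hs
      rw [hy0] at h1
      refine h1.trans ?_
      gcongr
      linarith
  · intro b y₀ hy₀
    obtain ⟨y, hy0, hy, hydec⟩ := hex b y₀ hy₀
    obtain ⟨e, he⟩ := F.exists_hasDerivAt_angle hτ hy (by rw [hy0, hy₀]) hydec
    rw [hy0] at he
    exact F.exists_hasFDerivAt he

end Main

theorem mainTheorem2 {n q : ℕ} (f : Vec n → Vec q → Vec n)
    (hf : ContDiff ℝ 2 (Function.uncurry f)) (p : Vec q) (T ρ τtr : ℝ) (hT : 0 < T)
    (hρ : Irrational ρ) (v : ℝ → ℝ → Vec n)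
    (hv : IsTorusSolution (fun x => f x p) T ρ v)
    (hst : IsTransversallyStable (fun x => f x p) T ρ v τtr)
    (h : (ℝ → ℝ → Vec n) → Vec q → Fin 2 → ℝ)
    (Dv : Fin 2 → ℝ → ℝ → Vec n) (Dp : Fin 2 → Vec q) (hh : IsPhaseCondition h v p Dv Dp)
    (lT lρ : ℝ → ℝ → Vec n)
    (hlT : IsAdjointFunction f p T ρ v Dv Dp 0 1 lT)
    (hlρ : IsAdjointFunction f p T ρ v Dv Dp 1 0 lρ) :
    -- phase dynamics along perturbed trajectories, uniformly for all `τ ≥ 0`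
    (∃ ε₀ > 0, ∃ r > 0, ∃ C > 0, ∀ ε : ℝ, 0 < ε → ε ≤ ε₀ →
      ∀ dode : ℝ → Vec n, ContinuousOn dode (Set.Ici 0) → (∀ τ ≥ 0, ‖dode τ‖ ≤ ε) →
      ∀ (φ₀ σ₀ : ℝ) (x₀ : Vec n), ‖x₀ - v φ₀ σ₀‖ ≤ ε →
        (∃ x, IsPerturbedTrajectory (fun x => f x p) T dode x₀ x) ∧
        ∀ x, IsPerturbedTrajectory (fun x => f x p) T dode x₀ x →
          ∃ φ σ : ℝ → ℝ,
            IsPhaseDecomposition v lT lρ x φ σ ∧ |φ 0 - φ₀| ≤ r ∧ |σ 0 - σ₀| ≤ r ∧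
            DifferentiableOn ℝ φ (Set.Ici 0) ∧ DifferentiableOn ℝ σ (Set.Ici 0) ∧
            (∀ τ ≥ 0,
              ‖x τ - v (φ τ) (σ τ)‖ ≤ C * ε ∧
              |derivWithin φ (Set.Ici 0) τ - -inner ℝ (lρ (φ τ) (σ τ)) (dode τ)| ≤ C * ε ^ 2 ∧
              |derivWithin σ (Set.Ici 0) τ - (1 + inner ℝ (lT (φ τ) (σ τ)) (dode τ) / T)|
                ≤ C * ε ^ 2) ∧
            ∀ φ' σ' : ℝ → ℝ, IsPhaseDecomposition v lT lρ x φ' σ' →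
              |φ' 0 - φ₀| ≤ r → |σ' 0 - σ₀| ≤ r →
              Set.EqOn φ' φ (Set.Ici 0) ∧ Set.EqOn σ' σ (Set.Ici 0)) ∧
    -- comparison of unforced trajectories
    (∃ d₀ > 0, ∃ C > 0, ∀ (φ₀ σ₀ : ℝ) (d : Vec n), ‖d‖ ≤ d₀ → ∀ τ ≥ 0,
      FlowDefined (fun x => f x p) (T * τ) (v φ₀ σ₀ + d) ∧
      FlowDefined (fun x => f x p) (T * τ)
        (v (φ₀ - inner ℝ (lρ φ₀ σ₀) d) (σ₀ + inner ℝ (lT φ₀ σ₀) d / T)) ∧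
      ‖flow (fun x => f x p) (T * τ) (v φ₀ σ₀ + d) -
        flow (fun x => f x p) (T * τ)
          (v (φ₀ - inner ℝ (lρ φ₀ σ₀) d) (σ₀ + inner ℝ (lT φ₀ σ₀) d / T))‖
        ≤ C * ‖d‖ ^ 2 + C * Real.exp (-τ / τtr)) ∧
    -- the adjoint solutions give the linearization of the asymptotic phases
    (∃ d₀ > 0, ∃ r > 0, ∃ C > 0, ∀ (φ₀ σ₀ : ℝ) (d : Vec n), ‖d‖ ≤ d₀ →
      ∃ φs σs : ℝ, IsAsymptoticPhase (fun x => f x p) T v (v φ₀ σ₀ + d) φs σs ∧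
        |φs - φ₀| ≤ r ∧ |σs - σ₀| ≤ r ∧
        |φs - (φ₀ - inner ℝ (lρ φ₀ σ₀) d)| ≤ C * ‖d‖ ^ 2 ∧
        |σs - (σ₀ + inner ℝ (lT φ₀ σ₀) d / T)| ≤ C * ‖d‖ ^ 2 ∧
        ∀ φ' σ' : ℝ, IsAsymptoticPhase (fun x => f x p) T v (v φ₀ σ₀ + d) φ' σ' →
          |φ' - φ₀| ≤ r → |σ' - σ₀| ≤ r → φ' = φs ∧ σ' = σs) := by
  have hg2 : ContDiff ℝ 2 (fun x => f x p) := hf.comp (contDiff_id.prodMk contDiff_const)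
  have hg1 : ContDiff ℝ 1 (fun x => f x p) := hg2.of_le (by norm_num)
  have hΛ := adjointFrame_apply T lT lρ
  obtain ⟨gt, B, K, hgt, hB, hagree, F⟩ := exists_phaseFrame hg2 hT hρ hv hst hh hlT hlρ
  exact ⟨F.perturbed_phase_dynamics hg1 hgt hB hagree hΛ, F.flow_comparison hg1 hgt hB hagree hΛ,
    F.asymptotic_phase_linearization hg1 hgt hB hagree hΛ⟩
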